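/- **Setting.** Let $n\ge 1$, $k\ge 0$, and let $Cl_{n+1}$ be the real Clifford algebra generated by $\mathbb{R}^{n+1}=\mathrm{span}(e_1,\dots,e_{n+1})$ with $x^2=-\|x\|^2$; let $\mathbb{R}^n=\mathrm{span}(e_1,\dots,e_n)$, and let $\mathbb{S}^n\subset\mathbb{R}^{n+1}$, $\mathbb{S}^{n-1}\subset\mathbb{R}^n$ be the unit spheres. Let $\mathcal{M}_k$ (resp. $\overline{\mathcal{M}_k}$) be the space of $Cl_{n+1}$-valued polynomials $p$ on $\mathbb{R}^n$, homogeneous of degree $k$, with $\sum_{j=1}^n e_j\,\partial p/\partial u_j=0$ (resp. $\sum_{j=1}^n (\partial p/\partial u_j)\,e_j=0$), and put $\mathcal{M}_{-1}=\overline{\mathcal{M}_{-1}}=0$. The space $\mathcal{H}_k$ of harmonic $Cl_{n+1}$-valued polynomials homogeneous of degree $k$ decomposes as $\mathcal{H}_k=\mathcal{M}_k\oplus u\,\mathcal{M}_{k-1}=\overline{\mathcal{M}_k}\oplus\overline{\mathcal{M}_{k-1}}\,u$; let $P_k:\mathcal{H}_k\to\mathcal{M}_k$ and $P_{k,r}:\mathcal{H}_k\to\overline{\mathcal{M}_k}$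 be the corresponding projections. Let $$D_s=w\Big(\Lambda+\frac n2\Big),\qquad \Lambda=\sum_{1\le i<j\le n+1}e_ie_j\Big(w_i\frac{\partial}{\partial w_j}-w_j\frac{\partial}{\partial w_i}\Big),\qquad w\in\mathbb{S}^n,$$ be the spherical Dirac operator. It acts on functions from the left, and from the right by $$gD_s=\sum_{i<j}\Big(w_i\frac{\partial g}{\partial w_j}-w_j\frac{\partial g}{\partial w_i}\Big)\,w\,e_ie_j+\frac n2\,g\,w .$$ For functions $f(x_s,u)$, $g(x_s,u)$ set $R_k^Sf=P_kD_{s,x_s}f$ and $gR_k^S=gD_{s,x_s}P_{k,r}$, and for polynomials $P,Q$ set $(P(u),Q(u))_u=\int_{\mathbb{S}^{n-1}}P(u)Q(u)\,ds(u)$. **Cauchy's Theorem.** Let $U_s\subseteq\mathbb{S}^n$ be a domain and let $V_s\subseteq U_s$ be a subdomain whose boundary $\partial V_s$ in $\mathbb{S}^n$ is contained in $U_s$ and is a $C^1$ hypersurface of $\mathbb{S}^n$ with $V_s$ locally on one side of it. Let $n(x_s)$ be the unit vector tangent to $\mathbb{S}^n$ at $x_s\in\partial V_s$, orthogonal to $\partial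 V_s$ and pointing out of $V_s$, and let $d\Sigma$ be the $(n-1)$-dimensional surface measure on $\partial V_s$. Let $f,g:U_s\times\mathbb{R}^n\to Cl_{n+1}$ be $C^1$ functions such that $f(x_s,\cdot)\in\mathcal{M}_k$ and $g(x_s,\cdot)\in\overline{\mathcal{M}_k}$ for every $x_s\in U_s$. If $R_k^Sf=0$ and $gR_k^S=0$ on $U_s\times\mathbb{R}^n$, then $x_s\mapsto (g(x_s,u),P_kn(x_s)f(x_s,u))_u$ is integrable over $\partial V_s$ and $$\int_{\partial V_s}\big(g(x_s,u),\,P_k\,n(x_s)f(x_s,u)\big)_u\,d\Sigma(x_s)=0 .$$ -/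

import Mathlib

open MeasureTheory Set Metric Topology
open scoped Manifold ContDiff Gradient

noncomputable section

namespace SphericalRS

/-- Euclidean space `ℝᵐ`. -/
abbrev E (m : ℕ) : Type := EuclideanSpace ℝ (Fin m)

/-- The unit sphere `𝕊ⁿ ⊆ ℝⁿ⁺¹`. -/
abbrev Sph (n : ℕ) : Type := sphere (0 : E (n + 1)) 1

/-! ### The Clifford algebra `Cl_{n+1}` -/

/-- The quadratic form `x ↦ -‖x‖²` on `ℝⁿ⁺¹`. -/
def negSq (n : ℕ) : QuadraticForm ℝ (E (n + 1)) :=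
  -LinearMap.BilinMap.toQuadraticMap (innerₗ (E (n + 1)))

theorem negSq_apply (n : ℕ) (x : E (n + 1)) : negSq n x = -‖x‖ ^ 2 := by
  simp [negSq]

/-- The real Clifford algebra `Cl_{n+1}`, with `x * x = -‖x‖²` for `x ∈ ℝⁿ⁺¹`. -/
abbrev Cl (n : ℕ) : Type := CliffordAlgebra (negSq n)

/-- The inclusion of vectors `ℝⁿ⁺¹ ⊆ Cl_{n+1}`. -/
def vec {n : ℕ} (x : E (n + 1)) : Cl n := CliffordAlgebra.ι (negSq n) x

/-- The standard basis vector `e_i` as an element of `Cl_{n+1}`. -/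
def e {n : ℕ} (i : Fin (n + 1)) : Cl n := vec (EuclideanSpace.single i 1)

/-- The inclusion `ℝⁿ = span (e_1, …, e_n) ⊆ Cl_{n+1}`. -/
def vecN {n : ℕ} (u : E n) : Cl n := ∑ j : Fin n, u j • e j.castSucc

theorem vec_mul_self {n : ℕ} (x : E (n + 1)) :
    vec x * vec x = algebraMap ℝ (Cl n) (-‖x‖ ^ 2) := by
  rw [vec, CliffordAlgebra.ι_sq_scalar, negSq_apply]

/-- The basis `e_A = e_{j_1} ⋯ e_{j_r}` of `Cl_{n+1}`, indexed by the subsets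
`A = {j_1 < ⋯ < j_r}` of the index set. -/
def basisCl (n : ℕ) : Module.Basis (Finset (Fin (n + 1))) ℝ (Cl n) :=
  ((EuclideanSpace.basisFun (Fin (n + 1)) ℝ).toBasis.ExteriorAlgebra).map
    (CliffordAlgebra.equivExterior (negSq n)).symm

/-- The coordinates `a ↦ (a_A)_A`, seen in a Euclidean space. -/
def coordCl (n : ℕ) : Cl n ≃ₗ[ℝ] EuclideanSpace ℝ (Finset (Fin (n + 1))) :=
  (basisCl n).equivFun.trans (WithLp.linearEquiv 2 ℝ (Finset (Fin (n + 1)) → ℝ)).symm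

/-- The norm `‖a‖² = ∑_A a_A²` on the (finite dimensional) Clifford algebra. -/
instance instNormedAddCommGroupCl (n : ℕ) : NormedAddCommGroup (Cl n) :=
  NormedAddCommGroup.induced (Cl n) (EuclideanSpace ℝ (Finset (Fin (n + 1))))
    (coordCl n) (coordCl n).injective

instance instNormedSpaceCl (n : ℕ) : NormedSpace ℝ (Cl n) :=
  NormedSpace.induced ℝ (Cl n) (EuclideanSpace ℝ (Finset (Fin (n + 1))))
    (coordCl n).toLinearMap

/-! ### Monogenic polynomials on `ℝⁿ` and the Almansi-Fischer projections -/

/-- `p : ℝⁿ → Cl_{n+1}` is a polynomial, homogeneous of degree `k`: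
`p(u) = ∑_{|α| = k} u^α c_α` with coefficients `c_α ∈ Cl_{n+1}`. -/
def IsHomPoly {n : ℕ} (k : ℕ) (p : E n → Cl n) : Prop :=
  ∃ c : (Fin n → ℕ) → Cl n, ∀ u : E n,
    p u = ∑ α ∈ Finset.piAntidiag (Finset.univ : Finset (Fin n)) k, (∏ i, u i ^ α i) • c α

/-- The Dirac operator `D p = ∑_{j=1}^n e_j ∂p/∂u_j` of `ℝⁿ`, acting from the left. -/
def diracL {n : ℕ} (p : E n → Cl n) (u : E n) : Cl n :=
  ∑ j : Fin n, e j.castSucc * fderiv ℝ p u (EuclideanSpace.single j 1)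

/-- The Dirac operator `p D = ∑_{j=1}^n ∂p/∂u_j e_j` of `ℝⁿ`, acting from the right. -/
def diracR {n : ℕ} (p : E n → Cl n) (u : E n) : Cl n :=
  ∑ j : Fin n, fderiv ℝ p u (EuclideanSpace.single j 1) * e j.castSucc

/-- The space `𝓜_k` of left monogenic polynomials homogeneous of degree `k`. -/
def monogenicL (n k : ℕ) : Set (E n → Cl n) :=
  {p | IsHomPoly k p ∧ ∀ u, diracL p u = 0}

/-- The space of right monogenic polynomials homogeneous of degree `k`. -/
def monogenicR (n k : ℕ) : Set (E n → Cl n) :=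
  {p | IsHomPoly k p ∧ ∀ u, diracR p u = 0}

/-- The complement `u 𝓜_{k-1}` of `𝓜_k` in the harmonic polynomials homogeneous of degree `k`
(zero for `k = 0`). -/
def complL (n : ℕ) : ℕ → Set (E n → Cl n)
  | 0 => {0}
  | k + 1 => {h | ∃ q ∈ monogenicL n k, ∀ u, h u = vecN u * q u}

/-- The complement of the right monogenic polynomials: products `q(u) u` with `q` right monogenic
homogeneous of degree `k - 1` (zero for `k = 0`). -/
def complR (n : ℕ) : ℕ → Set (E n → Cl n)
  | 0 => {0}
  | k + 1 => {h | ∃ q ∈ monogenicR n k, ∀ u, h u = q u * vecN u}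

open Classical in
/-- The left projection `P_k : 𝓗_k = 𝓜_k ⊕ u 𝓜_{k-1} → 𝓜_k`; `0` off `𝓜_k + u 𝓜_{k-1}`. -/
def projL {n : ℕ} (k : ℕ) (h : E n → Cl n) : E n → Cl n :=
  if H : ∃ p ∈ monogenicL n k, h - p ∈ complL n k then H.choose else 0

open Classical in
/-- The right projection `P_{k,r}` from `𝓗_k` onto the right monogenic polynomials. -/
def projR {n : ℕ} (k : ℕ) (h : E n → Cl n) : E n → Cl n :=
  if H : ∃ p ∈ monogenicR n k, h - p ∈ complR n k then H.choose else 0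

/-! ### The spherical Dirac and Rarita-Schwinger type operators -/

open Classical in
/-- The extension of a function on `𝕊ⁿ` to `ℝⁿ⁺¹ \ {0}` that is constant along rays. -/
def radialExt {n : ℕ} (F : Sph n → Cl n) (y : E (n + 1)) : Cl n :=
  if hy : ‖y‖⁻¹ • y ∈ sphere (0 : E (n + 1)) 1 then F ⟨‖y‖⁻¹ • y, hy⟩ else 0

/-- `w_i ∂F/∂w_j - w_j ∂F/∂w_i` at `w ∈ 𝕊ⁿ`. This is a derivative in a direction tangent to the
sphere, so any extension of `F` to a neighbourhood may be used to compute it. -/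
def angular {n : ℕ} (i j : Fin (n + 1)) (F : Sph n → Cl n) (w : Sph n) : Cl n :=
  fderiv ℝ (radialExt F) w
    ((w : E (n + 1)) i • EuclideanSpace.single j 1 - (w : E (n + 1)) j • EuclideanSpace.single i 1)

/-- The spherical Dirac operator `D_s F = w (Λ + n/2) F`, where
`Λ = ∑_{i<j} e_i e_j (w_i ∂/∂w_j - w_j ∂/∂w_i)`. -/
def sphDiracL {n : ℕ} (F : Sph n → Cl n) (w : Sph n) : Cl n :=
  vec (w : E (n + 1)) *
    ((∑ i : Fin (n + 1), ∑ j ∈ Finset.Ioi i, e i * e j * angular i j F w)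
      + ((n : ℝ) / 2) • F w)

/-- The spherical Dirac operator acting from the right: the Clifford coefficients `w e_i e_j` and
`w` of `D_s` multiply the derivatives of `G` from the right. -/
def sphDiracR {n : ℕ} (G : Sph n → Cl n) (w : Sph n) : Cl n :=
  (∑ i : Fin (n + 1), ∑ j ∈ Finset.Ioi i,
      angular i j G w * (vec (w : E (n + 1)) * e i * e j))
    + ((n : ℝ) / 2) • (G w * vec (w : E (n + 1)))

/-- The left operator `R_k^S f(x, u) = P_k D_{s,x} f(x, u)`. -/
def raritaL {n : ℕ} (k : ℕ) (f : Sph n → E n → Cl n) (x : Sph n) : E n → Cl n :=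
  projL k fun u => sphDiracL (fun y => f y u) x

/-- The right operator `g(x, u) R_k^S = g(x, u) D_{s,x} P_{k,r}`. -/
def raritaR {n : ℕ} (k : ℕ) (g : Sph n → E n → Cl n) (x : Sph n) : E n → Cl n :=
  projR k fun u => sphDiracR (fun y => g y u) x

/-- `f(x, u)` is of class `C¹` on `U × ℝⁿ`. -/
def IsC1On {n : ℕ} (U : Set (Sph n)) (f : Sph n → E n → Cl n) : Prop :=
  ContMDiffOn ((𝓡 n).prod 𝓘(ℝ, E n)) 𝓘(ℝ, Cl n) 1
    (fun z : Sph n × E n => f z.1 z.2) (U ×ˢ univ)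

/-- The pairing `(P, Q)_u = ∫_{𝕊ⁿ⁻¹} P(u) Q(u) ds(u)`, with `ds` the surface measure. -/
def pairing {n : ℕ} (P Q : E n → Cl n) : Cl n :=
  ∫ u : sphere (0 : E n) 1, P u * Q u ∂((volume : Measure (E n)).toSphere)

/-! ### Subdomains of the sphere with `C¹` boundary -/

/-- The component of `∇ρ(p)` tangent to the sphere at `p`. -/
def tanGrad {n : ℕ} (ρ : E (n + 1) → ℝ) (p : Sph n) : E (n + 1) :=
  ∇ ρ p - inner ℝ (p : E (n + 1)) (∇ ρ p) • (p : E (n + 1))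

/-- `ρ` is a `C¹` defining function of `V` near `p`: `V = {ρ < 0}` near `p`, and the differential
of `ρ` along the sphere does not vanish at `p`. -/
def IsDefiningAt {n : ℕ} (V : Set (Sph n)) (p : Sph n) (ρ : E (n + 1) → ℝ) : Prop :=
  ContDiffAt ℝ 1 ρ p ∧ tanGrad ρ p ≠ 0 ∧ ∀ᶠ x : Sph n in 𝓝 p, x ∈ V ↔ ρ x < 0

/-- The boundary of `V` in `𝕊ⁿ` is a `C¹` hypersurface with `V` on one side of it. -/
def HasC1Boundary {n : ℕ} (V : Set (Sph n)) : Prop :=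
  ∀ p ∈ frontier V, ∃ ρ : E (n + 1) → ℝ, IsDefiningAt V p ρ

open Classical in
/-- The unit vector tangent to the sphere at `p ∈ ∂V`, orthogonal to `∂V` and pointing out of `V`:
the normalized tangential gradient of a defining function (it does not depend on the choice). -/
def outwardNormal {n : ℕ} (V : Set (Sph n)) (p : Sph n) : E (n + 1) :=
  if H : ∃ ρ, IsDefiningAt V p ρ then ‖tanGrad H.choose p‖⁻¹ • tanGrad H.choose p else 0

/-- The `(n-1)`-dimensional surface measure `dΣ` on hypersurfaces of `𝕊ⁿ`: Hausdorff measure,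
normalized so as to agree with Lebesgue measure on `ℝⁿ⁻¹`. -/
def surfaceMeasure (n : ℕ) : Measure (Sph n) := Measure.euclideanHausdorffMeasure (n - 1)

/-- The integrand `(g(x, u), P_k n(x) f(x, u))_u` at `x ∈ ∂V`. -/
def boundaryForm {n : ℕ} (k : ℕ) (V : Set (Sph n)) (f g : Sph n → E n → Cl n) (x : Sph n) : Cl n :=
  pairing (g x) (projL k fun u => vec (outwardNormal V x) * f x u)

end SphericalRS

end

/-! The statement is a divergence theorem in disguise. Fix a real linear functional `l` on the
Clifford algebra and expand `f = ∑ c i • b i`, `g = ∑ c' j • b' j` in bases of left and right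
monogenic polynomials, with real C¹ coefficients on the sphere. A product `c b` satisfies `D_s (c b)
= (n/2 c w - ∇c) b`, and from the right the same vector multiplies from the right
(`sphDiracL_sum_smul`, `sphDiracR_sum_smul`). The pairing `a, b ↦ ∫ a b` over the unit sphere
annihilates the complements `u 𝓜_{k-1}` and its right analogue: this is Stokes for `a u b`, as `∑
∂_l (a e_l b) = 0` (`integral_mul_vecN_mul_eq_zero`). So the projections can be dropped under the
pairing, once it is known that a vector times a monogenic polynomial has a decomposition
(`vec_mul_mem_sup`), and both Rarita-Schwinger equations become scalar identities on the
coefficients.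

Let `M j i` represent `v ↦ l (b' j, v b i)_u`, and let `X` be the sum of the tangential parts of `c'
j c i M j i`. Then `l` of the boundary integrand is `⟨ν, X⟩`. The spherical divergence of `X` is the
sum of `⟨M j i, c' j ∇c i + c i ∇c' j - n c' j c i w⟩`; half of the curvature term `n w` goes to
each factor, and the two halves vanish by the equations for `f` and for `g`. This is where the
constant `n/2` in `D_s` is needed.

The divergence theorem on a spherical domain with C¹ boundary, with Hausdorff measure on the
boundary (`integral_boundary_eq_zero`), is proved without an area formula. The field is extended to
be constant along rays and multiplied by a radial cutoff, so that the domain becomes a cone in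
Euclidean space; the cutoff contributes only the factor `radialMoment`. Near a boundary point the
cone is a subgraph, and a shear reduces the flux to an integral over a hyperplane. In a small enough
neighbourhood the graph is almost flat and its parametrization almost isometric, so flux and
boundary integral of a field `Y` supported there differ by at most `ε ∫ ‖Y‖`
(`exists_local_estimate`). In a partition of unity these errors add up to `ε ∫ ‖X‖`, however fine
the cover, and `ε` is arbitrary. -/

noncomputable section

namespace SphericalRS

/-! ### Divergence theorem for subgraphs of C¹ functions. -/

section Subgraph

variable {H : Type*} [NormedAddCommGroup H] [NormedSpace ℝ H] [FiniteDimensional ℝ H]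
  [MeasurableSpace H] [BorelSpace H] (μ : Measure H) [μ.IsAddHaarMeasure]

theorem integral_fderiv_apply_eq_zero {f : H → ℝ} (hf : ContDiff ℝ 1 f)
    (hc : HasCompactSupport f) (h : H) : ∫ z, fderiv ℝ f z h ∂μ = 0 := by
  have hcont : Continuous fun z => fderiv ℝ f z h :=
    (hf.continuous_fderiv one_ne_zero).clm_apply continuous_const
  have hsupp : HasCompactSupport fun z => fderiv ℝ f z h :=
    (hc.fderiv (𝕜 := ℝ)).comp_left (g := fun A : H →L[ℝ] ℝ => A h) rfl
  have := integral_mul_fderiv_eq_neg_fderiv_mul_of_integrable (μ := μ) (f := fun _ : H => (1 : ℝ))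
    (g := f) (v := h) (by simp) (by simpa using hcont.integrable_of_hasCompactSupport hsupp)
    (by simpa using hf.continuous.integrable_of_hasCompactSupport hc)
    (fun _ _ => differentiableAt_const _) (fun z _ => hf.differentiable one_ne_zero z)
  simpa using this

theorem integral_halfSpace_fderiv_snd {ξ : ℝ × H → ℝ} (hξ : ContDiff ℝ 1 ξ)
    (hc : HasCompactSupport ξ) (h : H) :
    ∫ p in Iio (0 : ℝ) ×ˢ (univ : Set H), fderiv ℝ ξ p (0, h) ∂(volume.prod μ) = 0 := by
  have hcont : Continuous fun p => fderiv ℝ ξ p (0, h) :=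
    (hξ.continuous_fderiv one_ne_zero).clm_apply continuous_const
  have hsupp : HasCompactSupport fun p => fderiv ℝ ξ p (0, h) :=
    (hc.fderiv (𝕜 := ℝ)).comp_left (g := fun A : ℝ × H →L[ℝ] ℝ => A (0, h)) rfl
  have hint : Integrable (fun p => fderiv ℝ ξ p (0, h)) (volume.prod μ) :=
    hcont.integrable_of_hasCompactSupport hsupp
  rw [setIntegral_prod _ hint.integrableOn]
  refine (setIntegral_congr_fun measurableSet_Iio fun τ _ => ?_).trans (integral_zero _ _)
  simp only [Measure.restrict_univ]
  have h1 : ContDiff ℝ 1 fun z => ξ (τ, z) := hξ.comp (contDiff_const.prodMk contDiff_id)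
  have h2 : HasCompactSupport fun z => ξ (τ, z) :=
    hc.comp_isClosedEmbedding
      (Isometry.of_dist_eq (f := fun z : H => (τ, z)) (by simp [Prod.dist_eq])).isClosedEmbedding
  refine Eq.trans ?_ (integral_fderiv_apply_eq_zero μ h1 h2 h)
  congr 1 with z
  have := ((hξ.differentiable one_ne_zero (τ, z)).hasFDerivAt.comp z
    ((hasFDerivAt_const τ z).prodMk (hasFDerivAt_id z))).fderiv
  simp only [Function.comp_def] at this
  rw [this]
  simp

theorem integral_halfSpace_fderiv_fst {ξ : ℝ × H → ℝ} (hξ : ContDiff ℝ 1 ξ)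
    (hc : HasCompactSupport ξ) {g : H → ℝ} (hg : Continuous g) :
    ∫ p in Iio (0 : ℝ) ×ˢ (univ : Set H), g p.2 * fderiv ℝ ξ p (1, 0) ∂(volume.prod μ) =
      ∫ z, g z * ξ (0, z) ∂μ := by
  have hcont : Continuous fun p : ℝ × H => g p.2 * fderiv ℝ ξ p (1, 0) :=
    (hg.comp continuous_snd).mul ((hξ.continuous_fderiv one_ne_zero).clm_apply continuous_const)
  have hsupp : HasCompactSupport fun p : ℝ × H => g p.2 * fderiv ℝ ξ p (1, 0) :=
    ((hc.fderiv (𝕜 := ℝ)).comp_left (g := fun A : ℝ × H →L[ℝ] ℝ => A (1, 0)) rfl).mul_left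
  have hint : Integrable (fun p : ℝ × H => g p.2 * fderiv ℝ ξ p (1, 0)) (volume.prod μ) :=
    hcont.integrable_of_hasCompactSupport hsupp
  rw [← Measure.prod_restrict, integral_prod_symm _ (by
    rw [Measure.prod_restrict]; exact hint.integrableOn), Measure.restrict_univ]
  congr 1 with z
  simp only
  rw [integral_const_mul]
  congr 1
  have h1 : ContDiff ℝ 1 fun t => ξ (t, z) := hξ.comp (contDiff_id.prodMk contDiff_const)
  have h2 : HasCompactSupport fun t => ξ (t, z) :=
    hc.comp_isClosedEmbedding
      (Isometry.of_dist_eq (f := fun t : ℝ => (t, z)) (by simp [Prod.dist_eq])).isClosedEmbedding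
  rw [← h2.integral_Iic_deriv_eq h1 0, integral_Iic_eq_integral_Iio]
  congr 1 with t
  have := ((hξ.differentiable one_ne_zero (t, z)).hasFDerivAt.comp t
    ((hasFDerivAt_id t).prodMk (hasFDerivAt_const z t))).hasDerivAt.deriv
  simp only [Function.comp_def, id] at this
  rw [this]
  simp

theorem measurePreserving_shear {φ : H → ℝ} (hφ : Continuous φ) :
    MeasurePreserving (fun p : ℝ × H => (φ p.2 + p.1, p.2)) (volume.prod μ) (volume.prod μ) := by
  have h := (MeasurePreserving.id μ).skew_product (μa := μ) (μc := (volume : Measure ℝ))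
    (μd := (volume : Measure ℝ)) (g := fun z t => φ z + t) (by fun_prop)
    (Filter.Eventually.of_forall fun z => (measurePreserving_add_left volume (φ z)).map_eq)
  exact (Measure.measurePreserving_swap.comp h).comp Measure.measurePreserving_swap

/-- Translation of the graph of `φ` to the hyperplane `t = 0`. -/
def shearHomeomorph {φ : H → ℝ} (hφ : Continuous φ) : ℝ × H ≃ₜ ℝ × H where
  toFun p := (φ p.2 + p.1, p.2)
  invFun p := (p.1 - φ p.2, p.2)
  left_inv p := by simp
  right_inv p := by simp
  continuous_toFun := by fun_prop
  continuous_invFun := by fun_prop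

theorem setIntegral_subgraph_eq {φ : H → ℝ} (hφ : Continuous φ) (f : ℝ × H → ℝ) :
    ∫ p in {p : ℝ × H | p.1 < φ p.2}, f p ∂(volume.prod μ) =
      ∫ p in Iio (0 : ℝ) ×ˢ (univ : Set H), f (φ p.2 + p.1, p.2) ∂(volume.prod μ) := by
  rw [← (measurePreserving_shear μ hφ).setIntegral_preimage_emb
    (shearHomeomorph hφ).measurableEmbedding f]
  congr 2
  ext p
  simp [add_lt_iff_neg_left]

/-- The volume preserving shear by `φ` flattens the graph to the hyperplane `t = 0`. The factor on
the right is the pairing of the direction `(a, h)` with the unnormalized outward conormal `(1,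
-dφ)`. -/
theorem integral_subgraph_fderiv {φ : H → ℝ} (hφ : ContDiff ℝ 1 φ) {ζ : ℝ × H → ℝ}
    (hζ : ContDiff ℝ 1 ζ) (hc : HasCompactSupport ζ) (a : ℝ) (h : H) :
    ∫ p in {p : ℝ × H | p.1 < φ p.2}, fderiv ℝ ζ p (a, h) ∂(volume.prod μ) =
      ∫ z, (a - fderiv ℝ φ z h) * ζ (φ z, z) ∂μ := by
  rw [setIntegral_subgraph_eq μ hφ.continuous]
  set ξ : ℝ × H → ℝ := fun p => ζ (φ p.2 + p.1, p.2) with hξdef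
  have hξ : ContDiff ℝ 1 ξ := hζ.comp (by fun_prop)
  have hξc : HasCompactSupport ξ := hc.comp_homeomorph (shearHomeomorph hφ.continuous)
  have hder : ∀ p (b : ℝ) (k : H), fderiv ℝ ξ p (b, k) =
      fderiv ℝ ζ (φ p.2 + p.1, p.2) (fderiv ℝ φ p.2 k + b, k) := by
    intro p b k
    have h1 : HasFDerivAt (fun p : ℝ × H => (φ p.2 + p.1, p.2)) _ p :=
      ((((hφ.differentiable one_ne_zero) p.2).hasFDerivAt.comp p hasFDerivAt_snd).add
        hasFDerivAt_fst).prodMk hasFDerivAt_snd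
    have := (((hζ.differentiable one_ne_zero) (φ p.2 + p.1, p.2)).hasFDerivAt.comp p h1).fderiv
    simp only [Function.comp_def] at this
    rw [hξdef, this]
    simp
  -- The direction is split into one along the flattened boundary, which integrates to zero on every
  -- slice, and a multiple of the transversal direction. The coefficient of the latter does not
  -- depend on `t`, so the fundamental theorem of calculus applies in `t`.
  have hsplit : ∀ p : ℝ × H, fderiv ℝ ζ (φ p.2 + p.1, p.2) (a, h) =
      fderiv ℝ ξ p (0, h) + (a - fderiv ℝ φ p.2 h) * fderiv ℝ ξ p (1, 0) := by
    intro p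
    rw [hder, hder, ← smul_eq_mul, ← map_smul, ← map_add]
    simp
  have hφ' : Continuous fun z => a - fderiv ℝ φ z h :=
    continuous_const.sub ((hφ.continuous_fderiv one_ne_zero).clm_apply continuous_const)
  have hc1 : HasCompactSupport (fderiv ℝ ξ) := hξc.fderiv (𝕜 := ℝ)
  have hc2 : Continuous (fderiv ℝ ξ) := hξ.continuous_fderiv one_ne_zero
  simp_rw [hsplit]
  rw [integral_add, integral_halfSpace_fderiv_snd μ hξ hξc,
    integral_halfSpace_fderiv_fst μ hξ hξc hφ']
  · simp [hξdef]
  · exact (Continuous.integrable_of_hasCompactSupport (by fun_prop)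
      (hc1.comp_left (g := fun A : ℝ × H →L[ℝ] ℝ => A (0, h)) rfl)).integrableOn
  · exact (Continuous.integrable_of_hasCompactSupport
      ((hφ'.comp continuous_snd).mul (by fun_prop))
      (hc1.comp_left (g := fun A : ℝ × H →L[ℝ] ℝ => A (1, 0)) rfl).mul_left).integrableOn

end Subgraph

/-! ### Almost equal measures, and Hausdorff measure under almost isometries. -/

section Comparison

theorem integral_le_of_measure_le {X : Type*} [MeasurableSpace X] {κ₁ κ₂ : Measure X} {C : ℝ}
    (hC : 0 ≤ C) (h12 : κ₁ ≤ ENNReal.ofReal C • κ₂) {h : X → ℝ} (h0 : ∀ x, 0 ≤ h x)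
    (hh : Integrable h κ₂) : ∫ x, h x ∂κ₁ ≤ C * ∫ x, h x ∂κ₂ := by
  have := integral_mono_measure h12 (Filter.Eventually.of_forall h0)
    (hh.smul_measure ENNReal.ofReal_ne_top)
  rwa [integral_smul_measure, ENNReal.toReal_ofReal hC, smul_eq_mul] at this

/-- The two measure inequalities compare integrals of nonnegative functions; positive and negative
part are treated separately and recombined in `|h|`. -/
theorem abs_integral_sub_integral_le {X : Type*} [MeasurableSpace X] {κ₁ κ₂ : Measure X} {ε : ℝ}
    (hε : 0 ≤ ε) (h12 : κ₁ ≤ ENNReal.ofReal (1 + ε) • κ₂)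
    (h21 : κ₂ ≤ ENNReal.ofReal (1 + ε) • κ₁) {h : X → ℝ} (hh : Integrable h κ₁) :
    |∫ x, h x ∂κ₁ - ∫ x, h x ∂κ₂| ≤ 2 * ε * ∫ x, |h x| ∂κ₁ := by
  have hC : (0 : ℝ) ≤ 1 + ε := by linarith
  have hh2 : Integrable h κ₂ := (hh.smul_measure ENNReal.ofReal_ne_top).mono_measure h21
  have key : ∀ g : X → ℝ, (∀ x, 0 ≤ g x) → Integrable g κ₁ → Integrable g κ₂ →
      |∫ x, g x ∂κ₁ - ∫ x, g x ∂κ₂| ≤ 2 * ε * ∫ x, g x ∂κ₁ := by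
    intro g g0 g1 g2
    have a := integral_le_of_measure_le hC h12 g0 g2
    have b := integral_le_of_measure_le hC h21 g0 g1
    have c : 0 ≤ ∫ x, g x ∂κ₁ := integral_nonneg g0
    rw [abs_le]
    constructor <;> nlinarith [mul_nonneg hε c]
  have e1 : ∀ κ : Measure X, Integrable h κ →
      ∫ x, h x ∂κ = ∫ x, max (h x) 0 ∂κ - ∫ x, max (-h x) 0 ∂κ := by
    intro κ hκ
    rw [← integral_sub hκ.pos_part hκ.neg_part]
    simp only [max_zero_sub_eq_self]
  have e2 : ∫ x, |h x| ∂κ₁ = ∫ x, max (h x) 0 ∂κ₁ + ∫ x, max (-h x) 0 ∂κ₁ := by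
    rw [← integral_add hh.pos_part hh.neg_part]
    simp only [max_zero_add_max_neg_zero_eq_abs_self]
  have a := key (fun x => max (h x) 0) (fun x => le_max_right _ _) hh.pos_part hh2.pos_part
  have b := key (fun x => max (-h x) 0) (fun x => le_max_right _ _) hh.neg_part hh2.neg_part
  rw [e1 κ₁ hh, e1 κ₂ hh2, e2]
  rw [abs_le] at *
  constructor <;> linarith [a.1, a.2, b.1, b.2]

variable {X : Type*} [MetricSpace X] [MeasurableSpace X] [BorelSpace X] {m : ℕ}

theorem euclideanHausdorffMeasure_image_le {Y : Type*} [MetricSpace Y] [MeasurableSpace Y]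
    [BorelSpace Y] {K : NNReal} {Φ : Y → X} {B : Set Y} (hΦ : LipschitzOnWith K Φ B) (m : ℕ) :
    μHE[m] (Φ '' B) ≤ (K : ENNReal) ^ m * μHE[m] B := by
  simp only [Measure.euclideanHausdorffMeasure_def, Measure.smul_apply, ENNReal.smul_def,
    smul_eq_mul]
  have h := hΦ.hausdorffMeasure_image_le (d := (m : ℝ)) (by positivity)
  rw [ENNReal.rpow_natCast] at h
  calc _ ≤ _ := mul_le_mul_right h _
    _ = _ := by ring

/-- The lower distance bound makes `Φ` injective on `B` with `K`-Lipschitz inverse, to which the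
upper bound applies. -/
theorem le_euclideanHausdorffMeasure_image {Y : Type*} [MetricSpace Y] [MeasurableSpace Y]
    [BorelSpace Y] {K : NNReal} {Φ : Y → X} {B : Set Y}
    (hΦ : ∀ v ∈ B, ∀ w ∈ B, dist v w ≤ K * dist (Φ v) (Φ w)) (m : ℕ) :
    μHE[m] B ≤ (K : ENNReal) ^ m * μHE[m] (Φ '' B) := by
  rcases B.eq_empty_or_nonempty with rfl | hne
  · simp
  have : Nonempty Y := ⟨hne.some⟩
  have hinj : InjOn Φ B := fun v hv w hw h => by
    have := hΦ v hv w hw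
    rw [h, dist_self, mul_zero] at this
    exact dist_le_zero.1 this
  have hleft := hinj.leftInvOn_invFunOn
  have hL : LipschitzOnWith K (Function.invFunOn Φ B) (Φ '' B) := by
    refine LipschitzOnWith.of_dist_le_mul ?_
    rintro _ ⟨v, hv, rfl⟩ _ ⟨w, hw, rfl⟩
    rw [hleft hv, hleft hw]
    exact hΦ v hv w hw
  have := euclideanHausdorffMeasure_image_le hL m
  rwa [hleft.image_image] at this

/-- Hausdorff measure on the image of an almost isometric embedding of an open subset of `ℝᵐ`
is close to the image of Lebesgue measure. -/
theorem abs_setIntegral_image_sub_le {K : NNReal} {ε : ℝ} (hε : 0 ≤ ε)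
    (hK : (K : ℝ) ^ m ≤ 1 + ε) {Φ : E m → X} (hΦ : Measurable Φ) {B : Set (E m)}
    (hL : LipschitzOnWith K Φ B)
    (hA : ∀ v ∈ B, ∀ w ∈ B, dist v w ≤ K * dist (Φ v) (Φ w)) {h : X → ℝ}
    (hh : IntegrableOn h (Φ '' B) μHE[m]) (hm : Measurable h) :
    |∫ x in Φ '' B, h x ∂μHE[m] - ∫ v in B, h (Φ v)| ≤
      2 * ε * ∫ x in Φ '' B, |h x| ∂μHE[m] := by
  have hKE : (K : ENNReal) ^ m ≤ ENNReal.ofReal (1 + ε) := by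
    rw [← ENNReal.coe_pow, ENNReal.ofReal, ENNReal.coe_le_coe]
    exact NNReal.le_toNNReal_of_coe_le (by simpa using hK)
  -- On `ℝᵐ` the normalized Hausdorff measure is Lebesgue measure, so both comparisons of measures
  -- reduce to Lipschitz bounds for `Φ` and its inverse on measurable pieces of `B`.
  have hvol : ∀ s : Set (E m), volume s = μHE[m] s := fun s => by
    rw [EuclideanSpace.euclideanHausdorffMeasure_eq_volume]
  have himg : ∀ T : Set X, T ∩ Φ '' B = Φ '' (B ∩ Φ ⁻¹' T) := fun T => by
    rw [image_inter_preimage, inter_comm]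
  rw [← integral_map (φ := Φ) (f := h) hΦ.aemeasurable hm.aestronglyMeasurable]
  refine abs_integral_sub_integral_le hε ?_ ?_ hh
  · refine Measure.le_iff.2 fun T hT => ?_
    rw [Measure.restrict_apply hT, Measure.smul_apply, Measure.map_apply hΦ hT,
      Measure.restrict_apply (hΦ hT), smul_eq_mul, himg, inter_comm (Φ ⁻¹' T), hvol]
    exact (euclideanHausdorffMeasure_image_le (hL.mono inter_subset_left) m).trans (by gcongr)
  · refine Measure.le_iff.2 fun T hT => ?_
    rw [Measure.smul_apply, Measure.restrict_apply hT, Measure.map_apply hΦ hT,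
      Measure.restrict_apply (hΦ hT), smul_eq_mul, himg, inter_comm (Φ ⁻¹' T), hvol]
    exact (le_euclideanHausdorffMeasure_image
      (fun v hv w hw => hA v hv.1 w hw.1) m).trans (by gcongr)

end Comparison

/-! ### Radial projection onto the sphere, and cones. -/

section RadialProjection

variable {n : ℕ}

theorem inv_norm_smul_mem_sphere {y : E (n + 1)} (hy : y ≠ 0) :
    ‖y‖⁻¹ • y ∈ sphere (0 : E (n + 1)) 1 := by
  simp [norm_smul, hy]

open Classical in
/-- The radial projection `y ↦ y / ‖y‖` to the sphere (with an arbitrary value at `0`). -/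
def nproj (y : E (n + 1)) : Sph n :=
  if hy : ‖y‖⁻¹ • y ∈ sphere (0 : E (n + 1)) 1 then ⟨‖y‖⁻¹ • y, hy⟩
  else ⟨EuclideanSpace.single 0 1, by simp⟩

theorem coe_nproj {y : E (n + 1)} (hy : y ≠ 0) : (nproj y : E (n + 1)) = ‖y‖⁻¹ • y := by
  rw [nproj, dif_pos (inv_norm_smul_mem_sphere hy)]

theorem norm_coe_sph (w : Sph n) : ‖(w : E (n + 1))‖ = 1 := by simp

theorem coe_sph_ne_zero (w : Sph n) : (w : E (n + 1)) ≠ 0 := fun h => by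
  simpa [h] using norm_coe_sph w

theorem nproj_coe (w : Sph n) : nproj (w : E (n + 1)) = w := by
  ext1
  rw [coe_nproj (coe_sph_ne_zero w), norm_coe_sph, inv_one, one_smul]

theorem nproj_smul {r : ℝ} (hr : 0 < r) {y : E (n + 1)} (hy : y ≠ 0) :
    nproj (r • y) = nproj y := by
  ext1
  rw [coe_nproj (smul_ne_zero hr.ne' hy), coe_nproj hy, norm_smul, Real.norm_of_nonneg hr.le,
    smul_smul]
  congr 1
  field_simp

theorem smul_nproj {y : E (n + 1)} (hy : y ≠ 0) : ‖y‖ • (nproj y : E (n + 1)) = y := by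
  rw [coe_nproj hy, smul_smul, mul_inv_cancel₀ (norm_ne_zero_iff.2 hy), one_smul]

theorem continuousOn_nproj : ContinuousOn (nproj : E (n + 1) → Sph n) {0}ᶜ := by
  rw [Topology.IsInducing.subtypeVal.continuousOn_iff]
  refine ContinuousOn.congr (f := fun y : E (n + 1) => ‖y‖⁻¹ • y) ?_ fun y hy => coe_nproj hy
  exact (continuousOn_id.norm.inv₀ fun y hy => norm_ne_zero_iff.2 hy).smul continuousOn_id

theorem continuousAt_nproj {y : E (n + 1)} (hy : y ≠ 0) : ContinuousAt nproj y :=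
  continuousOn_nproj.continuousAt (isOpen_compl_singleton.mem_nhds hy)

theorem contDiffAt_coe_nproj {y : E (n + 1)} (hy : y ≠ 0) {k : ℕ∞} :
    ContDiffAt ℝ k (fun y => (nproj y : E (n + 1))) y := by
  have h : ContDiffAt ℝ k (fun y : E (n + 1) => ‖y‖⁻¹ • y) y :=
    ((contDiffAt_norm ℝ hy).inv (norm_ne_zero_iff.2 hy)).smul contDiffAt_id
  refine h.congr_of_eventuallyEq ?_
  filter_upwards [isOpen_compl_singleton.mem_nhds hy] with z hz using coe_nproj hz

theorem radialExt_eq (F : Sph n → Cl n) {y : E (n + 1)} (hy : y ≠ 0) :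
    radialExt F y = F (nproj y) := by
  rw [radialExt, dif_pos (inv_norm_smul_mem_sphere hy), nproj,
    dif_pos (inv_norm_smul_mem_sphere hy)]

/-- The open cone over a subset of the sphere. -/
def cone (V : Set (Sph n)) : Set (E (n + 1)) := {y | y ≠ 0 ∧ nproj y ∈ V}

theorem isOpen_cone {V : Set (Sph n)} (hV : IsOpen V) : IsOpen (cone V) :=
  continuousOn_nproj.isOpen_inter_preimage isOpen_compl_singleton hV

theorem coe_mem_cone {V : Set (Sph n)} {w : Sph n} : (w : E (n + 1)) ∈ cone V ↔ w ∈ V := by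
  simp [cone, nproj_coe, coe_sph_ne_zero w]

end RadialProjection

/-! ### Orthonormal coordinates adapted to a boundary point. -/

section Frame

/-- An orthonormal frame of `ℝᵐ⁺²`: a point `q` of the sphere, a tangent direction `ν` at `q`, and
an isometric parametrization `J` of their orthogonal complement. -/
structure Frame (m : ℕ) where
  q : E (m + 2)
  ν : E (m + 2)
  J : E m →ₗᵢ[ℝ] E (m + 2)
  norm_q : ‖q‖ = 1
  norm_ν : ‖ν‖ = 1
  inner_q_ν : inner ℝ q ν = 0
  inner_q_J : ∀ v, inner ℝ q (J v) = 0
  inner_ν_J : ∀ v, inner ℝ ν (J v) = 0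

theorem Frame.exists {m : ℕ} {q ν : E (m + 2)} (hq : ‖q‖ = 1) (hν : ‖ν‖ = 1)
    (hqν : inner ℝ q ν = 0) : ∃ fr : Frame m, fr.q = q ∧ fr.ν = ν := by
  have ho : Orthonormal ℝ ![q, ν] := by
    simp [orthonormal_iff_ite, Fin.forall_fin_two, hq, hν, hqν, real_inner_comm]
  set K : Submodule ℝ (E (m + 2)) := Submodule.span ℝ (range ![q, ν]) with hK
  have hKr : Module.finrank ℝ K = 2 := by
    simpa using finrank_span_eq_card ho.linearIndependent
  have hKo : Module.finrank ℝ Kᗮ = m := by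
    have := Submodule.finrank_add_finrank_orthogonal K
    rw [hKr, finrank_euclideanSpace_fin] at this
    omega
  have e : E m ≃ₗᵢ[ℝ] Kᗮ := ((stdOrthonormalBasis ℝ Kᗮ).reindex (finCongr hKo)).repr.symm
  have hm : ∀ i v, inner ℝ (![q, ν] i) (e v : E (m + 2)) = 0 := fun i v =>
    (Submodule.mem_orthogonal _ _).1 (e v).2 _ (Submodule.subset_span ⟨i, rfl⟩)
  exact ⟨⟨q, ν, Kᗮ.subtypeₗᵢ.comp e.toLinearIsometry, hq, hν, hqν, fun v => hm 0 v,
    fun v => hm 1 v⟩, rfl, rfl⟩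

namespace Frame

variable {m : ℕ} (fr : Frame m)

/-- The coordinates `(t, (s, v)) ↦ t ν + (s q + J v)`. -/
def lin : ℝ × (ℝ × E m) →ₗ[ℝ] E (m + 2) :=
  (LinearMap.toSpanSingleton ℝ _ fr.ν).coprod
    ((LinearMap.toSpanSingleton ℝ _ fr.q).coprod fr.J.toLinearMap)

theorem lin_apply (t s : ℝ) (v : E m) : fr.lin (t, (s, v)) = t • fr.ν + (s • fr.q + fr.J v) := rfl

theorem norm_sq_lin (t s : ℝ) (v : E m) :
    ‖fr.lin (t, (s, v))‖ ^ 2 = t ^ 2 + (s ^ 2 + ‖v‖ ^ 2) := by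
  have h1 : inner ℝ fr.ν fr.q = 0 := by rw [real_inner_comm]; exact fr.inner_q_ν
  rw [lin_apply, norm_add_sq_real, norm_add_sq_real, inner_add_right, inner_smul_left,
    inner_smul_left, inner_smul_right, inner_smul_left, h1, fr.inner_q_J, fr.inner_ν_J, norm_smul,
    norm_smul, fr.norm_q, fr.norm_ν, fr.J.norm_map]
  simp

theorem lin_injective : Function.Injective fr.lin := by
  rw [injective_iff_map_eq_zero]
  rintro ⟨t, s, v⟩ h
  have := fr.norm_sq_lin t s v
  rw [h, norm_zero] at this
  have h1 : t ^ 2 = 0 := by nlinarith [sq_nonneg t, sq_nonneg s, sq_nonneg ‖v‖]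
  have h2 : s ^ 2 = 0 := by nlinarith [sq_nonneg t, sq_nonneg s, sq_nonneg ‖v‖]
  have h3 : ‖v‖ ^ 2 = 0 := by nlinarith [sq_nonneg t, sq_nonneg s, sq_nonneg ‖v‖]
  simp_all

/-- The coordinates `(t, (s, v)) ↦ t ν + (s q + J v)` as a linear equivalence. -/
def coord : (ℝ × (ℝ × E m)) ≃L[ℝ] E (m + 2) :=
  (LinearEquiv.ofInjectiveOfFinrankEq fr.lin fr.lin_injective
    (by simp; omega)).toContinuousLinearEquiv

theorem coord_apply (t s : ℝ) (v : E m) :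
    fr.coord (t, (s, v)) = t • fr.ν + (s • fr.q + fr.J v) := rfl

theorem norm_sq_coord (t s : ℝ) (v : E m) :
    ‖fr.coord (t, (s, v))‖ ^ 2 = t ^ 2 + (s ^ 2 + ‖v‖ ^ 2) := fr.norm_sq_lin t s v

/-- The coordinates as an isometry of Euclidean spaces. -/
def isom : WithLp 2 (ℝ × WithLp 2 (ℝ × E m)) ≃ₗᵢ[ℝ] E (m + 2) where
  toLinearEquiv := ((WithLp.linearEquiv 2 ℝ (ℝ × WithLp 2 (ℝ × E m))).trans
    ((LinearEquiv.refl ℝ ℝ).prodCongr (WithLp.linearEquiv 2 ℝ (ℝ × E m)))).trans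
      fr.coord.toLinearEquiv
  norm_map' x := by
    rw [← sq_eq_sq₀ (norm_nonneg _) (norm_nonneg _), WithLp.prod_norm_sq_eq_of_L2,
      WithLp.prod_norm_sq_eq_of_L2]
    simp only [Real.norm_eq_abs, sq_abs]
    exact fr.norm_sq_coord x.fst x.snd.fst x.snd.snd

theorem measurePreserving_coord :
    MeasurePreserving fr.coord ((volume : Measure ℝ).prod ((volume : Measure ℝ).prod volume))
      volume := by
  have h1 := (MeasurePreserving.id (volume : Measure ℝ)).prod
    (WithLp.volume_preserving_toLp ℝ (E m))
  have h2 := WithLp.volume_preserving_toLp ℝ (WithLp 2 (ℝ × E m))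
  exact (fr.isom.measurePreserving.comp h2).comp h1

theorem trace_eq (A : E (m + 2) →ₗ[ℝ] E (m + 2)) :
    LinearMap.trace ℝ _ A = inner ℝ fr.ν (A fr.ν) + (inner ℝ fr.q (A fr.q) +
      ∑ i, inner ℝ (fr.J (EuclideanSpace.single i 1)) (A (fr.J (EuclideanSpace.single i 1)))) := by
  rw [LinearMap.trace_eq_sum_inner A (((OrthonormalBasis.singleton Unit ℝ).prod
    ((OrthonormalBasis.singleton Unit ℝ).prod (EuclideanSpace.basisFun (Fin m) ℝ))).map fr.isom)]
  have h : ∀ x, fr.isom x = fr.coord (x.fst, (x.snd.fst, x.snd.snd)) := fun _ => rfl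
  simp [h, coord_apply]

end Frame

end Frame

/-! ### The domain as a subgraph in central projection coordinates. -/

section LocalGraph

theorem hasFDerivAt_coe_nproj {n : ℕ} (w : Sph n) :
    HasFDerivAt (fun y : E (n + 1) => (nproj y : E (n + 1)))
      (ContinuousLinearMap.id ℝ (E (n + 1)) -
        (innerSL ℝ (w : E (n + 1))).smulRight (w : E (n + 1))) w := by
  have h1 : HasFDerivAt (fun y : E (n + 1) => ‖y‖) (innerSL ℝ (w : E (n + 1))) w := by
    have h := ((hasStrictFDerivAt_norm_sq (w : E (n + 1))).hasFDerivAt).sqrt (by simp)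
    simp only [Real.sqrt_sq (norm_nonneg _), norm_coe_sph] at h
    refine h.congr_fderiv ?_
    ext z
    simp
  have h2 := ((hasDerivAt_inv (x := ‖(w : E (n + 1))‖) (by simp)).comp_hasFDerivAt _ h1).smul
    (hasFDerivAt_id (w : E (n + 1)))
  refine (h2.congr_fderiv ?_).congr_of_eventuallyEq ?_
  · ext z : 1
    simp [sub_eq_add_neg]
  · filter_upwards [isOpen_compl_singleton.mem_nhds (coe_sph_ne_zero w)] with z hz
    simp [coe_nproj hz]

theorem contDiff_bump_mul {F : Type*} [NormedAddCommGroup F] [InnerProductSpace ℝ F]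
    {φ : F → ℝ} {c : F} (b : ContDiffBump c) {k : ℕ∞}
    (hφ : ∀ v ∈ closedBall c b.rOut, ContDiffAt ℝ k φ v) : ContDiff ℝ k fun v => b v * φ v := by
  rw [contDiff_iff_contDiffAt]
  intro v
  by_cases hv : v ∈ closedBall c b.rOut
  · exact b.contDiffAt.mul (hφ v hv)
  · refine (contDiffAt_const (c := (0 : ℝ))).congr_of_eventuallyEq ?_
    filter_upwards [isClosed_closedBall.isOpen_compl.mem_nhds hv] with z hz
    rw [b.zero_of_le_dist (le_of_not_ge hz), zero_mul]

variable {m : ℕ}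

theorem Frame.coord_one_ne_zero (fr : Frame m) (t : ℝ) (v : E m) :
    fr.coord (t, (1, v)) ≠ 0 := fun h => by
  have := fr.norm_sq_coord t 1 v
  rw [h, norm_zero] at this
  nlinarith [sq_nonneg t, sq_nonneg ‖v‖]

theorem Frame.coord_zero (fr : Frame m) : fr.coord (0, (1, 0)) = fr.q := by
  simp [Frame.coord_apply]

/-- A frontier point of an open set is not in it, so `ρ ≥ 0` there; and `ρ > 0` would persist nearby
and keep points of `V` away. -/
theorem eventually_frontier_imp_eq_zero {n : ℕ} {V : Set (Sph n)} (hV : IsOpen V) {q : Sph n}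
    {ρ : E (n + 1) → ℝ} (hρ : IsDefiningAt V q ρ) :
    ∀ᶠ x : Sph n in 𝓝 q, x ∈ frontier V → ρ x = 0 := by
  have hc : ∀ᶠ x : Sph n in 𝓝 q, ContDiffAt ℝ 1 ρ x :=
    continuous_subtype_val.continuousAt.eventually (hρ.1.eventually (by simp))
  filter_upwards [hρ.2.2.eventually_nhds, hc] with x hx hcx hxf
  rw [hV.frontier_eq] at hxf
  refine le_antisymm ?_ (not_lt.1 fun h => hxf.2 (hx.self_of_nhds.2 h))
  by_contra! hpos
  have h1 : ∀ᶠ y : Sph n in 𝓝 x, 0 < ρ y :=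
    (hcx.continuousAt.comp continuous_subtype_val.continuousAt).eventually_const_lt hpos
  obtain ⟨y, hy, hyV⟩ := (mem_closure_iff_frequently.1 hxf.1).and_eventually (h1.and hx) |>.exists
  exact absurd (hyV.2.1 hy) (not_lt.2 hyV.1.le)

theorem tanGrad_eq {n : ℕ} (ρ : E (n + 1) → ℝ) (q : Sph n) {h : E (n + 1)}
    (hh : inner ℝ (q : E (n + 1)) h = 0) : inner ℝ (tanGrad ρ q) h = inner ℝ (∇ ρ q) h := by
  rw [tanGrad, inner_sub_left, inner_smul_left, hh]
  simp

theorem fderiv_eq_inner_tanGrad {n : ℕ} {ρ : E (n + 1) → ℝ} {q : Sph n}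
    (hd : DifferentiableAt ℝ ρ q) {h : E (n + 1)} (hh : inner ℝ (q : E (n + 1)) h = 0) :
    fderiv ℝ ρ q h = inner ℝ (tanGrad ρ q) h := by
  rw [tanGrad_eq ρ q hh, hd.hasGradientAt.hasFDerivAt.fderiv]
  simp

/-- Near a boundary point, the domain is the subgraph of a `C¹` function in the central projection
coordinates of an adapted frame. -/
theorem exists_local_graph {V : Set (Sph (m + 1))} (hV : IsOpen V) {q : Sph (m + 1)}
    (hq : q ∈ frontier V) {ρ : E (m + 2) → ℝ} (hρ : IsDefiningAt V q ρ) {fr : Frame m}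
    (hfq : fr.q = q) (hfν : fr.ν = ‖tanGrad ρ q‖⁻¹ • tanGrad ρ q) :
    ∃ φ : E m → ℝ, ContDiff ℝ 1 φ ∧ φ 0 = 0 ∧ fderiv ℝ φ 0 = 0 ∧ ∃ δ > 0, ∀ t v, |t| < δ →
      ‖v‖ < δ → (nproj (fr.coord (t, (1, v))) ∈ V ↔ t < φ v) ∧
        (nproj (fr.coord (t, (1, v))) ∈ frontier V ↔ t = φ v) := by
  set P : E m × ℝ → Sph (m + 1) := fun p => nproj (fr.coord (p.2, (1, p.1))) with hP
  have hP0 : P 0 = q := by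
    simp only [hP, Prod.fst_zero, Prod.snd_zero, fr.coord_zero, hfq, nproj_coe]
  have hPc : Continuous P := continuousOn_nproj.comp_continuous
    (fr.coord.continuous.comp (by fun_prop)) fun p => fr.coord_one_ne_zero _ _
  set r : E m × ℝ → ℝ := fun p => ρ (P p) with hr
  have hPs : ContDiffAt ℝ 1 (fun p => (P p : E (m + 2))) 0 :=
    ContDiffAt.comp (g := fun y : E (m + 2) => (nproj y : E (m + 2)))
      (f := fun p : E m × ℝ => fr.coord (p.2, (1, p.1))) (0 : E m × ℝ)
      (contDiffAt_coe_nproj (fr.coord_one_ne_zero _ _) (k := 1)) (by fun_prop)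
  have hrs : ContDiffAt ℝ 1 r 0 := ContDiffAt.comp (0 : E m × ℝ) (by rw [hP0]; exact hρ.1) hPs
  have ha : 0 < ‖tanGrad ρ q‖ := norm_pos_iff.2 hρ.2.1
  have htg : tanGrad ρ q = ‖tanGrad ρ q‖ • fr.ν := by
    rw [hfν, smul_smul, mul_inv_cancel₀ ha.ne', one_smul]
  -- The derivative of `nproj` at `q` removes only the `q`-component, and the gradient of `ρ` along
  -- the sphere is a multiple of `ν`. Hence the linearization of `r` sees `t` alone, which gives
  -- both solvability for `t` and `dφ = 0` at the origin.
  have hrd : ∀ v t, fderiv ℝ r 0 (v, t) = ‖tanGrad ρ q‖ * t := by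
    intro v t
    have hl : HasFDerivAt (fun p : E m × ℝ => fr.coord (p.2, (1, p.1)))
        ((fr.coord : _ →L[ℝ] E (m + 2)).comp ((ContinuousLinearMap.snd ℝ (E m) ℝ).prod
          ((0 : E m × ℝ →L[ℝ] ℝ).prod (ContinuousLinearMap.fst ℝ (E m) ℝ)))) 0 :=
      fr.coord.hasFDerivAt.comp (0 : E m × ℝ)
        (hasFDerivAt_snd.prodMk ((hasFDerivAt_const (1 : ℝ) _).prodMk hasFDerivAt_fst))
    have hN := hasFDerivAt_coe_nproj q
    have hd := hρ.1.differentiableAt one_ne_zero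
    have hcq : fr.coord ((0 : E m × ℝ).2, ((1 : ℝ), (0 : E m × ℝ).1)) = (q : E (m + 2)) := by
      rw [← hfq]; exact fr.coord_zero
    rw [← hcq] at hN
    have h2 := hN.comp (0 : E m × ℝ) hl
    have hd' : HasFDerivAt ρ (fderiv ℝ ρ q)
      (((fun y : E (m + 2) => (nproj y : E (m + 2))) ∘
        fun p : E m × ℝ => fr.coord (p.2, (1, p.1))) 0) := by
      have : (((fun y : E (m + 2) => (nproj y : E (m + 2))) ∘
        fun p : E m × ℝ => fr.coord (p.2, (1, p.1))) 0) = (q : E (m + 2)) := by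
        simp only [Function.comp_apply, hcq, nproj_coe]
      rw [this]
      exact hd.hasFDerivAt
    have h3 := (hd'.comp (0 : E m × ℝ) h2).fderiv
    have h4 : fderiv ℝ r 0 = _ := h3
    have ho : inner ℝ (q : E (m + 2)) (t • fr.ν + fr.J v) = 0 := by
      rw [← hfq, inner_add_right, inner_smul_right, fr.inner_q_ν, fr.inner_q_J]
      simp
    have ho' : inner ℝ fr.ν (t • fr.ν + fr.J v) = t := by
      rw [inner_add_right, inner_smul_right, real_inner_self_eq_norm_sq, fr.norm_ν, fr.inner_ν_J]
      simp
    rw [h4]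
    have : fr.coord (t, ((0 : ℝ), v)) = t • fr.ν + fr.J v := by simp [fr.coord_apply]
    simp only [ContinuousLinearMap.comp_apply, ContinuousLinearMap.prod_apply,
      ContinuousLinearMap.coe_fst', ContinuousLinearMap.coe_snd', _root_.zero_apply,
      ContinuousLinearEquiv.coe_coe, this, _root_.sub_apply,
      ContinuousLinearMap.id_apply, ContinuousLinearMap.smulRight_apply, innerSL_apply_apply, hcq,
      ho, zero_smul, sub_zero]
    rw [fderiv_eq_inner_tanGrad hd ho, htg, inner_smul_left, ho', norm_smul, fr.norm_ν]
    simp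
  have hinv : (fderiv ℝ r 0 ∘L .inr ℝ (E m) ℝ).IsInvertible := by
    refine ⟨ContinuousLinearEquiv.unitsEquivAut ℝ (Units.mk0 _ ha.ne'), ?_⟩
    ext
    simp [hrd]
  set φ₀ := hrs.implicitFunction one_ne_zero hinv with hφ₀
  have hr0 : r 0 = 0 := by
    simp only [hr, hP0]
    exact (eventually_frontier_imp_eq_zero hV hρ).self_of_nhds hq
  have hφ0 : φ₀ 0 = 0 := hrs.implicitFunction_apply_self one_ne_zero hinv
  have hφs : ContDiffAt ℝ 1 φ₀ 0 := hrs.contDiffAt_implicitFunction one_ne_zero hinv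
  have hφd : fderiv ℝ φ₀ 0 = 0 := by
    rw [show (0 : E m) = (0 : E m × ℝ).1 from rfl,
      (hrs.hasStrictFDerivAt_implicitFunction one_ne_zero hinv).hasFDerivAt.fderiv]
    ext v
    simp [hrd]
  have hφz : ∀ᶠ v in 𝓝 (0 : E m), r (v, φ₀ v) = 0 := by
    have := hrs.eventually_apply_implicitFunction one_ne_zero hinv
    rwa [hr0] at this
  have hpos : ∀ᶠ p in 𝓝 (0 : E m × ℝ), DifferentiableAt ℝ r p ∧ 0 < fderiv ℝ r p (0, 1) := by
    have h1 : ∀ᶠ p in 𝓝 (0 : E m × ℝ), ContDiffAt ℝ 1 r p := hrs.eventually (by simp)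
    have h2 : ContinuousAt (fun p => fderiv ℝ r p (0, 1)) 0 :=
      (hrs.continuousAt_fderiv one_ne_zero).clm_apply continuousAt_const
    have h3 : 0 < fderiv ℝ r 0 (0, 1) := by rw [hrd]; simpa using ha
    filter_upwards [h1, h2.eventually_const_lt h3] with p hp hp2
    exact ⟨hp.differentiableAt one_ne_zero, hp2⟩
  have hVP : ∀ᶠ p in 𝓝 (0 : E m × ℝ), (P p ∈ V ↔ r p < 0) ∧ (P p ∈ frontier V → r p = 0) := by
    have := hPc.continuousAt (x := 0)
    rw [ContinuousAt, hP0] at this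
    exact this.eventually (hρ.2.2.and (eventually_frontier_imp_eq_zero hV hρ))
  obtain ⟨δ₁, hδ₁, hbox⟩ := Metric.eventually_nhds_iff_ball.1 (hpos.and hVP)
  have hφc : ∀ᶠ v in 𝓝 (0 : E m), |φ₀ v| < δ₁ := by
    have := hφs.continuousAt.abs
    rw [ContinuousAt, hφ0, abs_zero] at this
    exact this.eventually_lt_const hδ₁
  obtain ⟨δ₂, hδ₂, hb2⟩ := Metric.eventually_nhds_iff_ball.1
    ((hφs.eventually (by simp)).and (hφz.and hφc))
  -- The implicit function is C¹ only near `0`; multiplying by a bump makes it C¹ everywhere and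
  -- leaves it unchanged on the smaller ball.
  set b : ContDiffBump (0 : E m) := ⟨δ₂ / 3, δ₂ / 2, by positivity, by linarith⟩ with hb
  have hbφ : ∀ v, ‖v‖ < δ₂ / 3 → b v * φ₀ v = φ₀ v := fun v hv => by
    rw [b.one_of_mem_closedBall (by simpa [hb] using hv.le), one_mul]
  refine ⟨fun v => b v * φ₀ v, ?_, ?_, ?_, min δ₁ (δ₂ / 3), by positivity, ?_⟩
  · refine contDiff_bump_mul (k := 1) b fun v hv => (hb2 v ?_).1
    simp only [hb, mem_closedBall, dist_zero_right, mem_ball] at hv ⊢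
    linarith
  · simp [hφ0]
  · rw [← hφd]
    refine Filter.EventuallyEq.fderiv_eq ?_
    filter_upwards [Metric.ball_mem_nhds (0 : E m) (show 0 < δ₂ / 3 by positivity)] with v hv
    exact hbφ v (by simpa using hv)
  · intro t v ht hv
    rw [lt_min_iff] at ht hv
    simp only
    rw [hbφ v hv.2]
    have hbx : ∀ t', |t'| < δ₁ → (v, t') ∈ ball (0 : E m × ℝ) δ₁ := fun t' ht' => by
      simp [Prod.norm_def, hv.1, ht']
    -- Strict monotonicity in `t` upgrades the equation `r (v, φ v) = 0` to the sign of `r`: it is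
    -- negative exactly below the graph.
    have hmono : StrictMonoOn (fun t' => r (v, t')) (Ioo (-δ₁) δ₁) := by
      have hder : ∀ t' ∈ Ioo (-δ₁) δ₁,
          HasDerivAt (fun t' => r (v, t')) (fderiv ℝ r (v, t') (0, 1)) t' := fun t' ht' => by
        have := ((hbox (v, t') (hbx t' (abs_lt.2 ht'))).1.1.hasFDerivAt.comp t'
          ((hasFDerivAt_const v t').prodMk (hasFDerivAt_id t'))).hasDerivAt
        simpa [Function.comp_def] using this
      refine strictMonoOn_of_deriv_pos (convex_Ioo _ _)
        (fun t' ht' => (hder t' ht').continuousAt.continuousWithinAt) fun t' ht' => ?_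
      rw [interior_Ioo] at ht'
      rw [(hder t' ht').deriv]
      exact (hbox (v, t') (hbx t' (abs_lt.2 ht'))).1.2
    have hv2 := hb2 v (by simp; linarith [hv.2])
    have htm := abs_lt.1 ht.1
    have hφm := abs_lt.1 hv2.2.2
    have hz : r (v, φ₀ v) = 0 := hv2.2.1
    have hVt := (hbox (v, t) (hbx t ht.1)).2
    have hlt : ∀ t', |t'| < δ₁ → (P (v, t') ∈ V ↔ t' < φ₀ v) := fun t' ht' => by
      rw [(hbox (v, t') (hbx t' ht')).2.1, ← hz]
      exact hmono.lt_iff_lt (abs_lt.1 ht') hφm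
    refine ⟨hlt t ht.1, fun h => ?_, ?_⟩
    · exact hmono.injOn htm hφm ((hVt.2 h).trans hz.symm)
    · rintro rfl
      rw [hV.frontier_eq]
      refine ⟨?_, fun h => lt_irrefl _ ((hlt _ ht.1).1 h)⟩
      -- A graph point is approached vertically from below by points of `V`, hence lies in the
      -- closure.
      have hcont : Filter.Tendsto (fun t' => P (v, t')) (𝓝[<] (φ₀ v)) (𝓝 (P (v, φ₀ v))) :=
        ((hPc.comp (Continuous.prodMk_right v)).continuousAt).mono_left nhdsWithin_le_nhds
      refine mem_closure_of_tendsto hcont ?_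
      have h1 : ∀ᶠ t' in 𝓝[<] (φ₀ v), |t'| < δ₁ :=
        nhdsWithin_le_nhds (continuous_abs.continuousAt.eventually_lt_const ht.1)
      filter_upwards [h1, self_mem_nhdsWithin] with t' h1 h2
      exact (hlt t' h1).2 h2

end LocalGraph

/-! ### Cutting off ray-constant fields to an annulus. -/

section RadialCutoff

/-- A smooth bump function on `(0, ∞)`, applied to `‖y‖²` to localize to an annulus. -/
def radialBump : ContDiffBump (2 : ℝ) := ⟨1 / 2, 1, by norm_num, by norm_num⟩

theorem radialBump_eq_zero {x : ℝ} (hx : x ≤ 1 ∨ 3 ≤ x) : radialBump x = 0 := by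
  refine radialBump.zero_of_le_dist ?_
  simp only [radialBump, Real.dist_eq]
  rcases hx with h | h
  · rw [abs_of_nonpos (by linarith)]; linarith
  · rw [abs_of_nonneg (by linarith)]; linarith

/-- The `m`-th radial moment of the cutoff. -/
def radialMoment (m : ℕ) : ℝ := ∫ s in Ioi (0 : ℝ), s ^ m * radialBump (s ^ 2)

/-- Substitution `s ↦ R s`. With `R` the norm of a graph point, this turns the radial integral into
a weight that equals one at the base point of the frame. -/
theorem radialMoment_scaled (m : ℕ) {R : ℝ} (hR : 0 < R) :
    ∫ s in Ioi (0 : ℝ), s ^ m * radialBump (s ^ 2 * R ^ 2) = (R ^ (m + 1))⁻¹ * radialMoment m := by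
  have h := integral_comp_mul_left_Ioi (fun s : ℝ => s ^ m * radialBump (s ^ 2)) 0 hR
  rw [mul_zero, smul_eq_mul] at h
  have h2 : ∀ s : ℝ, (R * s) ^ m * radialBump ((R * s) ^ 2) =
      R ^ m * (s ^ m * radialBump (s ^ 2 * R ^ 2)) := fun s => by
    rw [mul_pow, mul_pow, mul_comm (R ^ 2)]; ring
  simp_rw [h2] at h
  rw [integral_const_mul] at h
  rw [radialMoment, pow_succ R m, mul_inv, mul_assoc, ← h, ← mul_assoc,
    inv_mul_cancel₀ (pow_ne_zero _ hR.ne'), one_mul]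

theorem radialMoment_pos (m : ℕ) : 0 < radialMoment m := by
  have hc : Continuous fun s : ℝ => s ^ m * radialBump (s ^ 2) := by
    have := radialBump.continuous
    fun_prop
  have hs : HasCompactSupport fun s : ℝ => s ^ m * radialBump (s ^ 2) := by
    refine HasCompactSupport.intro (isCompact_closedBall (0 : ℝ) 2) fun s hs => ?_
    rw [radialBump_eq_zero (Or.inr ?_), mul_zero]
    rw [mem_closedBall, dist_zero_right, not_le, Real.norm_eq_abs] at hs
    nlinarith [sq_abs s]
  have hint := (hc.integrable_of_hasCompactSupport (μ := volume) hs).integrableOn (s := Ioi (0 : ℝ))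
  rw [radialMoment, setIntegral_pos_iff_support_of_nonneg_ae _ hint]
  · have hU : IsOpen ((Function.support fun s : ℝ => s ^ m * radialBump (s ^ 2)) ∩ Ioi 0) :=
      (isOpen_compl_singleton.preimage hc).inter isOpen_Ioi
    refine hU.measure_pos _ ⟨√2, ?_, by simp⟩
    have h1 : radialBump 2 = 1 := by
      exact radialBump.one_of_mem_closedBall (by simp [radialBump])
    simp [h1]
  · filter_upwards [ae_restrict_mem measurableSet_Ioi] with s hs
    exact mul_nonneg (pow_nonneg (le_of_lt hs) _) radialBump.nonneg

variable {n : ℕ}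

/-- The localization of a vector field to an annulus. -/
def annular (Y : E (n + 1) → E (n + 1)) (y : E (n + 1)) : E (n + 1) :=
  radialBump (‖y‖ ^ 2) • Y y

/-- The cutoff vanishes identically near the origin, which is the only place where `Y` may be
singular. -/
theorem contDiff_annular {Y : E (n + 1) → E (n + 1)} (hY : ContDiffOn ℝ 1 Y {0}ᶜ) :
    ContDiff ℝ 1 (annular Y) := by
  rw [contDiff_iff_contDiffAt]
  intro y
  by_cases hy : y = 0
  · refine (contDiffAt_const (c := (0 : E (n + 1)))).congr_of_eventuallyEq ?_
    filter_upwards [Metric.ball_mem_nhds y one_pos] with z hz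
    rw [hy, mem_ball, dist_zero_right] at hz
    rw [annular, radialBump_eq_zero (Or.inl (by nlinarith [norm_nonneg z])), zero_smul]
  · exact (radialBump.contDiff.contDiffAt.comp y (contDiff_norm_sq ℝ).contDiffAt).smul
      (hY.contDiffAt (isOpen_compl_singleton.mem_nhds hy))

theorem annular_eq_zero {Y : E (n + 1) → E (n + 1)} {y : E (n + 1)}
    (hy : ‖y‖ ^ 2 ≤ 1 ∨ 3 ≤ ‖y‖ ^ 2) : annular Y y = 0 := by
  rw [annular, radialBump_eq_zero hy, zero_smul]

theorem hasCompactSupport_annular (Y : E (n + 1) → E (n + 1)) :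
    HasCompactSupport (annular Y) := by
  refine HasCompactSupport.intro (isCompact_closedBall (0 : E (n + 1)) 2) fun y hy => ?_
  rw [mem_closedBall, dist_zero_right, not_le] at hy
  exact annular_eq_zero (Or.inr (by nlinarith))

/-- The right-hand set is closed although `nproj` is only known to be continuous off the origin,
since the annulus stays away from it. -/
theorem tsupport_annular_subset {Y : E (n + 1) → E (n + 1)} {K : Set (Sph n)} (hK : IsCompact K)
    (hY : ∀ y, y ≠ 0 → nproj y ∉ K → Y y = 0) :
    tsupport (annular Y) ⊆ {y | 1 ≤ ‖y‖ ^ 2 ∧ ‖y‖ ^ 2 ≤ 3 ∧ nproj y ∈ K} := by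
  have hA1 : IsClosed {y : E (n + 1) | 1 ≤ ‖y‖ ^ 2} := isClosed_le (by fun_prop) (by fun_prop)
  have hA2 : IsClosed {y : E (n + 1) | ‖y‖ ^ 2 ≤ 3} := isClosed_le (by fun_prop) (by fun_prop)
  have hA : IsClosed {y : E (n + 1) | 1 ≤ ‖y‖ ^ 2 ∧ ‖y‖ ^ 2 ≤ 3} := hA1.inter hA2
  have hA0 : {y : E (n + 1) | 1 ≤ ‖y‖ ^ 2 ∧ ‖y‖ ^ 2 ≤ 3} ⊆ {0}ᶜ := by
    rintro y hy rfl
    norm_num at hy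
  have hcl := (continuousOn_nproj.mono hA0).preimage_isClosed_of_isClosed hA hK.isClosed
  refine (closure_minimal (fun y hy => ?_) hcl).trans fun y hy => ⟨hy.1.1, hy.1.2, hy.2⟩
  have h1 : ¬ (‖y‖ ^ 2 ≤ 1 ∨ 3 ≤ ‖y‖ ^ 2) := fun h => hy (annular_eq_zero h)
  push Not at h1
  refine ⟨⟨h1.1.le, h1.2.le⟩, ?_⟩
  by_contra hc
  refine hy ?_
  rw [annular, hY y (hA0 ⟨h1.1.le, h1.2.le⟩) hc, smul_zero]

end RadialCutoff

/-! ### Flux through a subgraph in frame coordinates. -/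

section FrameDivergence

variable {m : ℕ} (fr : Frame m)

theorem Frame.fderiv_inner_comp {Z : E (m + 2) → E (m + 2)} (hZ : ContDiff ℝ 1 Z) (b : E (m + 2))
    (p x : ℝ × (ℝ × E m)) :
    fderiv ℝ (fun p => inner ℝ b (Z (fr.coord p))) p x =
      inner ℝ b (fderiv ℝ Z (fr.coord p) (fr.coord x)) := by
  have h := (innerSL ℝ b).hasFDerivAt.comp p
    (((hZ.differentiable one_ne_zero (fr.coord p)).hasFDerivAt).comp p fr.coord.hasFDerivAt)
  have h2 : fderiv ℝ (fun p => inner ℝ b (Z (fr.coord p))) p = _ := h.fderiv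
  rw [h2]
  simp

/-- The trace is taken in the orthonormal basis of the frame, and each diagonal entry is integrated
by `integral_subgraph_fderiv`: the direction `ν` gets the coefficient one, every other direction a
derivative of `φ`. -/
theorem Frame.integral_subgraph_trace {Z : E (m + 2) → E (m + 2)} (hZ : ContDiff ℝ 1 Z)
    (hc : HasCompactSupport Z) {φ : ℝ × E m → ℝ} (hφ : ContDiff ℝ 1 φ) :
    ∫ p in {p : ℝ × (ℝ × E m) | p.1 < φ p.2},
        LinearMap.trace ℝ _ (fderiv ℝ Z (fr.coord p)).toLinearMap =
      (∫ z, inner ℝ fr.ν (Z (fr.coord (φ z, z)))) +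
        ((∫ z, (0 - fderiv ℝ φ z (1, 0)) * inner ℝ fr.q (Z (fr.coord (φ z, z)))) +
        ∑ i, ∫ z, (0 - fderiv ℝ φ z (0, EuclideanSpace.single i 1)) *
          inner ℝ (fr.J (EuclideanSpace.single i 1)) (Z (fr.coord (φ z, z)))) := by
  have hs : ∀ b : E (m + 2), ContDiff ℝ 1 fun p => inner ℝ b (Z (fr.coord p)) := fun b =>
    contDiff_const.inner ℝ (hZ.comp fr.coord.contDiff)
  have hcs : ∀ b : E (m + 2), HasCompactSupport fun p => inner ℝ b (Z (fr.coord p)) := fun b =>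
    (hc.comp_homeomorph fr.coord.toHomeomorph).comp_left (g := fun z => inner ℝ b z) (by simp)
  have hint : ∀ b x, Integrable (fun p => fderiv ℝ (fun p => inner ℝ b (Z (fr.coord p))) p x)
      ((volume : Measure ℝ).prod ((volume : Measure ℝ).prod (volume : Measure (E m)))) := fun b x =>
    (((hs b).continuous_fderiv one_ne_zero).clm_apply continuous_const
      ).integrable_of_hasCompactSupport
      (((hcs b).fderiv (𝕜 := ℝ)).comp_left (g := fun A : ℝ × (ℝ × E m) →L[ℝ] ℝ => A x) rfl)
  have key := fun (b : E (m + 2)) (a : ℝ) (h : ℝ × E m) =>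
    integral_subgraph_fderiv ((volume : Measure ℝ).prod (volume : Measure (E m))) hφ (hs b) (hcs b)
      a h
  have htr : ∀ p, LinearMap.trace ℝ _ (fderiv ℝ Z (fr.coord p)).toLinearMap =
      fderiv ℝ (fun p => inner ℝ fr.ν (Z (fr.coord p))) p (1, 0) +
      (fderiv ℝ (fun p => inner ℝ fr.q (Z (fr.coord p))) p (0, (1, 0)) +
      ∑ i, fderiv ℝ (fun p => inner ℝ (fr.J (EuclideanSpace.single i 1)) (Z (fr.coord p))) p
        (0, (0, EuclideanSpace.single i 1))) := fun p => by
    have e1 : fr.coord (1, 0) = fr.ν := by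
      rw [show (0 : ℝ × E m) = (0, 0) from rfl, fr.coord_apply]; simp
    have e2 : fr.coord (0, (1, 0)) = fr.q := fr.coord_zero
    have e3 : ∀ v, fr.coord (0, (0, v)) = fr.J v := fun v => by rw [fr.coord_apply]; simp
    rw [fr.trace_eq]
    simp only [fr.fderiv_inner_comp hZ, e1, e2, e3, ContinuousLinearMap.coe_coe]
  simp_rw [htr]
  have hv : (volume : Measure (ℝ × (ℝ × E m))) =
    (volume : Measure ℝ).prod ((volume : Measure ℝ).prod (volume : Measure (E m))) := rfl
  have hv2 : (volume : Measure (ℝ × E m)) = (volume : Measure ℝ).prod (volume : Measure (E m)) :=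
    rfl
  have hi3 := integrable_finsetSum (Finset.univ : Finset (Fin m)) fun i _ =>
    hint (fr.J (EuclideanSpace.single i 1)) (0, (0, EuclideanSpace.single i 1))
  have hi23 : Integrable (fun p => fderiv ℝ (fun p => inner ℝ fr.q (Z (fr.coord p))) p (0, (1, 0)) +
      ∑ i, fderiv ℝ (fun p => inner ℝ (fr.J (EuclideanSpace.single i 1)) (Z (fr.coord p))) p
        (0, (0, EuclideanSpace.single i 1))) _ := (hint fr.q (0, (1, 0))).add hi3
  rw [hv, hv2, integral_add (hint _ _).integrableOn hi23.integrableOn,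
    integral_add (hint _ _).integrableOn hi3.integrableOn,
    integral_finsetSum _ fun i _ => (hint _ _).integrableOn]
  simp_rw [key]
  simp

/-- Only the `ν`-term survives up to an error, since the `m + 1` remaining directions carry slopes
of the graph. The slopes have to be small only where the field does not vanish. -/
theorem Frame.abs_integral_subgraph_trace_sub_le {Z : E (m + 2) → E (m + 2)} (hZ : ContDiff ℝ 1 Z)
    (hc : HasCompactSupport Z) {φ : ℝ × E m → ℝ} (hφ : ContDiff ℝ 1 φ) {ε : ℝ}
    (hε : ∀ z, Z (fr.coord (φ z, z)) ≠ 0 → |fderiv ℝ φ z (1, 0)| ≤ ε ∧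
      ∀ i, |fderiv ℝ φ z (0, EuclideanSpace.single i 1)| ≤ ε) :
    |(∫ p in {p : ℝ × (ℝ × E m) | p.1 < φ p.2},
        LinearMap.trace ℝ _ (fderiv ℝ Z (fr.coord p)).toLinearMap) -
      ∫ z, inner ℝ fr.ν (Z (fr.coord (φ z, z)))| ≤
      (m + 1) * (ε * ∫ z, ‖Z (fr.coord (φ z, z))‖) := by
  have hcont : Continuous fun z => Z (fr.coord (φ z, z)) :=
    hZ.continuous.comp (fr.coord.continuous.comp (hφ.continuous.prodMk continuous_id))
  have hcs : HasCompactSupport fun z => Z (fr.coord (φ z, z)) := by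
    have h1 : HasCompactSupport fun p => Z (fr.coord p) := hc.comp_homeomorph fr.coord.toHomeomorph
    have h2 := (h1.isCompact.image continuous_snd)
    refine HasCompactSupport.intro h2 fun z hz => ?_
    by_contra hne
    exact hz ⟨(φ z, z), subset_tsupport _ hne, rfl⟩
  have hint : Integrable fun z => ‖Z (fr.coord (φ z, z))‖ :=
    (hcont.integrable_of_hasCompactSupport hcs).norm
  have bound : ∀ (x : ℝ × E m) (b : E (m + 2)), ‖b‖ = 1 →
      (∀ z, Z (fr.coord (φ z, z)) ≠ 0 → |fderiv ℝ φ z x| ≤ ε) →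
      |∫ z, (0 - fderiv ℝ φ z x) * inner ℝ b (Z (fr.coord (φ z, z)))| ≤
        ε * ∫ z, ‖Z (fr.coord (φ z, z))‖ := by
    intro x b hb hx
    rw [← integral_const_mul, ← Real.norm_eq_abs]
    refine norm_integral_le_of_norm_le (hint.const_mul ε) (Filter.Eventually.of_forall fun z => ?_)
    by_cases hz : Z (fr.coord (φ z, z)) = 0
    · simp [hz]
    · rw [norm_mul, zero_sub, norm_neg, Real.norm_eq_abs]
      have h1 := norm_inner_le_norm (𝕜 := ℝ) b (Z (fr.coord (φ z, z)))
      rw [hb, one_mul] at h1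
      exact mul_le_mul (hx z hz) h1 (norm_nonneg _) ((abs_nonneg _).trans (hx z hz))
  rw [fr.integral_subgraph_trace hZ hc hφ, add_sub_cancel_left]
  refine (abs_add_le _ _).trans ?_
  have h1 := bound (1, 0) fr.q fr.norm_q fun z hz => (hε z hz).1
  have h2 := (Finset.abs_sum_le_sum_abs _ _).trans (Finset.sum_le_sum fun i (_ : i ∈ Finset.univ) =>
    bound (0, EuclideanSpace.single i 1) (fr.J (EuclideanSpace.single i 1)) (by simp)
      fun z hz => (hε z hz).2 i)
  rw [Finset.sum_const, Finset.card_univ, Fintype.card_fin, nsmul_eq_mul] at h2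
  linarith

end FrameDivergence

/-! ### The cone over a graph as the graph of a homogeneous function. -/

section HomogeneousGraph

variable {m : ℕ}

/-- An auxiliary cutoff on `(0, ∞)`, equal to `1` on `[1/2, 2]`. -/
def scaleBump : ContDiffBump (5 / 4 : ℝ) := ⟨3 / 4, 1, by norm_num, by norm_num⟩

/-- The `1`-homogeneous extension `(s, v) ↦ s φ(v / s)` of `φ`, cut off near `s = 0`. -/
def homGraph (φ : E m → ℝ) (z : ℝ × E m) : ℝ := scaleBump z.1 * (z.1 * φ (z.1⁻¹ • z.2))

theorem contDiffAt_homGraph_aux {φ : E m → ℝ} (hφ : ContDiff ℝ 1 φ) {z : ℝ × E m} (hz : z.1 ≠ 0) :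
    ContDiffAt ℝ 1 (fun z : ℝ × E m => z.1 * φ (z.1⁻¹ • z.2)) z :=
  contDiffAt_fst.mul (hφ.contDiffAt.comp z ((contDiffAt_fst.inv hz).smul contDiffAt_snd))

theorem contDiff_homGraph {φ : E m → ℝ} (hφ : ContDiff ℝ 1 φ) : ContDiff ℝ 1 (homGraph φ) := by
  rw [contDiff_iff_contDiffAt]
  intro z
  by_cases hz : z.1 < 1 / 4
  · refine (contDiffAt_const (c := (0 : ℝ))).congr_of_eventuallyEq ?_
    filter_upwards [(isOpen_Iio.preimage continuous_fst).mem_nhds hz] with x hx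
    rw [homGraph, scaleBump.zero_of_le_dist, zero_mul]
    simp only [scaleBump, Real.dist_eq]
    have : x.1 < 1 / 4 := hx
    rw [abs_of_nonpos (by linarith)]
    linarith
  · exact (scaleBump.contDiff.contDiffAt.comp z contDiffAt_fst).mul
      (contDiffAt_homGraph_aux hφ (by linarith))

theorem homGraph_eq (φ : E m → ℝ) {s : ℝ} (hs : s ∈ Icc (1 / 2 : ℝ) 2) (v : E m) :
    homGraph φ (s, v) = s * φ (s⁻¹ • v) := by
  rw [homGraph, scaleBump.one_of_mem_closedBall, one_mul]
  simp only [scaleBump, mem_closedBall, Real.dist_eq, abs_le]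
  constructor <;> linarith [hs.1, hs.2]

/-- The gradient depends on `(s, v)` only through `v / s`, and it vanishes at `v = 0` when `φ` and
`dφ` do. So smallness near the base point holds uniformly in the scale `s`. -/
theorem fderiv_homGraph {φ : E m → ℝ} (hφ : ContDiff ℝ 1 φ) {s : ℝ} (hs : s ∈ Ioo (1 / 2 : ℝ) 2)
    (v : E m) (a : ℝ) (h : E m) : fderiv ℝ (homGraph φ) (s, v) (a, h) =
      a * (φ (s⁻¹ • v) - fderiv ℝ φ (s⁻¹ • v) (s⁻¹ • v)) + fderiv ℝ φ (s⁻¹ • v) h := by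
  have hs0 : s ≠ 0 := by linarith [hs.1]
  have he : homGraph φ =ᶠ[𝓝 (s, v)] fun z : ℝ × E m => z.1 * φ (z.1⁻¹ • z.2) := by
    filter_upwards [(isOpen_Ioo.preimage continuous_fst).mem_nhds (show (s, v).1 ∈ _ from hs)]
      with z hz
    exact homGraph_eq φ (Ioo_subset_Icc_self hz) z.2
  have hf : HasFDerivAt (fun z : ℝ × E m => z.1) (ContinuousLinearMap.fst ℝ ℝ (E m)) (s, v) :=
    hasFDerivAt_fst
  have h0 : HasFDerivAt (fun z : ℝ × E m => z.1⁻¹) _ (s, v) :=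
    HasDerivAt.comp_hasFDerivAt (h₂ := fun x : ℝ => x⁻¹) (s, v) (hasDerivAt_inv hs0) hf
  have h1 : HasFDerivAt (fun z : ℝ × E m => z.1⁻¹ • z.2) _ (s, v) := h0.fun_smul hasFDerivAt_snd
  have h2 := (hasFDerivAt_fst (𝕜 := ℝ) (p := (s, v))).mul
    (((hφ.differentiable one_ne_zero) (s⁻¹ • v)).hasFDerivAt.comp (s, v) h1)
  rw [he.fderiv_eq]
  have h3 : fderiv ℝ (fun z : ℝ × E m => z.1 * φ (z.1⁻¹ • z.2)) (s, v) = _ := h2.fderiv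
  rw [h3]
  simp only [_root_.add_apply, _root_.smul_apply, ContinuousLinearMap.comp_apply,
    ContinuousLinearMap.coe_fst', ContinuousLinearMap.coe_snd', Function.comp_apply,
    ContinuousLinearMap.smulRight_apply, map_add, map_smul, smul_eq_mul]
  field_simp
  ring

end HomogeneousGraph

/-! ### Conical neighbourhoods and integration over homogeneous graphs. -/

section Sector

variable {m : ℕ} (fr : Frame m)

/-- A neighbourhood of the base point of a frame, given by bounds on its coordinates. -/
def Frame.sector (δ δ' : ℝ) : Set (Sph (m + 1)) :=
  {p | 0 < (fr.coord.symm p).2.1 ∧ |(fr.coord.symm p).1| < δ * (fr.coord.symm p).2.1 ∧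
    ‖(fr.coord.symm p).2.2‖ < δ' * (fr.coord.symm p).2.1}

theorem Frame.isOpen_sector (δ δ' : ℝ) : IsOpen (fr.sector δ δ') := by
  have hc : Continuous fun p : Sph (m + 1) => fr.coord.symm p :=
    fr.coord.symm.continuous.comp continuous_subtype_val
  have h1 : IsOpen {p : Sph (m + 1) | 0 < (fr.coord.symm p).2.1} :=
    isOpen_lt (by fun_prop) (by fun_prop)
  have h2 : IsOpen {p : Sph (m + 1) | |(fr.coord.symm p).1| < δ * (fr.coord.symm p).2.1} :=
    isOpen_lt (by fun_prop) (by fun_prop)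
  have h3 : IsOpen {p : Sph (m + 1) | ‖(fr.coord.symm p).2.2‖ < δ' * (fr.coord.symm p).2.1} :=
    isOpen_lt (by fun_prop) (by fun_prop)
  exact h1.inter (h2.inter h3)

theorem Frame.nproj_mem_sector {δ δ' : ℝ} {p : ℝ × (ℝ × E m)} (hp : fr.coord p ≠ 0) :
    nproj (fr.coord p) ∈ fr.sector δ δ' ↔
      0 < p.2.1 ∧ |p.1| < δ * p.2.1 ∧ ‖p.2.2‖ < δ' * p.2.1 := by
  have hr : 0 < ‖fr.coord p‖⁻¹ := inv_pos.2 (norm_pos_iff.2 hp)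
  rw [sector, mem_ofPred_eq, coe_nproj hp, map_smul, ContinuousLinearEquiv.symm_apply_apply]
  simp only [Prod.smul_fst, Prod.smul_snd, smul_eq_mul, norm_smul, abs_mul,
    Real.norm_of_nonneg hr.le, abs_of_pos hr, mul_left_comm _ ‖fr.coord p‖⁻¹,
    mul_lt_mul_iff_right₀ hr, mul_pos_iff_of_pos_left hr]

/-- In the sector `|t|` and `‖v‖` are below `s`, so `1 ≤ t² + s² + ‖v‖² < 3 s²` gives `s > 1/2`,
while `s² ≤ 3` gives `s < 2`. The support of an annular field therefore lies where `homGraph` is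
exactly homogeneous. -/
theorem Frame.scale_mem_of_mem_sector {δ δ' : ℝ} (hδ : δ ≤ 1) (hδ' : δ' ≤ 1)
    {p : ℝ × (ℝ × E m)} (hp : fr.coord p ≠ 0) (hs : nproj (fr.coord p) ∈ fr.sector δ δ')
    (h1 : 1 ≤ ‖fr.coord p‖ ^ 2) (h3 : ‖fr.coord p‖ ^ 2 ≤ 3) : p.2.1 ∈ Ioo (1 / 2 : ℝ) 2 := by
  rw [fr.nproj_mem_sector hp] at hs
  obtain ⟨h0, ht, hv⟩ := hs
  have e := fr.norm_sq_coord p.1 p.2.1 p.2.2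
  have ht' : |p.1| < p.2.1 := ht.trans_le (by nlinarith)
  have hv' : ‖p.2.2‖ < p.2.1 := hv.trans_le (by nlinarith)
  have ht2 : p.1 ^ 2 < p.2.1 ^ 2 := by rw [← sq_abs p.1]; gcongr
  have hv2 : ‖p.2.2‖ ^ 2 < p.2.1 ^ 2 := by gcongr
  have e' : ‖fr.coord p‖ ^ 2 = p.1 ^ 2 + (p.2.1 ^ 2 + ‖p.2.2‖ ^ 2) := e
  constructor
  · nlinarith
  · nlinarith [sq_nonneg p.1, sq_nonneg ‖p.2.2‖]

/-- The graph of `φ` in the central projection coordinates. -/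
def Frame.graph (φ : E m → ℝ) (v : E m) : E (m + 2) := fr.coord (φ v, (1, v))

theorem Frame.smul_graph {φ : E m → ℝ} (s : ℝ) (v : E m) :
    s • fr.graph φ v = fr.coord (s * φ v, (s, s • v)) := by
  rw [graph, ← map_smul]
  simp

theorem Frame.one_le_norm_graph (φ : E m → ℝ) (v : E m) : 1 ≤ ‖fr.graph φ v‖ := by
  have := fr.norm_sq_coord (φ v) 1 v
  rw [← graph] at this
  nlinarith [sq_nonneg (φ v), sq_nonneg ‖v‖, norm_nonneg (fr.graph φ v)]

theorem Frame.graph_ne_zero (φ : E m → ℝ) (v : E m) : fr.graph φ v ≠ 0 :=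
  fr.coord_one_ne_zero _ _

/-- Integration over a homogeneous graph in polar coordinates. -/
theorem Frame.integral_homGraph {δ δ' : ℝ} (hδ : δ ≤ 1) (hδ' : δ' ≤ 1) {φ : E m → ℝ}
    (hφ : ContDiff ℝ 1 φ) {a : E (m + 2) → ℝ} (ha : ContinuousOn a {0}ᶜ)
    (hah : ∀ r : ℝ, 0 < r → ∀ y, a (r • y) = a y)
    (has : ∀ y, y ≠ 0 → nproj y ∉ fr.sector δ δ' → a y = 0) :
    ∫ z, radialBump (‖fr.coord (homGraph φ z, z)‖ ^ 2) * a (fr.coord (homGraph φ z, z)) =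
      radialMoment m * ∫ v, (‖fr.graph φ v‖ ^ (m + 1))⁻¹ * a (fr.graph φ v) := by
  set G : E (m + 2) → ℝ := fun y => radialBump (‖y‖ ^ 2) * a y with hG
  have hbc := radialBump.continuous
  have hGc : Continuous G := by
    rw [continuous_iff_continuousAt]
    intro y
    by_cases hy : y = 0
    · refine (continuousAt_const (y := (0 : ℝ))).congr ?_
      filter_upwards [Metric.ball_mem_nhds y one_pos] with z hz
      rw [hy, mem_ball, dist_zero_right] at hz
      rw [hG, eq_comm]
      simp only
      rw [radialBump_eq_zero (Or.inl (by nlinarith [norm_nonneg z])), zero_mul]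
    · exact (hbc.comp (by fun_prop)).continuousAt.mul
        (ha.continuousAt (isOpen_compl_singleton.mem_nhds hy))
  have hGs : HasCompactSupport G := by
    refine HasCompactSupport.intro (isCompact_closedBall (0 : E (m + 2)) 2) fun y hy => ?_
    rw [mem_closedBall, dist_zero_right, not_le] at hy
    simp only [hG]
    rw [radialBump_eq_zero (Or.inr (by nlinarith)), zero_mul]
  have hsupp : ∀ t s v, G (fr.coord (t, (s, v))) ≠ 0 → s ∈ Ioo (1 / 2 : ℝ) 2 := by
    intro t s v h
    have h1 : ¬ (‖fr.coord (t, (s, v))‖ ^ 2 ≤ 1 ∨ 3 ≤ ‖fr.coord (t, (s, v))‖ ^ 2) := fun h' => h (by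
      simp only [hG]; rw [radialBump_eq_zero h', zero_mul])
    push Not at h1
    have h0 : fr.coord (t, (s, v)) ≠ 0 := fun h0 => by rw [h0] at h1; norm_num at h1
    have h2 : nproj (fr.coord (t, (s, v))) ∈ fr.sector δ δ' := by
      by_contra hc
      exact h (by simp only [hG]; rw [has _ h0 hc, mul_zero])
    exact fr.scale_mem_of_mem_sector hδ hδ' h0 h2 h1.1.le h1.2.le
  have hcont : Continuous fun z => G (fr.coord (homGraph φ z, z)) :=
    hGc.comp (fr.coord.continuous.comp ((contDiff_homGraph hφ).continuous.prodMk continuous_id))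
  have hcs : HasCompactSupport fun z => G (fr.coord (homGraph φ z, z)) := by
    have h1 : HasCompactSupport fun p => G (fr.coord p) := hGs.comp_homeomorph fr.coord.toHomeomorph
    refine HasCompactSupport.intro (h1.isCompact.image continuous_snd) fun z hz => ?_
    by_contra hne
    exact hz ⟨(homGraph φ z, z), subset_tsupport _ hne, rfl⟩
  have hint := hcont.integrable_of_hasCompactSupport
    (μ := (volume : Measure ℝ).prod (volume : Measure (E m))) hcs
  have hscale : ∀ s : ℝ, 0 < s → ∫ v, G (fr.coord (homGraph φ (s, v), (s, v))) =
      ∫ v, s ^ m * radialBump (s ^ 2 * ‖fr.graph φ v‖ ^ 2) * a (fr.graph φ v) := by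
    intro s hs
    -- On the slice at height `s` the substitution `v ↦ s v` produces the Jacobian `s ^ m` and moves
    -- the graph point to `s` times the point over the slice at height one.
    have h1 := Measure.integral_comp_smul_of_nonneg (volume : Measure (E m))
      (fun v => G (fr.coord (homGraph φ (s, v), (s, v)))) s (hR := hs.le)
    rw [finrank_euclideanSpace_fin, smul_eq_mul, eq_inv_mul_iff_mul_eq₀ (pow_pos hs m).ne'] at h1
    rw [← h1, ← integral_const_mul]
    congr 1 with v
    rw [mul_assoc]
    congr 1
    have h2 : radialBump (s ^ 2 * ‖fr.graph φ v‖ ^ 2) * a (fr.graph φ v) =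
        G (fr.coord (s * φ v, (s, s • v))) := by
      simp only [hG, ← fr.smul_graph]
      rw [hah s hs, norm_smul, mul_pow, Real.norm_eq_abs, sq_abs]
    rw [h2]
    -- For `s` outside this interval `homGraph` may differ from the homogeneous extension, but there
    -- both sides are zero by the support of `G`.
    by_cases hI : s ∈ Ioo (1 / 2 : ℝ) 2
    · rw [homGraph_eq φ (Ioo_subset_Icc_self hI), smul_smul, inv_mul_cancel₀ hs.ne', one_smul]
    · rw [not_not.1 fun h => hI (hsupp _ _ _ h), not_not.1 fun h => hI (hsupp _ _ _ h)]
  have hγ : Continuous (fr.graph φ) :=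
    fr.coord.continuous.comp (hφ.continuous.prodMk (continuous_const.prodMk continuous_id))
  have haγ : Continuous fun v => a (fr.graph φ v) :=
    ha.comp_continuous hγ fun v => fr.graph_ne_zero φ v
  have hint2 : Integrable (fun p : ℝ × E m =>
      p.1 ^ m * radialBump (p.1 ^ 2 * ‖fr.graph φ p.2‖ ^ 2) * a (fr.graph φ p.2))
      ((volume : Measure ℝ).prod (volume : Measure (E m))) := by
    refine Continuous.integrable_of_hasCompactSupport ?_ ?_
    · have h1 : Continuous fun p : ℝ × E m => a (fr.graph φ p.2) := haγ.comp continuous_snd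
      have h2 : Continuous fun p : ℝ × E m => fr.graph φ p.2 := hγ.comp continuous_snd
      exact ((continuous_fst.pow m).mul
        (hbc.comp ((continuous_fst.pow 2).mul (h2.norm.pow 2)))).mul h1
    · refine HasCompactSupport.intro ((isCompact_closedBall (0 : ℝ) 2).prod
        (isCompact_closedBall (0 : E m) δ')) fun p hp => ?_
      rw [mem_prod, not_and_or, mem_closedBall, mem_closedBall, dist_zero_right, dist_zero_right,
        not_le, not_le] at hp
      rcases hp with hp | hp
      · rw [radialBump_eq_zero, mul_zero, zero_mul]
        have := fr.one_le_norm_graph φ p.2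
        have h4 : 3 ≤ p.1 ^ 2 := by rw [← sq_abs]; rw [Real.norm_eq_abs] at hp; nlinarith
        have h5 : (1 : ℝ) ≤ ‖fr.graph φ p.2‖ ^ 2 := by nlinarith
        right
        nlinarith
      · rw [has _ (fr.graph_ne_zero φ p.2), mul_zero]
        rw [Frame.graph, fr.nproj_mem_sector (fr.graph_ne_zero φ p.2)]
        simp only [mul_one]
        exact fun h => lt_asymm hp h.2.2
  calc ∫ z, G (fr.coord (homGraph φ z, z))
      = ∫ s, ∫ v, G (fr.coord (homGraph φ (s, v), (s, v))) := integral_prod _ hint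
    _ = ∫ s in Ioi (0 : ℝ), ∫ v, G (fr.coord (homGraph φ (s, v), (s, v))) := by
        refine (setIntegral_eq_integral_of_forall_compl_eq_zero fun s hs => ?_).symm
        refine (integral_congr_ae (Filter.Eventually.of_forall fun v => ?_)).trans
          (integral_zero _ _)
        exact not_not.1 fun h => hs (lt_trans (by norm_num) (hsupp _ _ _ h).1)
    _ = ∫ s in Ioi (0 : ℝ), ∫ v,
          s ^ m * radialBump (s ^ 2 * ‖fr.graph φ v‖ ^ 2) * a (fr.graph φ v) :=
        setIntegral_congr_fun measurableSet_Ioi fun s hs => hscale s hs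
    _ = ∫ v, ∫ s in Ioi (0 : ℝ),
          s ^ m * radialBump (s ^ 2 * ‖fr.graph φ v‖ ^ 2) * a (fr.graph φ v) := by
        refine integral_integral_swap ?_
        have := hint2.integrableOn (s := Ioi (0 : ℝ) ×ˢ univ)
        rwa [IntegrableOn, ← Measure.prod_restrict, Measure.restrict_univ] at this
    _ = ∫ v, radialMoment m * ((‖fr.graph φ v‖ ^ (m + 1))⁻¹ * a (fr.graph φ v)) := by
        congr 1 with v
        rw [integral_mul_const, radialMoment_scaled m (norm_pos_iff.2 (fr.graph_ne_zero φ v))]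
        ring
    _ = _ := integral_const_mul _ _

end Sector

/-! ### Almost isometric parametrization of the boundary, and the local flux. -/

section LocalEstimate

variable {m : ℕ}

theorem exists_pow_one_add_le (m : ℕ) {ε : ℝ} (hε : 0 < ε) :
    ∃ c : NNReal, 0 < c ∧ (c : ℝ) ≤ 1 / 2 ∧ (1 + 2 * (c : ℝ)) ^ m ≤ 1 + ε := by
  have hc : ContinuousAt (fun c : ℝ => (1 + 2 * c) ^ m) 0 := by fun_prop
  have h1 : ∀ᶠ c in 𝓝 (0 : ℝ), (1 + 2 * c) ^ m < 1 + ε :=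
    hc.eventually_lt_const (by simpa using hε)
  obtain ⟨r, hr, h⟩ := Metric.eventually_nhds_iff_ball.1 h1
  have h0 : (0 : ℝ) < min (r / 2) (1 / 2) := by positivity
  refine ⟨Real.toNNReal (min (r / 2) (1 / 2)), by simpa using hr, ?_, ?_⟩
  · rw [Real.coe_toNNReal _ h0.le]
    exact min_le_right _ _
  · rw [Real.coe_toNNReal _ h0.le]
    refine (h _ ?_).le
    rw [mem_ball, dist_zero_right, Real.norm_eq_abs, abs_of_pos h0]
    linarith [min_le_left (r / 2) (1 / 2 : ℝ)]

theorem Frame.hasStrictFDerivAt_graph (fr : Frame m) {q : Sph (m + 1)} (hq : fr.q = q)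
    {φ : E m → ℝ} (hφ : ContDiff ℝ 1 φ) (h0 : φ 0 = 0) (hd : fderiv ℝ φ 0 = 0) :
    HasStrictFDerivAt (fun v => (nproj (fr.graph φ v) : E (m + 2)))
      fr.J.toContinuousLinearMap 0 := by
  have hc : ContDiffAt ℝ 1 (fun v => (nproj (fr.graph φ v) : E (m + 2))) 0 :=
    ContDiffAt.comp (g := fun y : E (m + 2) => (nproj y : E (m + 2))) (0 : E m)
      (contDiffAt_coe_nproj (fr.graph_ne_zero φ 0) (k := 1))
      (fr.coord.contDiff.comp (hφ.prodMk (contDiff_const.prodMk contDiff_id))).contDiffAt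
  refine (hc.hasStrictFDerivAt one_ne_zero).congr_fderiv ?_
  have hg0 : fr.graph φ 0 = (q : E (m + 2)) := by rw [graph, h0, fr.coord_zero, hq]
  have h1 : HasFDerivAt (fr.graph φ) ((fr.coord : _ →L[ℝ] E (m + 2)).comp
      ((0 : E m →L[ℝ] ℝ).prod ((0 : E m →L[ℝ] ℝ).prod (ContinuousLinearMap.id ℝ (E m))))) 0 := by
    have h2 := (hφ.differentiable one_ne_zero 0).hasFDerivAt
    rw [hd] at h2
    exact fr.coord.hasFDerivAt.comp (0 : E m)
      (h2.prodMk ((hasFDerivAt_const (1 : ℝ) _).prodMk (hasFDerivAt_id _)))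
  have hN := hasFDerivAt_coe_nproj q
  rw [← hg0] at hN
  have h3 : fderiv ℝ (fun v => (nproj (fr.graph φ v) : E (m + 2))) 0 = _ :=
    (hN.comp (0 : E m) h1).fderiv
  rw [h3]
  ext v : 1
  have e3 : fr.coord (0, (0, v)) = fr.J v := by rw [fr.coord_apply]; simp
  simp [hg0, e3, ← hq, fr.inner_q_J]

/-- The parametrization has the isometry `J` as its strict derivative at `0`, so on a small ball it
changes distances by a relative error of at most `c`. -/
theorem Frame.exists_bilipschitz (fr : Frame m) {q : Sph (m + 1)} (hq : fr.q = q)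
    {φ : E m → ℝ} (hφ : ContDiff ℝ 1 φ) (h0 : φ 0 = 0) (hd : fderiv ℝ φ 0 = 0) {ε : ℝ}
    (hε : 0 < ε) : ∃ K : NNReal, (K : ℝ) ^ m ≤ 1 + ε ∧ ∃ r > 0,
      LipschitzOnWith K (fun v => nproj (fr.graph φ v)) (ball 0 r) ∧
      ∀ v ∈ ball (0 : E m) r, ∀ w ∈ ball (0 : E m) r,
        dist v w ≤ K * dist (nproj (fr.graph φ v)) (nproj (fr.graph φ w)) := by
  obtain ⟨c, hc0, hc, hcm⟩ := exists_pow_one_add_le m hε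
  obtain ⟨s, hs, hA⟩ := (fr.hasStrictFDerivAt_graph hq hφ h0 hd).approximates_deriv_on_nhds
    (Or.inr hc0)
  obtain ⟨r, hr, hrs⟩ := Metric.mem_nhds_iff.1 hs
  have hb : ∀ v ∈ ball (0 : E m) r, ∀ w ∈ ball (0 : E m) r,
      |dist (nproj (fr.graph φ v)) (nproj (fr.graph φ w)) - dist v w| ≤ c * dist v w := by
    intro v hv w hw
    have h1 := hA v (hrs hv) w (hrs hw)
    rw [Subtype.dist_eq, dist_eq_norm, dist_eq_norm, ← fr.J.norm_map (v - w)]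
    refine (abs_norm_sub_norm_le _ _).trans ?_
    rw [fr.J.norm_map]
    exact h1
  refine ⟨1 + 2 * c, by simpa using hcm, r, hr, LipschitzOnWith.of_dist_le_mul fun v hv w hw => ?_,
    fun v hv w hw => ?_⟩
  · have := (abs_le.1 (hb v hv w hw)).2
    push_cast
    nlinarith [dist_nonneg (x := v) (y := w), c.2]
  · have := (abs_le.1 (hb v hv w hw)).1
    push_cast
    have h2 : (1 - (c : ℝ)) * dist v w ≤ dist (nproj (fr.graph φ v)) (nproj (fr.graph φ w)) := by
      linarith
    -- The product is `1 + c (1 - 2 c)`; this is the use of `c ≤ 1 / 2`, and the reason for the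
    -- Lipschitz constant `1 + 2 c`.
    have h3 : (1 : ℝ) ≤ (1 + 2 * c) * (1 - c) := by nlinarith [c.2]
    calc dist v w ≤ (1 + 2 * c) * (1 - c) * dist v w :=
          le_mul_of_one_le_left dist_nonneg h3
      _ = (1 + 2 * (c : ℝ)) * ((1 - c) * dist v w) := by ring
      _ ≤ _ := mul_le_mul_of_nonneg_left h2 (by positivity)

/-- Dividing the coordinates of a sector point by `s` does not change its radial projection, so the
description of the frontier at height `s = 1` covers the whole sector. -/
theorem Frame.image_graph_eq (fr : Frame m) {V : Set (Sph (m + 1))} {φ : E m → ℝ} {δ δ' : ℝ}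
    (hδ' : δ' ≤ δ) (hφ : ∀ v, ‖v‖ < δ' → |φ v| < δ)
    (hV : ∀ t v, |t| < δ → ‖v‖ < δ → (nproj (fr.coord (t, (1, v))) ∈ frontier V ↔ t = φ v)) :
    (fun v => nproj (fr.graph φ v)) '' ball 0 δ' = frontier V ∩ fr.sector δ δ' := by
  ext p
  constructor
  · rintro ⟨v, hv, rfl⟩
    rw [mem_ball, dist_zero_right] at hv
    refine ⟨(hV _ v (hφ v hv) (hv.trans_le hδ')).2 rfl, ?_⟩
    simp only
    rw [graph, fr.nproj_mem_sector (fr.graph_ne_zero φ v)]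
    simpa using ⟨hφ v hv, hv⟩
  · rintro ⟨hp, hs⟩
    obtain ⟨⟨t, s, v⟩, hc⟩ : ∃ c, fr.coord c = p := fr.coord.surjective _
    have h0 : fr.coord (t, (s, v)) ≠ 0 := by rw [hc]; exact coe_sph_ne_zero p
    have hp' : p = nproj (fr.coord (t, (s, v))) := by rw [hc, nproj_coe]
    rw [hp', fr.nproj_mem_sector h0] at hs
    obtain ⟨hs0, ht, hv⟩ := hs
    simp only at hs0 ht hv
    have e : p = nproj (fr.coord (s⁻¹ * t, (1, s⁻¹ • v))) := by
      rw [hp', ← nproj_smul (inv_pos.2 hs0) h0, ← map_smul]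
      simp [inv_mul_cancel₀ hs0.ne']
    have hv' : ‖s⁻¹ • v‖ < δ' := by
      rw [norm_smul, Real.norm_of_nonneg (inv_pos.2 hs0).le, inv_mul_lt_iff₀ hs0]
      linarith
    have ht' : |s⁻¹ * t| < δ := by
      rw [abs_mul, abs_of_pos (inv_pos.2 hs0), inv_mul_lt_iff₀ hs0]
      linarith
    refine ⟨s⁻¹ • v, by simpa using hv', ?_⟩
    rw [e] at hp
    have := (hV _ _ ht' (hv'.trans_le hδ')).1 hp
    simp only [graph]
    rw [← this, ← e]

/-- The flux integral: the divergence of the annular localization of `Y`, over the cone on `V`. -/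
def fluxOver {n : ℕ} (V : Set (Sph n)) (Y : E (n + 1) → E (n + 1)) : ℝ :=
  ∫ y in cone V, LinearMap.trace ℝ _ (fderiv ℝ (annular Y) y).toLinearMap

theorem fderiv_eq_zero_of_notMem_tsupport {F G : Type*} [NormedAddCommGroup F] [NormedSpace ℝ F]
    [NormedAddCommGroup G] [NormedSpace ℝ G] {f : F → G} {y : F} (hy : y ∉ tsupport f) :
    fderiv ℝ f y = 0 := by
  by_contra h
  exact hy (support_fderiv_subset ℝ h)

/-- Off the support of the annular field both integrands are zero. On the support the point projects
into the sector and has scale in `(1/2, 2)`, and there membership in the cone is `t / s < φ (v /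
s)`, that is, `t < homGraph φ (s, v)`. -/
theorem Frame.fluxOver_eq (fr : Frame m) {V : Set (Sph (m + 1))} (hVo : IsOpen V) {φ : E m → ℝ}
    (hφ : ContDiff ℝ 1 φ) {δ δ' : ℝ} (hδ : δ ≤ 1) (hδ' : δ' ≤ δ)
    (hV : ∀ t v, |t| < δ → ‖v‖ < δ → (nproj (fr.coord (t, (1, v))) ∈ V ↔ t < φ v))
    {Y : E (m + 2) → E (m + 2)} {K : Set (Sph (m + 1))} (hK : IsCompact K)
    (hKs : K ⊆ fr.sector δ δ') (hY : ∀ y, y ≠ 0 → nproj y ∉ K → Y y = 0) :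
    fluxOver V Y = ∫ p in {p : ℝ × (ℝ × E m) | p.1 < homGraph φ p.2},
      LinearMap.trace ℝ _ (fderiv ℝ (annular Y) (fr.coord p)).toLinearMap := by
  have hmeas : MeasurableSet {p : ℝ × (ℝ × E m) | p.1 < homGraph φ p.2} :=
    measurableSet_lt measurable_fst
      ((contDiff_homGraph hφ).continuous.measurable.comp measurable_snd)
  rw [fluxOver, ← fr.measurePreserving_coord.setIntegral_preimage_emb
    fr.coord.toHomeomorph.measurableEmbedding]
  change ∫ p in fr.coord ⁻¹' cone V, LinearMap.trace ℝ _
    (fderiv ℝ (annular Y) (fr.coord p)).toLinearMap = _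
  rw [← integral_indicator hmeas,
    ← integral_indicator (fr.coord.continuous.measurable (isOpen_cone hVo).measurableSet)]
  congr 1 with p
  by_cases hp : fr.coord p ∈ tsupport (annular Y)
  · obtain ⟨h1, h3, hpK⟩ := tsupport_annular_subset hK hY hp
    have h0 : fr.coord p ≠ 0 := fun h0 => by rw [h0] at h1; norm_num at h1
    have hs := fr.scale_mem_of_mem_sector hδ (hδ'.trans hδ) h0 (hKs hpK) h1 h3
    have hs0 : 0 < p.2.1 := by linarith [hs.1]
    obtain ⟨-, ht, hv⟩ := (fr.nproj_mem_sector h0).1 (hKs hpK)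
    obtain ⟨t, s, v⟩ := p
    simp only at hs hs0 ht hv
    have e : nproj (fr.coord (t, (s, v))) = nproj (fr.coord (s⁻¹ * t, (1, s⁻¹ • v))) := by
      rw [← nproj_smul (inv_pos.2 hs0) h0, ← map_smul]
      simp [inv_mul_cancel₀ hs0.ne']
    have hv' : ‖s⁻¹ • v‖ < δ' := by
      rw [norm_smul, Real.norm_of_nonneg (inv_pos.2 hs0).le, inv_mul_lt_iff₀ hs0]
      linarith
    have ht' : |s⁻¹ * t| < δ := by
      rw [abs_mul, abs_of_pos (inv_pos.2 hs0), inv_mul_lt_iff₀ hs0]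
      linarith
    have hiff : (t, (s, v)) ∈ fr.coord ⁻¹' cone V ↔
        (t, (s, v)) ∈ {p : ℝ × (ℝ × E m) | p.1 < homGraph φ p.2} := by
      rw [mem_preimage, cone, mem_ofPred_eq, and_iff_right h0, e,
        hV _ _ ht' (hv'.trans_le hδ'), mem_ofPred_eq, homGraph_eq φ (Ioo_subset_Icc_self hs),
        inv_mul_lt_iff₀ hs0]
    by_cases hm : (t, (s, v)) ∈ fr.coord ⁻¹' cone V
    · rw [indicator_of_mem hm, indicator_of_mem (hiff.1 hm)]
    · rw [indicator_of_notMem hm, indicator_of_notMem (fun h => hm (hiff.2 h))]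
  · have : LinearMap.trace ℝ _ (fderiv ℝ (annular Y) (fr.coord p)).toLinearMap = 0 := by
      rw [fderiv_eq_zero_of_notMem_tsupport hp]; simp
    simp [indicator, this]

end LocalEstimate

/-! ### The divergence theorem near a boundary point, up to a small relative error. -/

section LocalEstimateMain

variable {m : ℕ}

theorem surfaceMeasure_eq (m : ℕ) : surfaceMeasure (m + 1) = μHE[m] := rfl

theorem inner_tanGrad {n : ℕ} (ρ : E (n + 1) → ℝ) (q : Sph n) :
    inner ℝ (q : E (n + 1)) (tanGrad ρ q) = 0 := by
  rw [tanGrad, inner_sub_right, inner_smul_right, real_inner_self_eq_norm_sq, norm_coe_sph]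
  simp

theorem measurable_nproj_graph (fr : Frame m) {φ : E m → ℝ} (hφ : ContDiff ℝ 1 φ) :
    Continuous fun v => nproj (fr.graph φ v) :=
  continuousOn_nproj.comp_continuous
    (fr.coord.continuous.comp (hφ.continuous.prodMk (continuous_const.prodMk continuous_id)))
    fun v => fr.graph_ne_zero φ v

theorem continuous_restrict_sphere {n : ℕ} {F : Type*} [TopologicalSpace F] {a : E (n + 1) → F}
    (ha : ContinuousOn a {0}ᶜ) : Continuous fun p : Sph n => a p :=
  ha.comp_continuous continuous_subtype_val coe_sph_ne_zero

theorem integrableOn_of_continuous {X : Type*} [TopologicalSpace X] [CompactSpace X]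
    [MeasurableSpace X] [BorelSpace X] {μ : Measure X} {S : Set X} (hS : μ S < ⊤) {h : X → ℝ}
    (hh : Continuous h) : IntegrableOn h S μ := by
  have : IsFiniteMeasure (μ.restrict S) := ⟨by simpa using hS⟩
  exact hh.integrable_of_hasCompactSupport (HasCompactSupport.of_compactSpace h)

/-- Comparison of the boundary integral with the integral over the parameter domain. -/
theorem Frame.abs_boundary_sub_le (fr : Frame m) {φ : E m → ℝ} (hφ : ContDiff ℝ 1 φ)
    {K : NNReal} {ε : ℝ} (hε : 0 ≤ ε) (hKm : (K : ℝ) ^ m ≤ 1 + ε) {δ δ' : ℝ}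
    (hL : LipschitzOnWith K (fun v => nproj (fr.graph φ v)) (ball 0 δ'))
    (hA : ∀ v ∈ ball (0 : E m) δ', ∀ w ∈ ball (0 : E m) δ',
        dist v w ≤ K * dist (nproj (fr.graph φ v)) (nproj (fr.graph φ w)))
    {V : Set (Sph (m + 1))}
    (himg : (fun v => nproj (fr.graph φ v)) '' ball 0 δ' = frontier V ∩ fr.sector δ δ')
    {a : E (m + 2) → ℝ} (ha : ContinuousOn a {0}ᶜ) (hah : ∀ r : ℝ, 0 < r → ∀ y, a (r • y) = a y)
    (has : ∀ y, y ≠ 0 → nproj y ∉ fr.sector δ δ' → a y = 0) :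
    |∫ p in frontier V, a p ∂surfaceMeasure (m + 1) - ∫ v, a (fr.graph φ v)| ≤
      2 * ε * ∫ p in frontier V, |a p| ∂surfaceMeasure (m + 1) := by
  have hac := continuous_restrict_sphere ha
  have hS : (surfaceMeasure (m + 1)) ((fun v => nproj (fr.graph φ v)) '' ball 0 δ') < ⊤ := by
    rw [surfaceMeasure_eq]
    refine (euclideanHausdorffMeasure_image_le hL m).trans_lt ?_
    rw [EuclideanSpace.euclideanHausdorffMeasure_eq_volume]
    exact ENNReal.mul_lt_top (by simp) measure_ball_lt_top
  have h := abs_setIntegral_image_sub_le (m := m) hε hKm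
    (measurable_nproj_graph fr hφ).measurable hL hA
    (integrableOn_of_continuous (μ := surfaceMeasure (m + 1)) hS hac) hac.measurable
  rw [himg] at h
  have hz : ∀ p : Sph (m + 1), p ∉ fr.sector δ δ' → a p = 0 := fun p hp =>
    has _ (coe_sph_ne_zero p) (by rwa [nproj_coe])
  have e1 : ∀ b : Sph (m + 1) → ℝ, (∀ p, p ∉ fr.sector δ δ' → b p = 0) →
      ∫ p in frontier V ∩ fr.sector δ δ', b p ∂surfaceMeasure (m + 1) =
        ∫ p in frontier V, b p ∂surfaceMeasure (m + 1) := fun b hb => by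
    exact (setIntegral_eq_of_subset_of_forall_sdiff_eq_zero isClosed_frontier.measurableSet
      inter_subset_left fun p hp => hb p fun h => hp.2 ⟨hp.1, h⟩).symm
  -- Constancy of `a` along rays allows the graph point itself in place of its projection; outside
  -- the ball the graph leaves the sector and `a` vanishes.
  have e2 : ∫ v in ball 0 δ', a (nproj (fr.graph φ v)) = ∫ v, a (fr.graph φ v) := by
    have : ∀ v, a (nproj (fr.graph φ v)) = a (fr.graph φ v) := fun v => by
      rw [coe_nproj (fr.graph_ne_zero φ v)]
      exact hah _ (inv_pos.2 (norm_pos_iff.2 (fr.graph_ne_zero φ v))) _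
    simp_rw [this]
    refine setIntegral_eq_integral_of_forall_compl_eq_zero fun v hv =>
      has _ (fr.graph_ne_zero φ v) ?_
    rw [graph, fr.nproj_mem_sector (fr.graph_ne_zero φ v)]
    simp only [mul_one]
    exact fun h => hv (by simpa using h.2.2)
  rw [← e1 _ hz, ← e1 _ (fun p hp => by rw [hz p hp, abs_zero]), ← e2]
  exact h

/-- At the base point the graph is tangent to `ν⊥`, the parametrization is isometric to first order,
and the radial weight is one. By continuity all three hold up to `ε₁` in a small sector, and the
flux is compared with the boundary integral through integrals over the parameter ball. The normal is
frozen at `q` here. -/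
theorem exists_local_estimate {V : Set (Sph (m + 1))} (hVo : IsOpen V) {q : Sph (m + 1)}
    (hq : q ∈ frontier V) {ρ : E (m + 2) → ℝ} (hρ : IsDefiningAt V q ρ) {ε : ℝ} (hε : 0 < ε) :
    ∃ O : Set (Sph (m + 1)), IsOpen O ∧ q ∈ O ∧ surfaceMeasure (m + 1) (frontier V ∩ O) < ⊤ ∧
      ∀ (Y : E (m + 2) → E (m + 2)) (K : Set (Sph (m + 1))), ContDiffOn ℝ 1 Y {0}ᶜ →
        (∀ r : ℝ, 0 < r → ∀ y, Y (r • y) = Y y) → IsCompact K → K ⊆ O →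
        (∀ y, y ≠ 0 → nproj y ∉ K → Y y = 0) →
        |fluxOver V Y - radialMoment m *
          ∫ p in frontier V, inner ℝ (‖tanGrad ρ q‖⁻¹ • tanGrad ρ q) (Y p)
            ∂surfaceMeasure (m + 1)| ≤
        ε * ∫ p in frontier V, ‖Y p‖ ∂surfaceMeasure (m + 1) := by
  have ha : 0 < ‖tanGrad ρ q‖ := norm_pos_iff.2 hρ.2.1
  obtain ⟨fr, hfq, hfν⟩ := Frame.exists (norm_coe_sph q)
    (show ‖‖tanGrad ρ q‖⁻¹ • tanGrad ρ q‖ = 1 by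
      rw [norm_smul, norm_inv, norm_norm, inv_mul_cancel₀ ha.ne'])
    (by rw [inner_smul_right, inner_tanGrad, mul_zero])
  obtain ⟨φ, hφ, hφ0, hφd, δ₀, hδ₀, hbox⟩ := exists_local_graph hVo hq hρ hfq hfν
  have hc0 := radialMoment_pos m
  set c := radialMoment m with hc
  -- The constant collects the three errors below: `3 (m + 1)` from the slopes, `3` from the radial
  -- weight and `2` from comparing measures.
  obtain ⟨ε₁, hε₁, hε₁1, hε₁ε⟩ : ∃ ε₁ : ℝ, 0 < ε₁ ∧ ε₁ ≤ 1 ∧ c * (3 * m + 8) * ε₁ ≤ ε := by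
    have hp : 0 < c * (3 * m + 8) := by positivity
    refine ⟨min 1 (ε / (c * (3 * m + 8))), by positivity, min_le_left _ _, ?_⟩
    calc _ ≤ c * (3 * m + 8) * (ε / (c * (3 * m + 8))) := by gcongr; exact min_le_right _ _
      _ = ε := mul_div_cancel₀ _ hp.ne'
  obtain ⟨K, hKm, r, hr, hL, hA⟩ := fr.exists_bilipschitz hfq hφ hφ0 hφd hε₁
  set δ := min δ₀ 1 with hδdef
  have hδ : 0 < δ := by positivity
  have hDc : Continuous (fderiv ℝ φ) := hφ.continuous_fderiv one_ne_zero
  have hγc : Continuous (fr.graph φ) :=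
    fr.coord.continuous.comp (hφ.continuous.prodMk (continuous_const.prodMk continuous_id))
  -- The first bound keeps the graph in the box, the next two are the slopes of `homGraph` in the
  -- directions `q` and `J`, and the last one controls the radial weight.
  have hsmall : ∀ᶠ v in 𝓝 (0 : E m), |φ v| < δ ∧ |φ v - fderiv ℝ φ v v| < ε₁ ∧
      (∀ i, |fderiv ℝ φ v (EuclideanSpace.single i 1)| < ε₁) ∧
      1 - ε₁ < (‖fr.graph φ v‖ ^ (m + 1))⁻¹ := by
    refine .and ?_ (.and ?_ (.and (Filter.eventually_all.2 fun i => ?_) ?_))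
    · exact (hφ.continuous.abs.tendsto' 0 0 (by simp [hφ0])).eventually_lt_const hδ
    · exact ((hφ.continuous.sub (hDc.clm_apply continuous_id)).abs.tendsto' 0 0
        (by simp [hφ0])).eventually_lt_const hε₁
    · exact ((hDc.clm_apply continuous_const).abs.tendsto' 0 0
        (by simp [hφd])).eventually_lt_const hε₁
    · have h1 : Continuous fun v => (‖fr.graph φ v‖ ^ (m + 1))⁻¹ :=
        (hγc.norm.pow _).inv₀ fun v => pow_ne_zero _ (norm_ne_zero_iff.2 (fr.graph_ne_zero φ v))
      refine (h1.tendsto' 0 1 ?_).eventually_const_lt (by linarith)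
      rw [Frame.graph, hφ0, fr.coord_zero, fr.norm_q]
      simp
  obtain ⟨r₂, hr₂, hb⟩ := Metric.eventually_nhds_iff_ball.1 hsmall
  set δ' := min δ (min r r₂) with hδ'def
  have hδ' : 0 < δ' := by positivity
  have hδδ' : δ' ≤ δ := min_le_left _ _
  have hδ1 : δ ≤ 1 := min_le_right _ _
  have hsub : ball (0 : E m) δ' ⊆ ball 0 r :=
    ball_subset_ball ((min_le_right _ _).trans (min_le_left _ _))
  have hb' : ∀ v : E m, ‖v‖ < δ' → _ := fun v hv => hb v (by
    rw [mem_ball, dist_zero_right]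
    exact hv.trans_le ((min_le_right _ _).trans (min_le_right _ _)))
  have himg := fr.image_graph_eq (V := V) (φ := φ) hδδ' (fun v hv => (hb' v hv).1)
    fun t v ht hv => (hbox t v (ht.trans_le (min_le_left _ _)) (hv.trans_le (min_le_left _ _))).2
  refine ⟨fr.sector δ δ', fr.isOpen_sector δ δ', ?_, ?_, ?_⟩
  · have : q = nproj (fr.coord (0, (1, 0))) := by rw [fr.coord_zero, hfq, nproj_coe]
    rw [this, fr.nproj_mem_sector (fr.coord_one_ne_zero _ _)]
    simp [hδ, hδ']
  · rw [← himg, surfaceMeasure_eq]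
    refine (euclideanHausdorffMeasure_image_le (hL.mono hsub) m).trans_lt ?_
    rw [EuclideanSpace.euclideanHausdorffMeasure_eq_volume]
    exact ENNReal.mul_lt_top (by simp) measure_ball_lt_top
  intro Y KY hY hYh hKY hKYs hYK
  have hYs : ∀ y, y ≠ 0 → nproj y ∉ fr.sector δ δ' → Y y = 0 := fun y hy h =>
    hYK y hy fun h' => h (hKYs h')
  rw [← hfν]
  have hhc := contDiff_homGraph hφ
  have hT := fr.abs_integral_subgraph_trace_sub_le (contDiff_annular hY)
    (hasCompactSupport_annular Y) hhc (ε := ε₁) ?_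
  swap
  · rintro ⟨s, v⟩ hz
    obtain ⟨h1, h3, hpK⟩ := tsupport_annular_subset hKY hYK (subset_tsupport _ hz)
    have h0 : fr.coord (homGraph φ (s, v), (s, v)) ≠ 0 := fun h0 => by
      rw [h0] at h1; norm_num at h1
    have hs : s ∈ Ioo (1 / 2 : ℝ) 2 :=
      fr.scale_mem_of_mem_sector hδ1 (hδδ'.trans hδ1) h0 (hKYs hpK) h1 h3
    have hs0 : 0 < s := by linarith [hs.1]
    have hv : ‖v‖ < δ' * s := ((fr.nproj_mem_sector h0).1 (hKYs hpK)).2.2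
    have hv' : ‖s⁻¹ • v‖ < δ' := by
      rw [norm_smul, Real.norm_of_nonneg (inv_pos.2 hs0).le, inv_mul_lt_iff₀ hs0]
      linarith
    obtain ⟨-, hb1, hb2, -⟩ := hb' _ hv'
    refine ⟨?_, fun i => ?_⟩
    · rw [fderiv_homGraph hφ hs]
      simpa using hb1.le
    · rw [fderiv_homGraph hφ hs]
      simpa using (hb2 i).le
  rw [← fr.fluxOver_eq hVo hφ hδ1 hδδ' (fun t v ht hv =>
    (hbox t v (ht.trans_le (min_le_left _ _)) (hv.trans_le (min_le_left _ _))).1)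
    hKY hKYs hYK] at hT
  have hA1 : ContinuousOn (fun y => inner ℝ fr.ν (Y y)) {0}ᶜ :=
    continuousOn_const.inner hY.continuousOn
  have hA2 : ContinuousOn (fun y => ‖Y y‖) {0}ᶜ := hY.continuousOn.norm
  have hN := fr.integral_homGraph hδ1 (hδδ'.trans hδ1) hφ hA1 (fun r hr y => by rw [hYh r hr])
    (fun y hy h => by rw [hYs y hy h, inner_zero_right])
  have hM := fr.integral_homGraph hδ1 (hδδ'.trans hδ1) hφ hA2 (fun r hr y => by rw [hYh r hr])
    (fun y hy h => by rw [hYs y hy h, norm_zero])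
  have hB1 := fr.abs_boundary_sub_le hφ hε₁.le hKm (hL.mono hsub)
    (fun v hv w hw => hA v (hsub hv) w (hsub hw)) himg hA1 (fun r hr y => by rw [hYh r hr])
    (fun y hy h => by rw [hYs y hy h, inner_zero_right])
  have hB2 := fr.abs_boundary_sub_le hφ hε₁.le hKm (hL.mono hsub)
    (fun v hv w hw => hA v (hsub hv) w (hsub hw)) himg hA2 (fun r hr y => by rw [hYh r hr])
    (fun y hy h => by rw [hYs y hy h, norm_zero])
  have hYγ : Continuous fun v => Y (fr.graph φ v) :=
    hY.continuousOn.comp_continuous hγc fun v => fr.graph_ne_zero φ v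
  have hYz : ∀ v, ¬ ‖v‖ < δ' → Y (fr.graph φ v) = 0 := fun v hv => by
    refine hYs _ (fr.graph_ne_zero φ v) ?_
    rw [Frame.graph, fr.nproj_mem_sector (fr.graph_ne_zero φ v)]
    simp only [mul_one]
    exact fun h => hv h.2.2
  have hYc : HasCompactSupport fun v => Y (fr.graph φ v) :=
    HasCompactSupport.intro (isCompact_closedBall (0 : E m) δ') fun v hv =>
      hYz v fun h => hv (by simpa using h.le)
  have hwc : Continuous fun v => (‖fr.graph φ v‖ ^ (m + 1))⁻¹ :=
    (hγc.norm.pow _).inv₀ fun v => pow_ne_zero _ (norm_ne_zero_iff.2 (fr.graph_ne_zero φ v))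
  have hw1 : ∀ v, (‖fr.graph φ v‖ ^ (m + 1))⁻¹ ≤ 1 := fun v =>
    inv_le_one_of_one_le₀ (one_le_pow₀ (fr.one_le_norm_graph φ v))
  have hw0 : ∀ v, 0 ≤ (‖fr.graph φ v‖ ^ (m + 1))⁻¹ := fun v => by positivity
  have hic : HasCompactSupport fun v => inner ℝ fr.ν (Y (fr.graph φ v)) :=
    hYc.comp_left (g := fun y => inner ℝ fr.ν y) (inner_zero_right _)
  have hi1 : Integrable fun v => inner ℝ fr.ν (Y (fr.graph φ v)) :=
    (continuous_const.inner hYγ).integrable_of_hasCompactSupport hic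
  have hi2 : Integrable fun v => (‖fr.graph φ v‖ ^ (m + 1))⁻¹ * inner ℝ fr.ν (Y (fr.graph φ v)) :=
    (hwc.mul (continuous_const.inner hYγ)).integrable_of_hasCompactSupport hic.mul_left
  have hi3 : Integrable fun v => ‖Y (fr.graph φ v)‖ :=
    hYγ.norm.integrable_of_hasCompactSupport hYc.norm
  have hi4 : Integrable fun v => (‖fr.graph φ v‖ ^ (m + 1))⁻¹ * ‖Y (fr.graph φ v)‖ :=
    (hwc.mul hYγ.norm).integrable_of_hasCompactSupport hYc.norm.mul_left
  have hM' : ∫ v, (‖fr.graph φ v‖ ^ (m + 1))⁻¹ * ‖Y (fr.graph φ v)‖ ≤ ∫ v, ‖Y (fr.graph φ v)‖ :=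
    integral_mono hi4 hi3 fun v => mul_le_of_le_one_left (norm_nonneg _) (hw1 v)
  have hW : |(∫ v, (‖fr.graph φ v‖ ^ (m + 1))⁻¹ * inner ℝ fr.ν (Y (fr.graph φ v))) -
      ∫ v, inner ℝ fr.ν (Y (fr.graph φ v))| ≤ ε₁ * ∫ v, ‖Y (fr.graph φ v)‖ := by
    rw [← integral_sub hi2 hi1, ← integral_const_mul, ← Real.norm_eq_abs]
    refine norm_integral_le_of_norm_le (hi3.const_mul ε₁) (Filter.Eventually.of_forall fun v => ?_)
    by_cases hv : ‖v‖ < δ'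
    · have h1 := norm_inner_le_norm (𝕜 := ℝ) fr.ν (Y (fr.graph φ v))
      rw [fr.norm_ν, one_mul] at h1
      rw [← sub_one_mul, norm_mul]
      refine mul_le_mul ?_ h1 (norm_nonneg _) hε₁.le
      rw [Real.norm_eq_abs, abs_le]
      constructor <;> linarith [hw1 v, (hb' v hv).2.2.2]
    · simp [hYz v hv]
  simp only [annular, inner_smul_right, norm_smul, Real.norm_of_nonneg radialBump.nonneg] at hT
  rw [hN, hM] at hT
  simp only [abs_norm] at hB2
  have hB1' : |∫ p in frontier V, inner ℝ fr.ν (Y p) ∂surfaceMeasure (m + 1) -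
      ∫ v, inner ℝ fr.ν (Y (fr.graph φ v))| ≤
      2 * ε₁ * ∫ p in frontier V, ‖Y p‖ ∂surfaceMeasure (m + 1) := by
    refine hB1.trans (mul_le_mul_of_nonneg_left ?_ (by positivity))
    have hfin : surfaceMeasure (m + 1) (frontier V ∩ fr.sector δ δ') < ⊤ := by
      rw [← himg, surfaceMeasure_eq]
      refine (euclideanHausdorffMeasure_image_le (hL.mono hsub) m).trans_lt ?_
      rw [EuclideanSpace.euclideanHausdorffMeasure_eq_volume]
      exact ENNReal.mul_lt_top (by simp) measure_ball_lt_top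
    have e1 : ∀ b : Sph (m + 1) → ℝ, (∀ p, p ∉ fr.sector δ δ' → b p = 0) →
        ∫ p in frontier V ∩ fr.sector δ δ', b p ∂surfaceMeasure (m + 1) =
          ∫ p in frontier V, b p ∂surfaceMeasure (m + 1) := fun b hb =>
      (setIntegral_eq_of_subset_of_forall_sdiff_eq_zero isClosed_frontier.measurableSet
        inter_subset_left fun p hp => hb p fun h => hp.2 ⟨hp.1, h⟩).symm
    have hz : ∀ p : Sph (m + 1), p ∉ fr.sector δ δ' → Y p = 0 := fun p hp =>
      hYs _ (coe_sph_ne_zero p) (by rwa [nproj_coe])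
    rw [← e1 _ (fun p hp => by rw [hz p hp, inner_zero_right, abs_zero]),
      ← e1 _ (fun p hp => by rw [hz p hp, norm_zero])]
    refine integral_mono (integrableOn_of_continuous hfin (continuous_restrict_sphere hA1).abs)
      (integrableOn_of_continuous hfin (continuous_restrict_sphere hA2)) fun p => ?_
    have h1 := norm_inner_le_norm (𝕜 := ℝ) fr.ν (Y p)
    rwa [fr.norm_ν, one_mul] at h1
  have hI0 : 0 ≤ ∫ p in frontier V, ‖Y p‖ ∂surfaceMeasure (m + 1) :=
    integral_nonneg fun _ => norm_nonneg _
  set I := ∫ p in frontier V, ‖Y p‖ ∂surfaceMeasure (m + 1)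
  set J := ∫ p in frontier V, inner ℝ fr.ν (Y p) ∂surfaceMeasure (m + 1)
  set I' := ∫ v, ‖Y (fr.graph φ v)‖
  set J' := ∫ v, inner ℝ fr.ν (Y (fr.graph φ v))
  set W := ∫ v, (‖fr.graph φ v‖ ^ (m + 1))⁻¹ * inner ℝ fr.ν (Y (fr.graph φ v))
  -- The comparison of measures gives `|I - I'| ≤ 2 ε₁ I`, and `ε₁ ≤ 1`.
  have hI' : I' ≤ 3 * I := by
    have := (abs_le.1 hB2).1
    nlinarith
  have h1 : |c * (W - J')| ≤ c * (ε₁ * (3 * I)) := by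
    rw [abs_mul, abs_of_pos hc0]
    exact mul_le_mul_of_nonneg_left (hW.trans (mul_le_mul_of_nonneg_left hI' hε₁.le)) hc0.le
  have h2 : |c * (J - J')| ≤ c * (2 * ε₁ * I) := by
    rw [abs_mul, abs_of_pos hc0]
    exact mul_le_mul_of_nonneg_left hB1' hc0.le
  have h3 : |fluxOver V Y - c * W| ≤ (m + 1) * (ε₁ * (c * (3 * I))) := by
    refine hT.trans ?_
    gcongr
    exact hM'.trans hI'
  have h4 : c * (3 * m + 8) * ε₁ * I ≤ ε * I := mul_le_mul_of_nonneg_right hε₁ε hI0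
  have h5 : fluxOver V Y - c * J = (fluxOver V Y - c * W) + c * (W - J') - c * (J - J') := by ring
  rw [h5]
  refine (abs_sub _ _).trans ?_
  refine (add_le_add (abs_add_le _ _) le_rfl).trans ?_
  refine le_trans (add_le_add (add_le_add h3 h1) h2) (le_trans (le_of_eq ?_) h4)
  ring

end LocalEstimateMain

/-! ### C¹ functions on the sphere extended along rays. -/

section Smoothness

variable {n : ℕ}

theorem contMDiffAt_nproj {y : E (n + 1)} (hy : y ≠ 0) :
    ContMDiffAt 𝓘(ℝ, E (n + 1)) (𝓡 n) 1 nproj y := by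
  let W : TopologicalSpace.Opens (E (n + 1)) := ⟨{0}ᶜ, isOpen_compl_singleton⟩
  have h1 : ContMDiff 𝓘(ℝ, E (n + 1)) 𝓘(ℝ, E (n + 1)) 1
      (fun x : W => (nproj (x : E (n + 1)) : E (n + 1))) := fun x =>
    (contMDiffAt_subtype_iff (U := W)).2 (contDiffAt_coe_nproj (k := 1) x.2).contMDiffAt
  have : Fact (Module.finrank ℝ (E (n + 1)) = n + 1) := ⟨finrank_euclideanSpace_fin⟩
  have h2 := (h1.codRestrict_sphere (n := n) fun x => (nproj (x : E (n + 1))).2) ⟨y, hy⟩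
  exact (contMDiffAt_subtype_iff (U := W) (f := nproj) (x := ⟨y, hy⟩)).1 h2

theorem ContMDiffOn.contDiffOn_comp_nproj {G : Type*} [NormedAddCommGroup G] [NormedSpace ℝ G]
    {U : Set (Sph n)} (hU : IsOpen U) {F : Sph n → G} (hF : ContMDiffOn (𝓡 n) 𝓘(ℝ, G) 1 F U) :
    ContDiffOn ℝ 1 (fun y => F (nproj y)) (cone U) := by
  intro y hy
  have h1 := (hF.contMDiffAt (hU.mem_nhds hy.2)).comp y (contMDiffAt_nproj hy.1)
  exact (contMDiffAt_iff_contDiffAt.1 h1).contDiffWithinAt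

end Smoothness

/-! ### Uniqueness and continuity of the outward normal. -/

section OutwardNormal

variable {n : ℕ} {V : Set (Sph n)}

theorem continuousAt_tanGrad {ρ : E (n + 1) → ℝ} {q : Sph n} (hρ : ContDiffAt ℝ 1 ρ q) :
    ContinuousAt (tanGrad ρ) q := by
  have h1 : ContinuousAt (fun p : Sph n => ∇ ρ (p : E (n + 1))) q := by
    have := (InnerProductSpace.toDual ℝ (E (n + 1))).symm.continuous.continuousAt.comp
      (hρ.continuousAt_fderiv one_ne_zero)
    exact this.comp (f := fun p : Sph n => (p : E (n + 1))) continuous_subtype_val.continuousAt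
  have h2 : ContinuousAt (fun p : Sph n => (p : E (n + 1))) q :=
    continuous_subtype_val.continuousAt
  exact h1.fun_sub ((ContinuousAt.inner (𝕜 := ℝ) h2 h1).fun_smul h2)

theorem IsDefiningAt.eventually {ρ : E (n + 1) → ℝ} {q : Sph n} (hρ : IsDefiningAt V q ρ) :
    ∀ᶠ p in 𝓝 q, IsDefiningAt V p ρ := by
  have hc : ∀ᶠ x : Sph n in 𝓝 q, ContDiffAt ℝ 1 ρ x :=
    continuous_subtype_val.continuousAt.eventually (hρ.1.eventually (by simp))
  filter_upwards [hc, (continuousAt_tanGrad hρ.1).eventually_ne hρ.2.1, hρ.2.2.eventually_nhds]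
    with p h1 h2 h3 using ⟨h1, h2, h3⟩

/-- A tangent direction along which `ρ` decreases (increases) leads into (out of) `{ρ < 0}`. -/
theorem hasDerivAt_comp_nproj {ρ : E (n + 1) → ℝ} {q : Sph n} (hρ : DifferentiableAt ℝ ρ q)
    {h : E (n + 1)} (hh : inner ℝ (q : E (n + 1)) h = 0) :
    HasDerivAt (fun t : ℝ => ρ (nproj ((q : E (n + 1)) + t • h))) (inner ℝ (tanGrad ρ q) h) 0 := by
  have h0 : HasDerivAt (fun t : ℝ => (q : E (n + 1)) + t • h) h 0 := by
    simpa using ((hasDerivAt_id (0 : ℝ)).smul_const h).const_add (q : E (n + 1))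
  have hN := hasFDerivAt_coe_nproj q
  have e : (q : E (n + 1)) + (0 : ℝ) • h = q := by simp
  rw [← e] at hN
  have h1 := hN.comp_hasDerivAt (0 : ℝ) h0
  have hd : HasFDerivAt ρ (fderiv ℝ ρ q) (((fun y : E (n + 1) => (nproj y : E (n + 1))) ∘
      fun t : ℝ => (q : E (n + 1)) + t • h) 0) := by
    have : (((fun y : E (n + 1) => (nproj y : E (n + 1))) ∘
      fun t : ℝ => (q : E (n + 1)) + t • h) 0) = (q : E (n + 1)) := by
      simp [nproj_coe]
    rw [this]
    exact hρ.hasFDerivAt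
  have h2 := hd.comp_hasDerivAt (0 : ℝ) h1
  refine (h2.congr_deriv ?_)
  rw [← fderiv_eq_inner_tanGrad hρ hh]
  simp [hh]

theorem eventually_mem_of_inner_neg {ρ : E (n + 1) → ℝ} {q : Sph n} (hρ : IsDefiningAt V q ρ)
    (h0 : ρ q = 0) {h : E (n + 1)} (hh : inner ℝ (q : E (n + 1)) h = 0) :
    (inner ℝ (tanGrad ρ q) h < 0 → ∀ᶠ t in 𝓝[>] (0 : ℝ), nproj ((q : E (n + 1)) + t • h) ∈ V) ∧
    (0 < inner ℝ (tanGrad ρ q) h → ∀ᶠ t in 𝓝[>] (0 : ℝ), nproj ((q : E (n + 1)) + t • h) ∉ V) := by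
  have hd := hasDerivAt_comp_nproj (hρ.1.differentiableAt one_ne_zero) hh
  have hc : Filter.Tendsto (fun t : ℝ => nproj ((q : E (n + 1)) + t • h)) (𝓝[>] 0) (𝓝 q) := by
    have h1 : ContinuousAt (fun t : ℝ => nproj ((q : E (n + 1)) + t • h)) 0 := by
      refine ContinuousAt.comp (g := nproj) ?_ (by fun_prop)
      exact continuousAt_nproj (by simpa using coe_sph_ne_zero q)
    have h2 := h1.tendsto
    simp only [zero_smul, add_zero, nproj_coe] at h2
    exact h2.mono_left nhdsWithin_le_nhds
  have hV := hc.eventually hρ.2.2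
  have hs := (hasDerivAt_iff_tendsto_slope.1 hd).mono_left
    (nhdsWithin_mono (0 : ℝ) fun t (ht : 0 < t) => ht.ne')
  have hsl : ∀ t : ℝ, slope (fun t : ℝ => ρ (nproj ((q : E (n + 1)) + t • h))) 0 t =
      t⁻¹ * ρ (nproj ((q : E (n + 1)) + t • h)) := fun t => by
    simp [slope, nproj_coe, h0]
  constructor
  · intro hneg
    filter_upwards [hs.eventually_lt_const hneg, hV, self_mem_nhdsWithin] with t h1 h2 h3
    rw [hsl] at h1
    exact h2.2 (neg_of_mul_neg_right h1 (inv_pos.2 h3).le)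
  · intro hpos
    filter_upwards [hs.eventually_const_lt hpos, hV, self_mem_nhdsWithin] with t h1 h2 h3 hm
    rw [hsl] at h1
    exact absurd (h2.1 hm) (not_lt.2 (pos_of_mul_pos_right h1 (inv_pos.2 h3).le).le)

/-- If the unit normals `a` and `b` differed, the tangent vector `b - a` would have negative product
with `a` and positive product with `b`. Moving from `q` in this direction would then lead into `V`
by the first defining function and out of `V` by the second. -/
theorem IsDefiningAt.normal_unique (hV : IsOpen V) {q : Sph n} (hq : q ∈ frontier V)
    {ρ₁ ρ₂ : E (n + 1) → ℝ} (h₁ : IsDefiningAt V q ρ₁) (h₂ : IsDefiningAt V q ρ₂) :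
    ‖tanGrad ρ₁ q‖⁻¹ • tanGrad ρ₁ q = ‖tanGrad ρ₂ q‖⁻¹ • tanGrad ρ₂ q := by
  have hz₁ := (eventually_frontier_imp_eq_zero hV h₁).self_of_nhds hq
  have hz₂ := (eventually_frontier_imp_eq_zero hV h₂).self_of_nhds hq
  have ha₁ : 0 < ‖tanGrad ρ₁ q‖ := norm_pos_iff.2 h₁.2.1
  have ha₂ : 0 < ‖tanGrad ρ₂ q‖ := norm_pos_iff.2 h₂.2.1
  set a := ‖tanGrad ρ₁ q‖⁻¹ • tanGrad ρ₁ q with ha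
  set b := ‖tanGrad ρ₂ q‖⁻¹ • tanGrad ρ₂ q with hb
  have hna : ‖a‖ = 1 := by rw [ha, norm_smul, norm_inv, norm_norm, inv_mul_cancel₀ ha₁.ne']
  have hnb : ‖b‖ = 1 := by rw [hb, norm_smul, norm_inv, norm_norm, inv_mul_cancel₀ ha₂.ne']
  have e₁ : tanGrad ρ₁ q = ‖tanGrad ρ₁ q‖ • a := by
    rw [ha, smul_smul, mul_inv_cancel₀ ha₁.ne', one_smul]
  have e₂ : tanGrad ρ₂ q = ‖tanGrad ρ₂ q‖ • b := by
    rw [hb, smul_smul, mul_inv_cancel₀ ha₂.ne', one_smul]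
  by_contra hne
  have hlt : inner ℝ a b < 1 := by
    refine lt_of_le_of_ne ?_ fun h => hne ((inner_eq_one_iff_of_norm_eq_one hna hnb).1 h)
    simpa [hna, hnb] using real_inner_le_norm a b
  have ho : inner ℝ (q : E (n + 1)) (b - a) = 0 := by
    rw [inner_sub_right, ha, hb, inner_smul_right, inner_smul_right, inner_tanGrad, inner_tanGrad]
    simp
  have i₁ : inner ℝ (tanGrad ρ₁ q) (b - a) < 0 := by
    rw [e₁, inner_smul_left, inner_sub_right, real_inner_self_eq_norm_sq, hna]
    exact mul_neg_of_pos_of_neg (by simpa using ha₁) (by linarith)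
  have i₂ : 0 < inner ℝ (tanGrad ρ₂ q) (b - a) := by
    rw [e₂, inner_smul_left, inner_sub_right, real_inner_self_eq_norm_sq, hnb, real_inner_comm]
    exact mul_pos (by simpa using ha₂) (by linarith)
  obtain ⟨t, ht1, ht2⟩ := (((eventually_mem_of_inner_neg h₁ hz₁ ho).1 i₁).and
    ((eventually_mem_of_inner_neg h₂ hz₂ ho).2 i₂)).exists
  exact ht2 ht1

theorem outwardNormal_eq (hV : IsOpen V) {q : Sph n} (hq : q ∈ frontier V)
    {ρ : E (n + 1) → ℝ} (h : IsDefiningAt V q ρ) :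
    outwardNormal V q = ‖tanGrad ρ q‖⁻¹ • tanGrad ρ q := by
  have H : ∃ ρ, IsDefiningAt V q ρ := ⟨ρ, h⟩
  rw [outwardNormal, dif_pos H]
  exact IsDefiningAt.normal_unique hV hq H.choose_spec h

/-- One defining function serves all nearby frontier points, and the normal does not depend on the
one chosen, so locally it is a continuous expression in a fixed `ρ`. -/
theorem continuousOn_outwardNormal (hV : IsOpen V) (hb : HasC1Boundary V) :
    ContinuousOn (outwardNormal V) (frontier V) := by
  intro q hq
  obtain ⟨ρ, hρ⟩ := hb q hq
  have hc := continuousAt_tanGrad hρ.1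
  have h1 : ContinuousAt (fun p => ‖tanGrad ρ p‖⁻¹ • tanGrad ρ p) q :=
    (hc.norm.inv₀ (norm_ne_zero_iff.2 hρ.2.1)).smul hc
  refine h1.continuousWithinAt.congr_of_eventuallyEq ?_ (outwardNormal_eq hV hq hρ)
  filter_upwards [self_mem_nhdsWithin, nhdsWithin_le_nhds hρ.eventually] with p hp h
  exact outwardNormal_eq hV hp h

theorem inner_outwardNormal (V : Set (Sph n)) (q : Sph n) :
    inner ℝ (q : E (n + 1)) (outwardNormal V q) = 0 := by
  rw [outwardNormal]
  split_ifs
  · rw [inner_smul_right, inner_tanGrad, mul_zero]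
  · simp

end OutwardNormal

/-! ### Local estimates with the true normal, at all points of the closure. -/

section SphereDivergence

variable {m : ℕ}

theorem surfaceMeasure_frontier_lt_top {V : Set (Sph (m + 1))} (hVo : IsOpen V)
    (hb : HasC1Boundary V) : surfaceMeasure (m + 1) (frontier V) < ⊤ := by
  refine (isClosed_frontier (s := V)).isCompact.measure_lt_top_of_nhdsWithin fun q hq => ?_
  obtain ⟨ρ, hρ⟩ := hb q hq
  obtain ⟨O, hO, hqO, hfin, -⟩ := exists_local_estimate hVo hq hρ one_pos
  refine ⟨frontier V ∩ O, ?_, hfin⟩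
  exact Filter.inter_mem self_mem_nhdsWithin (nhdsWithin_le_nhds (hO.mem_nhds hqO))

theorem integrableOn_of_continuousOn_isCompact {X F : Type*} [TopologicalSpace X] [T2Space X]
    [MeasurableSpace X] [BorelSpace X] [NormedAddCommGroup F] [SecondCountableTopologyEither X F]
    {μ : Measure X} {S : Set X} (hS : IsCompact S) (hμ : μ S < ⊤) {h : X → F}
    (hh : ContinuousOn h S) : IntegrableOn h S μ := by
  obtain ⟨C, hC⟩ := hS.exists_bound_of_continuousOn hh
  have : IsFiniteMeasure (μ.restrict S) := ⟨by simpa using hμ⟩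
  exact Integrable.of_bound (hh.aestronglyMeasurable hS.measurableSet) C
    ((ae_restrict_mem hS.measurableSet).mono hC)

theorem abs_setIntegral_le_of_bound {X : Type*} [MeasurableSpace X] {μ : Measure X} {S : Set X}
    (hS : MeasurableSet S) {h k : X → ℝ} (hk : IntegrableOn k S μ) (hle : ∀ x ∈ S, |h x| ≤ k x) :
    |∫ x in S, h x ∂μ| ≤ ∫ x in S, k x ∂μ := by
  rw [← Real.norm_eq_abs]
  exact norm_integral_le_of_norm_le hk ((ae_restrict_mem hS).mono hle)

/-- The local form of the divergence theorem, up to an error `ε`, near each point of the closure. -/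
theorem exists_local_estimate_closure {U V : Set (Sph (m + 1))} (hUo : IsOpen U) (hVo : IsOpen V)
    (hVU : V ⊆ U) (hbU : frontier V ⊆ U) (hb : HasC1Boundary V) {q : Sph (m + 1)}
    (hq : q ∈ closure V) {ε : ℝ} (hε : 0 < ε) :
    ∃ O : Set (Sph (m + 1)), IsOpen O ∧ q ∈ O ∧ O ⊆ U ∧
      ∀ (Y : E (m + 2) → E (m + 2)) (K : Set (Sph (m + 1))), ContDiffOn ℝ 1 Y {0}ᶜ →
        (∀ r : ℝ, 0 < r → ∀ y, Y (r • y) = Y y) → IsCompact K → K ⊆ O →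
        (∀ y, y ≠ 0 → nproj y ∉ K → Y y = 0) →
        |fluxOver V Y - radialMoment m *
          ∫ p in frontier V, inner ℝ (outwardNormal V p) (Y p) ∂surfaceMeasure (m + 1)| ≤
        ε * ∫ p in frontier V, ‖Y p‖ ∂surfaceMeasure (m + 1) := by
  have hfm : MeasurableSet (frontier V) := isClosed_frontier.measurableSet
  have hfc : IsCompact (frontier V) := isClosed_frontier.isCompact
  by_cases hqV : q ∈ V
  -- At an interior point the field is supported inside `V`: its flux is the full integral of the
  -- divergence of a compactly supported field, and the boundary integrand vanishes on the frontier.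
  · refine ⟨V, hVo, hqV, hVU, fun Y K hY _ hK hKV hYK => ?_⟩
    have h1 : fluxOver V Y = 0 := by
      have hZ := contDiff_annular hY
      have hc := hasCompactSupport_annular Y
      have e1 : fluxOver V Y = ∫ y, LinearMap.trace ℝ _ (fderiv ℝ (annular Y) y).toLinearMap := by
        refine setIntegral_eq_integral_of_forall_compl_eq_zero fun y hy => ?_
        rw [fderiv_eq_zero_of_notMem_tsupport (fun h => hy ?_)]
        · simp
        · obtain ⟨h1, -, h2⟩ := tsupport_annular_subset hK hYK h
          exact ⟨fun h0 => by rw [h0] at h1; norm_num at h1, hKV h2⟩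
      rw [e1]
      simp_rw [LinearMap.trace_eq_sum_inner _ (EuclideanSpace.basisFun (Fin (m + 2)) ℝ)]
      have hd : ∀ i y, inner ℝ (EuclideanSpace.basisFun (Fin (m + 2)) ℝ i)
          ((fderiv ℝ (annular Y) y).toLinearMap (EuclideanSpace.basisFun (Fin (m + 2)) ℝ i)) =
          fderiv ℝ (fun y => inner ℝ (EuclideanSpace.basisFun (Fin (m + 2)) ℝ i) (annular Y y)) y
            (EuclideanSpace.basisFun (Fin (m + 2)) ℝ i) := fun i y => by
        have h2 : fderiv ℝ (fun y => inner ℝ (EuclideanSpace.basisFun (Fin (m + 2)) ℝ i)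
            (annular Y y)) y = _ :=
          ((innerSL ℝ (EuclideanSpace.basisFun (Fin (m + 2)) ℝ i)).hasFDerivAt.comp y
            (hZ.differentiable one_ne_zero y).hasFDerivAt).fderiv
        rw [h2]
        simp
      simp_rw [hd]
      have hs : ∀ i, ContDiff ℝ 1 fun y =>
          inner ℝ (EuclideanSpace.basisFun (Fin (m + 2)) ℝ i) (annular Y y) := fun i =>
        contDiff_const.inner ℝ hZ
      have hcs : ∀ i, HasCompactSupport fun y =>
          inner ℝ (EuclideanSpace.basisFun (Fin (m + 2)) ℝ i) (annular Y y) := fun i =>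
        hc.comp_left (g := fun z => inner ℝ (EuclideanSpace.basisFun (Fin (m + 2)) ℝ i) z) (by simp)
      rw [integral_finsetSum]
      · exact Finset.sum_eq_zero fun i _ => integral_fderiv_apply_eq_zero volume (hs i) (hcs i) _
      · exact fun i _ => (((hs i).continuous_fderiv one_ne_zero).clm_apply
          continuous_const).integrable_of_hasCompactSupport
          (((hcs i).fderiv (𝕜 := ℝ)).comp_left (g := fun A : E (m + 2) →L[ℝ] ℝ => A _) rfl)
    have h2 : ∫ p in frontier V, inner ℝ (outwardNormal V p) (Y p) ∂surfaceMeasure (m + 1) = 0 := by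
      refine setIntegral_eq_zero_of_forall_eq_zero fun p hp => ?_
      rw [hYK p (coe_sph_ne_zero p), inner_zero_right]
      rw [nproj_coe]
      rw [hVo.frontier_eq] at hp
      exact fun h => hp.2 (hKV h)
    rw [h1, h2]
    simp only [mul_zero, sub_zero, abs_zero]
    exact mul_nonneg hε.le (integral_nonneg fun _ => norm_nonneg _)
  · have hqf : q ∈ frontier V := by rw [hVo.frontier_eq]; exact ⟨hq, hqV⟩
    obtain ⟨ρ, hρ⟩ := hb q hqf
    set c := radialMoment m with hc
    have hc0 : 0 < c := radialMoment_pos m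
    obtain ⟨O, hO, hqO, -, hest⟩ := exists_local_estimate hVo hqf hρ (half_pos hε)
    -- Half of `ε` is spent on the estimate with the normal frozen at `q`, the other half on letting
    -- the normal vary, where the oscillation is multiplied by `c`.
    set ε₂ := ε / (2 * c) with hε₂
    have hε₂0 : 0 < ε₂ := by positivity
    have hν := (continuousOn_outwardNormal hVo hb) q hqf
    obtain ⟨W, hW, hqW, hWν⟩ := mem_nhdsWithin.1 (hν (Metric.ball_mem_nhds _ hε₂0))
    refine ⟨O ∩ (W ∩ U), hO.inter (hW.inter hUo), ⟨hqO, hqW, hbU hqf⟩, fun p hp => hp.2.2,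
      fun Y K hY hYh hK hKO hYK => ?_⟩
    have h1 := hest Y K hY hYh hK (hKO.trans inter_subset_left) hYK
    rw [← outwardNormal_eq hVo hqf hρ] at h1
    have hfin := surfaceMeasure_frontier_lt_top hVo hb
    have hYc : Continuous fun p : Sph (m + 1) => Y p := continuous_restrict_sphere hY.continuousOn
    have i1 : IntegrableOn (fun p : Sph (m + 1) => inner ℝ (outwardNormal V p) (Y p)) (frontier V)
        (surfaceMeasure (m + 1)) := integrableOn_of_continuousOn_isCompact hfc hfin
      ((continuousOn_outwardNormal hVo hb).inner hYc.continuousOn)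
    have i2 : IntegrableOn (fun p : Sph (m + 1) => inner ℝ (outwardNormal V q) (Y p)) (frontier V)
        (surfaceMeasure (m + 1)) := integrableOn_of_continuousOn_isCompact hfc hfin
      (continuousOn_const.inner hYc.continuousOn)
    have i3 : IntegrableOn (fun p : Sph (m + 1) => ‖Y p‖) (frontier V)
        (surfaceMeasure (m + 1)) := integrableOn_of_continuousOn_isCompact hfc hfin
      hYc.norm.continuousOn
    have h2 : |(∫ p in frontier V, inner ℝ (outwardNormal V p) (Y p) ∂surfaceMeasure (m + 1)) -
        ∫ p in frontier V, inner ℝ (outwardNormal V q) (Y p) ∂surfaceMeasure (m + 1)| ≤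
        ε₂ * ∫ p in frontier V, ‖Y p‖ ∂surfaceMeasure (m + 1) := by
      rw [← integral_sub i1 i2, ← integral_const_mul]
      refine abs_setIntegral_le_of_bound hfm (i3.const_mul ε₂) fun p hp => ?_
      by_cases hpK : p ∈ K
      · rw [← inner_sub_left]
        refine (abs_real_inner_le_norm _ _).trans ?_
        have := hWν ⟨(hKO hpK).2.1, hp⟩
        rw [mem_preimage, mem_ball, dist_eq_norm] at this
        gcongr
      · rw [hYK p (coe_sph_ne_zero p) (by rwa [nproj_coe])]
        simp
    set J := ∫ p in frontier V, inner ℝ (outwardNormal V p) (Y p) ∂surfaceMeasure (m + 1)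
    set J' := ∫ p in frontier V, inner ℝ (outwardNormal V q) (Y p) ∂surfaceMeasure (m + 1)
    set I := ∫ p in frontier V, ‖Y p‖ ∂surfaceMeasure (m + 1)
    have h3 : |c * (J - J')| ≤ ε / 2 * I := by
      rw [abs_mul, abs_of_pos hc0]
      calc c * |J - J'| ≤ c * (ε₂ * I) := by gcongr
        _ = ε / 2 * I := by rw [hε₂]; field_simp
    have h4 : fluxOver V Y - c * J = (fluxOver V Y - c * J') - c * (J - J') := by ring
    rw [h4]
    refine (abs_sub _ _).trans ((add_le_add h1 h3).trans (le_of_eq ?_))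
    ring

/-- By the product rule the extra term is the derivative of the radial cutoff along `X`, which is a
multiple of `⟨y, X y⟩` and vanishes for tangential fields. -/
theorem trace_fderiv_annular {n : ℕ} {X : E (n + 1) → E (n + 1)} {y : E (n + 1)}
    (hX : DifferentiableAt ℝ X y) (ht : inner ℝ y (X y) = 0) :
    LinearMap.trace ℝ _ (fderiv ℝ (annular X) y).toLinearMap =
      radialBump (‖y‖ ^ 2) * LinearMap.trace ℝ _ (fderiv ℝ X y).toLinearMap := by
  have hd : HasDerivAt (fun x : ℝ => radialBump x) _ (‖y‖ ^ 2) :=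
    ((radialBump.contDiff (n := 1)).differentiable one_ne_zero (‖y‖ ^ 2)).hasDerivAt
  have hn : HasFDerivAt (fun y : E (n + 1) => ‖y‖ ^ 2) _ y :=
    (hasStrictFDerivAt_norm_sq y).hasFDerivAt
  have h1 := HasDerivAt.comp_hasFDerivAt (h₂ := fun x : ℝ => radialBump x) y hd hn
  have h2 : fderiv ℝ (annular X) y = _ := (h1.fun_smul hX.hasFDerivAt).fderiv
  rw [h2]
  have h3 : ∀ (a : ℝ) (A : E (n + 1) →L[ℝ] E (n + 1)) (b : E (n + 1) →L[ℝ] ℝ) (x : E (n + 1)),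
      LinearMap.trace ℝ _ (a • A + b.smulRight x).toLinearMap =
        a * LinearMap.trace ℝ _ A.toLinearMap + b x := fun a A b x => by
    rw [ContinuousLinearMap.toLinearMap_add, map_add, ContinuousLinearMap.toLinearMap_smul,
      map_smul, smul_eq_mul]
    congr 1
    exact LinearMap.trace_smulRight b.toLinearMap x
  rw [h3]
  simp [ht]

end SphereDivergence

/-! ### The divergence theorem on the sphere. -/

section DivergenceTheorem

variable {m : ℕ}

theorem continuous_trace_fderiv {n : ℕ} {Z : E n → E n} (hZ : ContDiff ℝ 1 Z) :
    Continuous fun y => LinearMap.trace ℝ _ (fderiv ℝ Z y).toLinearMap := by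
  have h : Continuous fun A : E n →L[ℝ] E n => LinearMap.trace ℝ _ A.toLinearMap :=
    ((LinearMap.trace ℝ (E n)).comp
      (ContinuousLinearMap.coeLM ℝ (M := E n) (N₃ := E n))).continuous_of_finiteDimensional
  exact h.comp (hZ.continuous_fderiv one_ne_zero)

theorem integrable_trace_fderiv {n : ℕ} {Z : E n → E n} (hZ : ContDiff ℝ 1 Z)
    (hc : HasCompactSupport Z) :
    Integrable fun y => LinearMap.trace ℝ _ (fderiv ℝ Z y).toLinearMap :=
  (continuous_trace_fderiv hZ).integrable_of_hasCompactSupport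
    ((hc.fderiv (𝕜 := ℝ)).comp_left (g := fun A : E n →L[ℝ] E n =>
      LinearMap.trace ℝ _ A.toLinearMap) (by simp))

/-- A function on the sphere with support in `U` times a `C¹` field on the cone over `U`. -/
theorem contDiffOn_smul_of_tsupport_subset {U : Set (Sph (m + 1))} {F : Type*}
    [NormedAddCommGroup F] [NormedSpace ℝ F] {X : E (m + 2) → F} (hUo : IsOpen U)
    (hX : ContDiffOn ℝ 1 X (cone U)) {χ : Sph (m + 1) → ℝ}
    (hχ : ContMDiff (𝓡 (m + 1)) 𝓘(ℝ, ℝ) 1 χ) (hs : tsupport χ ⊆ U) :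
    ContDiffOn ℝ 1 (fun y => χ (nproj y) • X y) {0}ᶜ := by
  intro y hy
  refine ContDiffAt.contDiffWithinAt ?_
  by_cases h : nproj y ∈ tsupport χ
  · have hy' : y ∈ cone U := ⟨hy, hs h⟩
    have h1 := (ContMDiffOn.contDiffOn_comp_nproj isOpen_univ hχ.contMDiffOn).contDiffAt
      ((isOpen_cone isOpen_univ).mem_nhds (⟨hy, mem_univ _⟩ : y ∈ cone univ))
    exact h1.fun_smul (hX.contDiffAt ((isOpen_cone hUo).mem_nhds hy'))
  · have h1 : ∀ᶠ z in 𝓝 y, nproj z ∉ tsupport χ :=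
      (continuousAt_nproj hy).eventually ((isClosed_tsupport χ).isOpen_compl.mem_nhds h)
    refine (contDiffAt_const (c := (0 : F))).congr_of_eventuallyEq ?_
    filter_upwards [h1] with z hz
    rw [image_eq_zero_of_notMem_tsupport hz, zero_smul]

/-- The divergence theorem on the sphere, for divergence free tangent fields. -/
theorem integral_boundary_eq_zero {U V : Set (Sph (m + 1))} (hUo : IsOpen U) (hVo : IsOpen V)
    (hVU : V ⊆ U) (hbU : frontier V ⊆ U) (hb : HasC1Boundary V) {X : E (m + 2) → E (m + 2)}
    (hX : ContDiffOn ℝ 1 X (cone U)) (hXh : ∀ r : ℝ, 0 < r → ∀ y, X (r • y) = X y)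
    (hXt : ∀ y ∈ cone U, inner ℝ y (X y) = 0)
    (hdiv : ∀ y ∈ cone V, LinearMap.trace ℝ _ (fderiv ℝ X y).toLinearMap = 0) :
    IntegrableOn (fun p : Sph (m + 1) => inner ℝ (outwardNormal V p) (X p)) (frontier V)
        (surfaceMeasure (m + 1)) ∧
      ∫ p in frontier V, inner ℝ (outwardNormal V p) (X p) ∂surfaceMeasure (m + 1) = 0 := by
  have hfin := surfaceMeasure_frontier_lt_top hVo hb
  have hfm : MeasurableSet (frontier V) := isClosed_frontier.measurableSet
  have hfc : IsCompact (frontier V) := isClosed_frontier.isCompact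
  have hcU : closure V ⊆ U := by
    rw [closure_eq_self_union_frontier]
    exact union_subset hVU hbU
  have hXc : ContinuousOn (fun p : Sph (m + 1) => X p) (frontier V) :=
    hX.continuousOn.comp continuous_subtype_val.continuousOn fun p hp => coe_mem_cone.2 (hbU hp)
  have hint : IntegrableOn (fun p : Sph (m + 1) => inner ℝ (outwardNormal V p) (X p)) (frontier V)
      (surfaceMeasure (m + 1)) := integrableOn_of_continuousOn_isCompact hfc hfin
    ((continuousOn_outwardNormal hVo hb).inner hXc)
  refine ⟨hint, ?_⟩
  set c := radialMoment m with hc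
  have hc0 : 0 < c := radialMoment_pos m
  set I := ∫ p in frontier V, ‖X p‖ ∂surfaceMeasure (m + 1) with hI
  -- The cover and the partition of unity depend on `ε`, but the sum of the errors does not feel
  -- this: the weights are nonnegative with sum one, so the integrals of `‖Y i‖` add up to that of
  -- `‖X‖`.
  have key : ∀ ε : ℝ, 0 < ε →
      |c * ∫ p in frontier V, inner ℝ (outwardNormal V p) (X p) ∂surfaceMeasure (m + 1)| ≤
        ε * I := by
    intro ε hε
    have hex : ∀ q : closure V, _ := fun q =>
      exists_local_estimate_closure hUo hVo hVU hbU hb q.2 hε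
    choose O hOo hqO hOU hest using hex
    obtain ⟨T, hT⟩ := (isClosed_closure (s := V)).isCompact.elim_finite_subcover O hOo
      fun q hq => mem_iUnion.2 ⟨⟨q, hq⟩, hqO ⟨q, hq⟩⟩
    have : Fact (Module.finrank ℝ (E (m + 2)) = m + 1 + 1) := ⟨finrank_euclideanSpace_fin⟩
    obtain ⟨χ, hχ⟩ := SmoothPartitionOfUnity.exists_isSubordinate (𝓡 (m + 1))
      (isClosed_closure (s := V)) (fun i : T => O i) (fun i => hOo i)
      (fun q hq => by
        obtain ⟨i, hi, hqi⟩ := mem_iUnion₂.1 (hT hq)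
        exact mem_iUnion.2 ⟨⟨i, hi⟩, hqi⟩)
    set Y : T → E (m + 2) → E (m + 2) := fun i y => χ i (nproj y) • X y with hY
    have hYd : ∀ i, ContDiffOn ℝ 1 (Y i) {0}ᶜ := fun i =>
      contDiffOn_smul_of_tsupport_subset hUo hX ((χ i).contMDiff.of_le (by simp))
        ((hχ i).trans (hOU i))
    have hYh : ∀ i, ∀ r : ℝ, 0 < r → ∀ y, Y i (r • y) = Y i y := fun i r hr y => by
      by_cases hy : y = 0
      · rw [hy, smul_zero]
      · simp only [hY, nproj_smul hr hy, hXh r hr]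
    have hYp : ∀ i (p : Sph (m + 1)), Y i p = χ i p • X p := fun i p => by
      simp only [hY, nproj_coe]
    have hYc : ∀ i, Continuous fun p : Sph (m + 1) => Y i p := fun i =>
      continuous_restrict_sphere (hYd i).continuousOn
    have hsum : ∀ p ∈ closure V, ∑ i, χ i p = 1 := fun p hp => by
      rw [← finsum_eq_sum_of_fintype]
      exact χ.sum_eq_one hp
    have e1 : ∀ i, |fluxOver V (Y i) - c *
        ∫ p in frontier V, inner ℝ (outwardNormal V p) (Y i p) ∂surfaceMeasure (m + 1)| ≤
        ε * ∫ p in frontier V, ‖Y i p‖ ∂surfaceMeasure (m + 1) := fun i =>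
      hest i (Y i) (tsupport (χ i)) (hYd i) (hYh i) (isClosed_tsupport _).isCompact (hχ i)
        fun y _ hy => by simp only [hY, image_eq_zero_of_notMem_tsupport hy, zero_smul]
    have e2 : ∑ i, fluxOver V (Y i) = 0 := by
      have hZ := fun i => contDiff_annular (hYd i)
      have hZc := fun i => hasCompactSupport_annular (Y i)
      simp only [fluxOver]
      rw [← integral_finsetSum _ fun i _ => (integrable_trace_fderiv (hZ i) (hZc i)).integrableOn]
      refine setIntegral_eq_zero_of_forall_eq_zero fun y hy => ?_
      have hyU : y ∈ cone U := ⟨hy.1, hVU hy.2⟩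
      have hXd : DifferentiableAt ℝ X y :=
        (hX.contDiffAt ((isOpen_cone hUo).mem_nhds hyU)).differentiableAt one_ne_zero
      -- `X` is only controlled over `U` and the weights sum to one only over the closure of `V`,
      -- but an identity on the open cone over `V` is enough to compare derivatives at its points.
      have h1 : annular X =ᶠ[𝓝 y] fun z => ∑ i, annular (Y i) z := by
        filter_upwards [(isOpen_cone hVo).mem_nhds hy] with z hz
        simp only [annular, hY]
        rw [← Finset.smul_sum, ← Finset.sum_smul, hsum _ (subset_closure hz.2), one_smul]
      have h2 : fderiv ℝ (annular X) y = ∑ i, fderiv ℝ (annular (Y i)) y := by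
        rw [h1.fderiv_eq]
        exact fderiv_fun_sum fun i _ => (hZ i).differentiable one_ne_zero y
      rw [← map_sum, ← ContinuousLinearMap.toLinearMap_sum, ← h2,
        trace_fderiv_annular hXd (hXt y hyU), hdiv y hy, mul_zero]
    have e3 : ∑ i, ∫ p in frontier V, inner ℝ (outwardNormal V p) (Y i p)
          ∂surfaceMeasure (m + 1) =
        ∫ p in frontier V, inner ℝ (outwardNormal V p) (X p) ∂surfaceMeasure (m + 1) := by
      rw [← integral_finsetSum]
      · refine setIntegral_congr_fun hfm fun p hp => ?_
        simp only [hYp]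
        rw [← inner_sum, ← Finset.sum_smul, hsum p (frontier_subset_closure hp), one_smul]
      · exact fun i _ => integrableOn_of_continuousOn_isCompact hfc hfin
          ((continuousOn_outwardNormal hVo hb).inner (hYc i).continuousOn)
    have e4 : ∑ i, ∫ p in frontier V, ‖Y i p‖ ∂surfaceMeasure (m + 1) = I := by
      rw [hI, ← integral_finsetSum]
      · refine setIntegral_congr_fun hfm fun p hp => ?_
        simp only [hYp, norm_smul, Real.norm_of_nonneg (χ.nonneg _ p)]
        rw [← Finset.sum_mul, hsum p (frontier_subset_closure hp), one_mul]
      · exact fun i _ => integrableOn_of_continuousOn_isCompact hfc hfin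
          (hYc i).norm.continuousOn
    rw [← e3, ← e4, Finset.mul_sum, Finset.mul_sum, ← abs_neg, ← zero_sub, ← e2,
      ← Finset.sum_sub_distrib]
    exact (Finset.abs_sum_le_sum_abs _ _).trans (Finset.sum_le_sum fun i _ => e1 i)
  have hI0 : 0 ≤ I := integral_nonneg fun _ => norm_nonneg _
  have h0 : |c * ∫ p in frontier V, inner ℝ (outwardNormal V p) (X p)
      ∂surfaceMeasure (m + 1)| ≤ 0 := by
    refine le_of_forall_pos_le_add fun δ hδ => ?_
    refine (key (δ / (I + 1)) (by positivity)).trans ?_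
    rw [zero_add, div_mul_eq_mul_div, div_le_iff₀ (by positivity)]
    nlinarith
  have h1 := abs_nonpos_iff.1 h0
  exact (mul_eq_zero.1 h1).resolve_left hc0.ne'

end DivergenceTheorem

/-! ### Vectors and bivectors in the Clifford algebra. -/

section CliffordAlgebra

variable {n : ℕ}

instance instFiniteDimensionalCl (n : ℕ) : FiniteDimensional ℝ (Cl n) :=
  Module.Finite.of_basis (basisCl n)

/-- The multiplication of the Clifford algebra as a continuous bilinear map. -/
def mulCl (n : ℕ) : Cl n →L[ℝ] Cl n →L[ℝ] Cl n :=
  LinearMap.toContinuousLinearMap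
    ((LinearMap.toContinuousLinearMap (𝕜 := ℝ) (E := Cl n) (F' := Cl n)).toLinearMap ∘ₗ
      LinearMap.mul ℝ (Cl n))

/-- The inclusion of vectors as a linear map. -/
def vecₗ (n : ℕ) : E (n + 1) →ₗ[ℝ] Cl n := CliffordAlgebra.ι (negSq n)

@[simp] theorem vecₗ_apply (x : E (n + 1)) : vecₗ n x = vec x := rfl

theorem vec_add (x y : E (n + 1)) : vec (x + y) = vec x + vec y := (vecₗ n).map_add x y

theorem vec_smul (r : ℝ) (x : E (n + 1)) : vec (r • x) = r • vec x := (vecₗ n).map_smul r x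

theorem vec_mul_vec_add (x y : E (n + 1)) :
    vec x * vec y + vec y * vec x = (-2 * inner ℝ x y) • (1 : Cl n) := by
  rw [vec, vec, CliffordAlgebra.ι_mul_ι_add_swap, Algebra.algebraMap_eq_smul_one]
  congr 1
  rw [QuadraticMap.polar, negSq_apply, negSq_apply, negSq_apply, norm_add_sq_real]
  ring

theorem vec_mul_self_smul (x : E (n + 1)) : vec x * vec x = (-‖x‖ ^ 2) • (1 : Cl n) := by
  rw [vec_mul_self, Algebra.algebraMap_eq_smul_one]

theorem vec_eq_sum (x : E (n + 1)) : vec x = ∑ i, x i • e (n := n) i := by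
  conv_lhs => rw [← (EuclideanSpace.basisFun (Fin (n + 1)) ℝ).sum_repr x]
  rw [← vecₗ_apply, map_sum]
  simp [e]

theorem e_mul_self (i : Fin (n + 1)) : e i * e i = (-1 : Cl n) := by
  rw [e, vec_mul_self_smul]
  simp

theorem e_mul_e_of_ne {i j : Fin (n + 1)} (h : i ≠ j) : e j * e i = -(e i * e j : Cl n) := by
  have := vec_mul_vec_add (n := n) (EuclideanSpace.single j 1) (EuclideanSpace.single i 1)
  rw [EuclideanSpace.inner_single_left] at this
  simp only [PiLp.single_apply, if_neg h.symm] at this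
  rw [eq_neg_iff_add_eq_zero]
  simpa [e] using this

/-- The bivector part of the product of two vectors. -/
theorem sum_bivector (w a : E (n + 1)) :
    ∑ i : Fin (n + 1), ∑ j ∈ Finset.Ioi i, (w i * a j - w j * a i) • (e i * e j : Cl n) =
      vec w * vec a + inner ℝ w a • (1 : Cl n) := by
  have h1 : vec w * vec a = ∑ i, ∑ j, (w i * a j) • (e i * e j : Cl n) := by
    rw [vec_eq_sum w, vec_eq_sum a, Finset.sum_mul_sum]
    simp [smul_smul, mul_comm]
  have h2 : inner ℝ w a • (1 : Cl n) = -∑ i, (w i * a i) • (e i * e i : Cl n) := by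
    simp only [e_mul_self, smul_neg, Finset.sum_neg_distrib, neg_neg, ← Finset.sum_smul]
    congr 1
    simp [PiLp.inner_apply, mul_comm]
  have h3 := Finset.sum_sum_Ioi_add_eq_sum_sum_off_diag
    (fun j i : Fin (n + 1) => (w i * a j) • (e i * e j : Cl n))
  -- Anticommutation writes the sum over `i < j` as the sum over all off-diagonal pairs; the missing
  -- diagonal is `-⟨w, a⟩`.
  have h4 : ∀ i : Fin (n + 1), ∑ j ∈ Finset.Ioi i, (w i * a j - w j * a i) • (e i * e j : Cl n) =
      ∑ j ∈ Finset.Ioi i, ((w i * a j) • (e i * e j : Cl n) + (w j * a i) • (e j * e i)) :=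
    fun i => Finset.sum_congr rfl fun j hj => by
      rw [e_mul_e_of_ne (Finset.mem_Ioi.1 hj).ne, smul_neg, sub_smul, sub_eq_add_neg]
  rw [Finset.sum_congr rfl fun i _ => h4 i, h1, h2, ← sub_eq_add_neg, ← Finset.sum_sub_distrib, h3]
  refine Finset.sum_congr rfl fun i _ => ?_
  rw [eq_sub_iff_add_eq, ← Finset.sum_add_sum_compl {i} fun j => (w i * a j) • (e i * e j : Cl n)]
  rw [Finset.sum_singleton, add_comm]

/-- The spherical Dirac operator sends the tangential gradient `a` to `-a`. -/
theorem vec_mul_sum_bivector {w : E (n + 1)} (hw : ‖w‖ = 1) {a : E (n + 1)}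
    (ha : inner ℝ w a = 0) :
    vec w * ∑ i : Fin (n + 1), ∑ j ∈ Finset.Ioi i, (w i * a j - w j * a i) • (e i * e j : Cl n) =
      -vec a := by
  rw [sum_bivector, ha, zero_smul, add_zero, ← mul_assoc, vec_mul_self_smul, hw]
  simp

end CliffordAlgebra

/-! ### Homogeneous Clifford-valued polynomials. -/

section HomogeneousPolynomials

variable {n k : ℕ}

/-- The space of homogeneous polynomials of degree `k` with values in the Clifford algebra, spanned
by the monomials with coefficient. -/
def homPoly (n k : ℕ) : Submodule ℝ (E n → Cl n) :=
  Submodule.span ℝ {p | ∃ α : Fin n → ℕ, ∑ i, α i = k ∧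
    ∃ a : Cl n, p = fun u => (∏ i, u i ^ α i) • a}

theorem monomial_mem_homPoly (α : Fin n → ℕ) (hα : ∑ i, α i = k) (a : Cl n) :
    (fun u : E n => (∏ i, u i ^ α i) • a) ∈ homPoly n k :=
  Submodule.subset_span ⟨α, hα, a, rfl⟩

theorem mem_homPoly {p : E n → Cl n} : p ∈ homPoly n k ↔ IsHomPoly k p := by
  constructor
  · intro hp
    induction hp using Submodule.span_induction with
    | mem p hp =>
      obtain ⟨α, hα, a, rfl⟩ := hp
      refine ⟨fun β => if β = α then a else 0, fun u => ?_⟩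
      rw [Finset.sum_eq_single α]
      · simp
      · intro β _ hβ
        simp [hβ]
      · intro h
        exact absurd (by simp [hα]) h
    | zero => exact ⟨0, fun u => by simp⟩
    | add p q _ _ hp hq =>
      obtain ⟨c, hc⟩ := hp
      obtain ⟨d, hd⟩ := hq
      exact ⟨c + d, fun u => by simp [hc, hd, Finset.sum_add_distrib]⟩
    | smul r p _ hp =>
      obtain ⟨c, hc⟩ := hp
      refine ⟨r • c, fun u => ?_⟩
      simp only [Pi.smul_apply, hc, Finset.smul_sum]
      exact Finset.sum_congr rfl fun α _ => smul_comm _ _ _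
  · rintro ⟨c, hc⟩
    have : p = ∑ α ∈ Finset.piAntidiag (Finset.univ : Finset (Fin n)) k,
        fun u : E n => (∏ i, u i ^ α i) • c α := by
      ext1 u
      rw [hc, Finset.sum_apply]
    rw [this]
    exact Submodule.sum_mem _ fun α hα =>
      monomial_mem_homPoly α (Finset.mem_piAntidiag.1 hα).1 (c α)

/-- Finite dimension is what later allows `f x` and `g x` to be expanded in fixed polynomials with
coefficients depending on `x`. -/
instance instFiniteDimensionalHomPoly (n k : ℕ) : FiniteDimensional ℝ (homPoly n k) := by
  let L : (Finset.piAntidiag (Finset.univ : Finset (Fin n)) k → Cl n) →ₗ[ℝ] (E n → Cl n) :=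
    { toFun := fun c u => ∑ α, (∏ i, u i ^ α.1 i) • c α
      map_add' := fun c d => by
        ext1 u
        simp [Finset.sum_add_distrib]
      map_smul' := fun r c => by
        ext1 u
        simp only [Pi.smul_apply, Finset.smul_sum, RingHom.id_apply]
        exact Finset.sum_congr rfl fun α _ => smul_comm _ _ _ }
  have h : homPoly n k ≤ LinearMap.range L := fun p hp => by
    obtain ⟨c, hc⟩ := mem_homPoly.1 hp
    refine ⟨fun α => c α, ?_⟩
    ext1 u
    rw [hc]
    exact Finset.sum_coe_sort (Finset.piAntidiag (Finset.univ : Finset (Fin n)) k)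
      (fun α => (∏ i, u i ^ α i) • c α)
  exact Submodule.finiteDimensional_of_le h

theorem map_comp_mem_homPoly (A : Cl n →ₗ[ℝ] Cl n) {p : E n → Cl n} (hp : p ∈ homPoly n k) :
    (fun u => A (p u)) ∈ homPoly n k := by
  obtain ⟨c, hc⟩ := mem_homPoly.1 hp
  exact mem_homPoly.2 ⟨fun α => A (c α), fun u => by simp [hc]⟩

theorem mul_mem_homPoly (a : Cl n) {p : E n → Cl n} (hp : p ∈ homPoly n k) :
    (fun u => a * p u) ∈ homPoly n k :=
  map_comp_mem_homPoly (LinearMap.mulLeft ℝ a) hp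

theorem coord_smul_mem_homPoly (j : Fin n) {p : E n → Cl n} (hp : p ∈ homPoly n k) :
    (fun u => u j • p u) ∈ homPoly n (k + 1) := by
  induction hp using Submodule.span_induction with
  | mem p hp =>
    obtain ⟨α, hα, a, rfl⟩ := hp
    have h := monomial_mem_homPoly (k := k + 1) (α + Pi.single j 1)
      (by simp [Finset.sum_add_distrib, hα]) a
    convert h using 2 with u
    rw [smul_smul]
    congr 1
    simp only [Pi.add_apply, pow_add, Finset.prod_mul_distrib]
    rw [mul_comm]
    congr 1
    rw [Finset.prod_eq_single j] <;> simp +contextual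
  | zero =>
    convert (homPoly n (k + 1)).zero_mem using 2 with u
    exact smul_zero _
  | add p q _ _ hp hq =>
    convert (homPoly n (k + 1)).add_mem hp hq using 2 with u
    exact smul_add _ _ _
  | smul r p _ hp =>
    convert (homPoly n (k + 1)).smul_mem r hp using 2 with u
    exact smul_comm (u j) r (p u)

theorem vecN_mul_mem_homPoly {p : E n → Cl n} (hp : p ∈ homPoly n k) :
    (fun u => vecN u * p u) ∈ homPoly n (k + 1) := by
  have h : (fun u => vecN u * p u) = ∑ j : Fin n, fun u => u j • (e j.castSucc * p u) := by
    ext1 u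
    simp [vecN, Finset.sum_mul]
  rw [h]
  exact Submodule.sum_mem _ fun j _ => coord_smul_mem_homPoly j (mul_mem_homPoly _ hp)

theorem contDiff_of_mem_homPoly {p : E n → Cl n} (hp : p ∈ homPoly n k) {N : ℕ∞} :
    ContDiff ℝ N p := by
  obtain ⟨c, hc⟩ := mem_homPoly.1 hp
  rw [funext hc]
  refine ContDiff.sum fun α _ => ?_
  have h : ContDiff ℝ N fun u : E n => ∏ i, u i ^ α i := contDiff_prod fun i _ => by fun_prop
  exact h.smul contDiff_const

theorem differentiable_of_mem_homPoly {p : E n → Cl n} (hp : p ∈ homPoly n k) :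
    Differentiable ℝ p :=
  (contDiff_of_mem_homPoly hp (N := 1)).differentiable one_ne_zero

theorem smul_eq_of_mem_homPoly {p : E n → Cl n} (hp : p ∈ homPoly n k) (t : ℝ) (u : E n) :
    p (t • u) = t ^ k • p u := by
  obtain ⟨c, hc⟩ := mem_homPoly.1 hp
  rw [hc, hc, Finset.smul_sum]
  refine Finset.sum_congr rfl fun α hα => ?_
  rw [smul_smul]
  congr 1
  simp only [PiLp.smul_apply, smul_eq_mul, mul_pow, Finset.prod_mul_distrib]
  rw [Finset.prod_pow_eq_pow_sum, (Finset.mem_piAntidiag.1 hα).1]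

/-- Euler's identity. -/
theorem fderiv_self_of_mem_homPoly {p : E n → Cl n} (hp : p ∈ homPoly n k) (u : E n) :
    fderiv ℝ p u u = (k : ℝ) • p u := by
  have h0 : HasDerivAt (fun t : ℝ => t • u) u 1 := by
    simpa using (hasDerivAt_id (1 : ℝ)).smul_const u
  have hd : HasFDerivAt p (fderiv ℝ p u) ((1 : ℝ) • u) := by
    rw [one_smul]
    exact (differentiable_of_mem_homPoly hp u).hasFDerivAt
  have h1 := hd.comp_hasDerivAt (1 : ℝ) h0
  have h2 : HasDerivAt (fun t : ℝ => t ^ k • p u) (((k : ℝ) * 1 ^ (k - 1)) • p u) 1 :=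
    (hasDerivAt_pow k (1 : ℝ)).smul_const (p u)
  have h3 : p ∘ (fun t : ℝ => t • u) = fun t : ℝ => t ^ k • p u :=
    funext fun t => smul_eq_of_mem_homPoly hp t u
  rw [h3] at h1
  simpa using h1.unique h2

theorem eq_of_mem_homPoly_zero {p : E n → Cl n} (hp : p ∈ homPoly n 0) (u v : E n) :
    p u = p v := by
  have h1 := smul_eq_of_mem_homPoly hp 0 u
  have h2 := smul_eq_of_mem_homPoly hp 0 v
  simp only [zero_smul, pow_zero, one_smul] at h1 h2
  rw [← h1, ← h2]

theorem hasDerivAt_monomial (α : Fin n → ℕ) (j : Fin n) (u : E n) :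
    HasDerivAt (fun t : ℝ => ∏ i, (u + t • EuclideanSpace.single j (1 : ℝ)) i ^ α i)
      (α j * ∏ i, u i ^ (α i - if i = j then 1 else 0)) 0 := by
  have h1 : (fun t : ℝ => ∏ i, (u + t • EuclideanSpace.single j (1 : ℝ)) i ^ α i) =
      fun t => (u j + t) ^ α j * ∏ i ∈ Finset.univ.erase j, u i ^ α i := by
    ext1 t
    rw [← Finset.mul_prod_erase _ _ (Finset.mem_univ j)]
    congr 1
    · simp
    · refine Finset.prod_congr rfl fun i hi => ?_
      simp [Finset.ne_of_mem_erase hi]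
  have h2 : ∏ i, u i ^ (α i - if i = j then 1 else 0) =
      u j ^ (α j - 1) * ∏ i ∈ Finset.univ.erase j, u i ^ α i := by
    rw [← Finset.mul_prod_erase _ _ (Finset.mem_univ j), if_pos rfl]
    congr 1
    refine Finset.prod_congr rfl fun i hi => ?_
    rw [if_neg (Finset.ne_of_mem_erase hi), Nat.sub_zero]
  rw [h1, h2, ← mul_assoc]
  have h3 := ((hasDerivAt_id (0 : ℝ)).const_add (u j)).fun_pow (α j)
  simpa using h3.mul_const (∏ i ∈ Finset.univ.erase j, u i ^ α i)

/-- The partial derivative of a function on `ℝⁿ`. -/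
def pderiv (j : Fin n) (p : E n → Cl n) (u : E n) : Cl n :=
  fderiv ℝ p u (EuclideanSpace.single j 1)

theorem fderiv_eq_sum_pderiv (p : E n → Cl n) (u v : E n) :
    fderiv ℝ p u v = ∑ j, v j • pderiv j p u := by
  conv_lhs => rw [← (EuclideanSpace.basisFun (Fin n) ℝ).sum_repr v]
  rw [map_sum]
  simp [pderiv]

theorem pderiv_eq_of_hasDerivAt {p : E n → Cl n} (hp : Differentiable ℝ p) {j : Fin n} {u : E n}
    {b : Cl n} (h : HasDerivAt (fun t : ℝ => p (u + t • EuclideanSpace.single j (1 : ℝ))) b 0) :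
    pderiv j p u = b := by
  have h0 : HasDerivAt (fun t : ℝ => u + t • EuclideanSpace.single j (1 : ℝ))
      (EuclideanSpace.single j (1 : ℝ)) 0 := by
    simpa using ((hasDerivAt_id (0 : ℝ)).smul_const (EuclideanSpace.single j (1 : ℝ))).const_add u
  have hd : HasFDerivAt p (fderiv ℝ p u) (u + (0 : ℝ) • EuclideanSpace.single j (1 : ℝ)) := by
    rw [zero_smul, add_zero]
    exact (hp u).hasFDerivAt
  exact (hd.comp_hasDerivAt (0 : ℝ) h0).unique h

theorem pderiv_mem_homPoly (j : Fin n) {p : E n → Cl n} (hp : p ∈ homPoly n (k + 1)) :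
    pderiv j p ∈ homPoly n k := by
  induction hp using Submodule.span_induction with
  | mem p hp =>
    obtain ⟨α, hα, a, rfl⟩ := hp
    have hd := differentiable_of_mem_homPoly (monomial_mem_homPoly α hα a)
    have h : pderiv j (fun u : E n => (∏ i, u i ^ α i) • a) = (α j : ℝ) •
        fun u : E n => (∏ i, u i ^ (α i - if i = j then 1 else 0)) • a := by
      ext1 u
      rw [Pi.smul_apply, smul_smul]
      exact pderiv_eq_of_hasDerivAt hd ((hasDerivAt_monomial α j u).smul_const a)
    rw [h]
    by_cases h0 : α j = 0
    · rw [h0, Nat.cast_zero, zero_smul]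
      exact Submodule.zero_mem _
    · refine Submodule.smul_mem _ _ (monomial_mem_homPoly _ ?_ a)
      have h1 : ∑ i, (α i - if i = j then 1 else 0) + ∑ i, (if i = j then 1 else 0) = k + 1 := by
        rw [← Finset.sum_add_distrib, ← hα]
        refine Finset.sum_congr rfl fun i _ => Nat.sub_add_cancel ?_
        split_ifs with h
        · rw [h]; omega
        · omega
      simpa using h1
  | zero =>
    have : pderiv j (0 : E n → Cl n) = 0 := by
      ext1 u
      simp [pderiv]
    rw [this]
    exact Submodule.zero_mem _
  | add p q hp' hq' hp hq =>
    have : pderiv j (p + q) = pderiv j p + pderiv j q := by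
      ext1 u
      simp [pderiv, fderiv_add (differentiable_of_mem_homPoly hp' u)
        (differentiable_of_mem_homPoly hq' u)]
    rw [this]
    exact Submodule.add_mem _ hp hq
  | smul r p hp' hp =>
    have : pderiv j (r • p) = r • pderiv j p := by
      ext1 u
      simp [pderiv, fderiv_const_smul (differentiable_of_mem_homPoly hp' u)]
    rw [this]
    exact Submodule.smul_mem _ _ hp

theorem pderiv_map {p : E n → Cl n} (hp : Differentiable ℝ p) (A : Cl n →ₗ[ℝ] Cl n) (j : Fin n)
    (u : E n) : pderiv j (fun u => A (p u)) u = A (pderiv j p u) := by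
  have h := (LinearMap.toContinuousLinearMap A).hasFDerivAt.comp u (hp u).hasFDerivAt
  have h' : fderiv ℝ (fun u => A (p u)) u = _ := h.fderiv
  rw [pderiv, h']
  rfl

theorem pderiv_comm {p : E n → Cl n} (hp : p ∈ homPoly n k) (i j : Fin n) (u : E n) :
    pderiv i (pderiv j p) u = pderiv j (pderiv i p) u := by
  have h2 : ContDiff ℝ 2 p := contDiff_of_mem_homPoly hp (N := 2)
  have hs : IsSymmSndFDerivAt ℝ p u :=
    h2.contDiffAt.isSymmSndFDerivAt (by simp [minSmoothness_of_isRCLikeNormedField])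
  have hd : DifferentiableAt ℝ (fderiv ℝ p) u :=
    (h2.fderiv_right (m := 1) (by norm_num)).differentiable one_ne_zero u
  have h : ∀ i j, pderiv i (pderiv j p) u =
      fderiv ℝ (fderiv ℝ p) u (EuclideanSpace.single i 1) (EuclideanSpace.single j 1) := by
    intro i j
    have h3 : fderiv ℝ (pderiv j p) u = _ := (hd.hasFDerivAt.clm_apply
      (hasFDerivAt_const (EuclideanSpace.single j (1 : ℝ)) u)).fderiv
    rw [pderiv, h3]
    simp
  rw [h, h]
  exact hs _ _

end HomogeneousPolynomials

/-! ### Decomposing a vector times a monogenic polynomial. -/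

section FischerDecomposition

variable {n k : ℕ}

theorem diracL_eq (p : E n → Cl n) (u : E n) :
    diracL p u = ∑ j : Fin n, e j.castSucc * pderiv j p u := rfl

theorem e_mul_vecN (j : Fin n) (u : E n) :
    e j.castSucc * vecN u = -(vecN u * e j.castSucc) - (2 * u j) • (1 : Cl n) := by
  have h : ∀ i : Fin n, e j.castSucc * e i.castSucc =
      -(e i.castSucc * e j.castSucc) - (if i = j then 2 else 0 : ℝ) • (1 : Cl n) := by
    intro i
    split_ifs with hij
    · rw [hij, e_mul_self, neg_neg, two_smul]
      abel
    · rw [zero_smul, sub_zero]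
      exact e_mul_e_of_ne fun h => hij (Fin.castSucc_injective n h)
  simp only [vecN, Finset.mul_sum, Finset.sum_mul, mul_smul_comm, smul_mul_assoc, h, smul_sub,
    smul_neg, Finset.sum_sub_distrib, Finset.sum_neg_distrib, smul_smul]
  congr 1
  rw [← Finset.sum_smul]
  congr 1
  simp [mul_comm]

theorem diracL_mul (p : E n → Cl n) (hp : Differentiable ℝ p) (a : Cl n) (u : E n) :
    diracL (fun u => a * p u) u = ∑ j : Fin n, e j.castSucc * (a * pderiv j p u) := by
  rw [diracL_eq]
  refine Finset.sum_congr rfl fun j _ => ?_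
  congr 1
  exact pderiv_map hp (LinearMap.mulLeft ℝ a) j u

/-- `e_{n+1}` anticommutes with every `e_j` occurring in the Dirac operator of `ℝⁿ`. -/
theorem diracL_e_last_mul {p : E n → Cl n} (hp : p ∈ monogenicL n k) (u : E n) :
    diracL (fun u => e (Fin.last n) * p u) u = 0 := by
  rw [diracL_mul p (differentiable_of_mem_homPoly (mem_homPoly.2 hp.1))]
  have h : ∀ j : Fin n, e j.castSucc * (e (Fin.last n) * pderiv j p u) =
      -(e (Fin.last n) * (e j.castSucc * pderiv j p u)) := fun j => by
    rw [← mul_assoc, e_mul_e_of_ne (Fin.castSucc_lt_last j).ne', ← mul_assoc, neg_mul]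
  rw [Finset.sum_congr rfl fun j _ => h j, Finset.sum_neg_distrib, ← Finset.mul_sum, ← diracL_eq,
    hp.2, mul_zero, neg_zero]

/-- Moving `e_j` past the constant vector `v` gives a sign and the scalar `-2 v_j`; the first part
vanishes by monogenicity and the second sums to the derivative along `v`. -/
theorem diracL_vecN_const_mul {p : E n → Cl n} (hp : p ∈ monogenicL n k) (v u : E n) :
    diracL (fun u => vecN v * p u) u = (-2 : ℝ) • fderiv ℝ p u v := by
  rw [diracL_mul p (differentiable_of_mem_homPoly (mem_homPoly.2 hp.1))]
  have h : ∀ j : Fin n, e j.castSucc * (vecN v * pderiv j p u) =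
      -(vecN v * (e j.castSucc * pderiv j p u)) + (-2 : ℝ) • v j • pderiv j p u := fun j => by
    rw [← mul_assoc, e_mul_vecN, sub_mul, neg_mul, mul_assoc, smul_mul_assoc, one_mul, smul_smul,
      neg_mul, neg_smul, sub_eq_add_neg]
  rw [Finset.sum_congr rfl fun j _ => h j, Finset.sum_add_distrib, Finset.sum_neg_distrib,
    ← Finset.mul_sum, ← diracL_eq, hp.2, mul_zero, neg_zero, zero_add, ← Finset.smul_sum,
    ← fderiv_eq_sum_pderiv]

/-- The inclusion of `ℝⁿ` as a linear map. -/
def vecNₗ (n : ℕ) : E n →ₗ[ℝ] Cl n where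
  toFun := vecN
  map_add' := fun u v => by simp [vecN, add_smul, Finset.sum_add_distrib]
  map_smul' := fun r u => by simp [vecN, Finset.smul_sum, smul_smul]

theorem vecN_single (j : Fin n) : vecN (EuclideanSpace.single j 1) = e (n := n) j.castSucc := by
  rw [vecN, Finset.sum_eq_single j] <;> simp +contextual

theorem pderiv_vecN_mul {p : E n → Cl n} (hp : Differentiable ℝ p) (j : Fin n) (u : E n) :
    pderiv j (fun u => vecN u * p u) u = e j.castSucc * p u + vecN u * pderiv j p u := by
  have h1 : HasFDerivAt (fun u : E n => vecN u) (LinearMap.toContinuousLinearMap (vecNₗ n)) u :=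
    (LinearMap.toContinuousLinearMap (vecNₗ n)).hasFDerivAt
  have h2 : fderiv ℝ (fun u => vecN u * p u) u = _ :=
    ((mulCl n).hasFDerivAt_of_bilinear h1 (hp u).hasFDerivAt).fderiv
  rw [pderiv, h2]
  change vecN u * pderiv j p u + vecN (EuclideanSpace.single j 1) * p u = _
  rw [vecN_single, add_comm]

/-- Differentiating the factor `u` gives `-n`, since `e_j² = -1`. Moving `e_j` past `u` gives `-2`
times the Euler derivative, that is, `-2 k`. -/
theorem diracL_vecN_mul {p : E n → Cl n} (hp : p ∈ monogenicL n k) (u : E n) :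
    diracL (fun u => vecN u * p u) u = (-(n + 2 * k : ℝ)) • p u := by
  have hp' := mem_homPoly.2 hp.1
  have hd := differentiable_of_mem_homPoly hp'
  have h : ∀ j : Fin n, e j.castSucc * pderiv j (fun u => vecN u * p u) u =
      -p u + (-(vecN u * (e j.castSucc * pderiv j p u)) + (-2 : ℝ) • u j • pderiv j p u) :=
    fun j => by
    rw [pderiv_vecN_mul hd, mul_add, ← mul_assoc, e_mul_self, ← mul_assoc, e_mul_vecN, sub_mul,
      neg_mul, one_mul, neg_mul, mul_assoc, smul_mul_assoc, one_mul, smul_smul,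
      neg_mul, neg_smul, sub_eq_add_neg]
  rw [diracL_eq, Finset.sum_congr rfl fun j _ => h j, Finset.sum_add_distrib,
    Finset.sum_add_distrib, Finset.sum_neg_distrib, Finset.sum_neg_distrib,
    ← Finset.mul_sum, ← diracL_eq, hp.2, mul_zero, neg_zero, zero_add, ← Finset.smul_sum,
    ← fderiv_eq_sum_pderiv, fderiv_self_of_mem_homPoly hp', Finset.sum_const, Finset.card_univ,
    Fintype.card_fin, ← Nat.cast_smul_eq_nsmul ℝ]
  module

theorem diracL_add {p q : E n → Cl n} (hp : Differentiable ℝ p) (hq : Differentiable ℝ q)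
    (u : E n) : diracL (p + q) u = diracL p u + diracL q u := by
  simp [diracL, fderiv_add (hp u) (hq u), mul_add, Finset.sum_add_distrib]

theorem diracL_smul (r : ℝ) {p : E n → Cl n} (hp : Differentiable ℝ p) (u : E n) :
    diracL (r • p) u = r • diracL p u := by
  simp [diracL, fderiv_const_smul (hp u), Finset.smul_sum]

/-- The left monogenic polynomials as a submodule. -/
def monoL (n k : ℕ) : Submodule ℝ (E n → Cl n) where
  carrier := monogenicL n k
  add_mem' := fun {p q} hp hq => by
    have hp' := mem_homPoly.2 hp.1
    have hq' := mem_homPoly.2 hq.1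
    refine ⟨mem_homPoly.1 ((homPoly n k).add_mem hp' hq'), fun u => ?_⟩
    rw [diracL_add (differentiable_of_mem_homPoly hp') (differentiable_of_mem_homPoly hq'), hp.2,
      hq.2, add_zero]
  zero_mem' := ⟨mem_homPoly.1 (homPoly n k).zero_mem, fun u => by simp [diracL]⟩
  smul_mem' := fun r p hp => by
    have hp' := mem_homPoly.2 hp.1
    refine ⟨mem_homPoly.1 ((homPoly n k).smul_mem r hp'), fun u => ?_⟩
    rw [diracL_smul r (differentiable_of_mem_homPoly hp'), hp.2, smul_zero]

theorem monoL_le_homPoly : monoL n k ≤ homPoly n k := fun _ hp => mem_homPoly.2 hp.1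

instance instFiniteDimensionalMonoL (n k : ℕ) : FiniteDimensional ℝ (monoL n k) :=
  Submodule.finiteDimensional_of_le monoL_le_homPoly

/-- Left multiplication of a function by the variable `u`. -/
def vecNMul (n : ℕ) : (E n → Cl n) →ₗ[ℝ] (E n → Cl n) where
  toFun q u := vecN u * q u
  map_add' p q := by ext1 u; simp [mul_add]
  map_smul' r p := by ext1 u; simp

/-- The complement `u 𝓜_{k-1}` as a submodule. -/
def complLₛ (n : ℕ) : ℕ → Submodule ℝ (E n → Cl n)
  | 0 => ⊥
  | k + 1 => (monoL n k).map (vecNMul n)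

theorem mem_complLₛ {p : E n → Cl n} : p ∈ complLₛ n k ↔ p ∈ complL n k := by
  cases k with
  | zero => simp [complLₛ, complL]
  | succ k =>
    constructor
    · rintro ⟨q, hq, rfl⟩
      exact ⟨q, hq, fun u => rfl⟩
    · rintro ⟨q, hq, h⟩
      exact ⟨q, hq, (funext h).symm⟩

theorem vec_eq_vecN_add (v : E (n + 1)) :
    vec v = vecN (WithLp.toLp 2 fun j => v j.castSucc : E n) + v (Fin.last n) • e (Fin.last n) := by
  rw [vec_eq_sum, Fin.sum_univ_castSucc]
  rfl

/-- The Dirac operator has constant coefficients and so commutes with partial derivatives. -/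
theorem pderiv_mem_monoL (j : Fin n) {p : E n → Cl n} (hp : p ∈ monoL n (k + 1)) :
    pderiv j p ∈ monoL n k := by
  have hp' := monoL_le_homPoly hp
  have hj := pderiv_mem_homPoly j hp'
  refine ⟨mem_homPoly.1 hj, fun u => ?_⟩
  have h1 : ∀ i : Fin n, e i.castSucc * pderiv i (pderiv j p) u =
      pderiv j (fun u => e i.castSucc * pderiv i p u) u := fun i => by
    rw [pderiv_comm hp']
    exact (pderiv_map (differentiable_of_mem_homPoly (pderiv_mem_homPoly i hp'))
      (LinearMap.mulLeft ℝ (e i.castSucc)) j u).symm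
  rw [diracL_eq, Finset.sum_congr rfl fun i _ => h1 i]
  have h2 : ∀ i : Fin n, DifferentiableAt ℝ (fun u => e i.castSucc * pderiv i p u) u := fun i =>
    differentiable_of_mem_homPoly (mul_mem_homPoly _ (pderiv_mem_homPoly i hp')) u
  have h3 : (fun u => ∑ i : Fin n, e i.castSucc * pderiv i p u) = fun _ => 0 :=
    funext fun u => hp.2 u
  have h4 := congrArg (fun q => fderiv ℝ q u (EuclideanSpace.single j 1)) h3
  simp only [fderiv_fun_sum fun i _ => h2 i] at h4
  simpa [pderiv] using h4

/-- A vector times a left monogenic polynomial has a Fischer decomposition. -/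
theorem vec_mul_mem_sup (hn : 1 ≤ n) (v : E (n + 1)) {q : E n → Cl n} (hq : q ∈ monoL n k) :
    (fun u => vec v * q u) ∈ monoL n k ⊔ complLₛ n k := by
  have hq' := monoL_le_homPoly hq
  cases k with
  | zero =>
    -- In degree zero `q` is constant, so the product is constant and already monogenic.
    refine Submodule.mem_sup_left ⟨mem_homPoly.1 (mul_mem_homPoly _ hq'), fun u => ?_⟩
    have h0 : q = fun _ => q 0 := funext fun u => eq_of_mem_homPoly_zero hq' u 0
    rw [h0]
    simp [diracL]
  | succ k =>
    set w : E n := WithLp.toLp 2 fun j => v j.castSucc with hw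
    have hlast : (fun u => e (Fin.last n) * q u) ∈ monoL n (k + 1) :=
      ⟨mem_homPoly.1 (mul_mem_homPoly _ hq'), diracL_e_last_mul hq⟩
    -- The Dirac operator sends `w q` to `-2 ∂_w q`, and `u ∂_w q` to `-(n + 2 k) ∂_w q`, because
    -- `∂_w q` is monogenic of degree `k`. With this `c` the difference `w q - c u ∂_w q` is
    -- monogenic; `n ≥ 1` keeps the denominator positive for `k = 0`.
    set c : ℝ := 2 / (n + 2 * k) with hc
    have hpos : (0 : ℝ) < n + 2 * k := by
      have : (1 : ℝ) ≤ n := by exact_mod_cast hn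
      positivity
    set r : E n → Cl n := c • ∑ j, w j • pderiv j q with hr
    have hrm : r ∈ monoL n k := Submodule.smul_mem _ _
      (Submodule.sum_mem _ fun j _ => Submodule.smul_mem _ _ (pderiv_mem_monoL j hq))
    have hru : ∀ u, r u = c • fderiv ℝ q u w := fun u => by
      rw [fderiv_eq_sum_pderiv, hr]
      simp [Finset.sum_apply]
    have hcompl : (fun u => vecN u * r u) ∈ complLₛ n (k + 1) :=
      mem_complLₛ.2 ⟨r, hrm, fun u => rfl⟩
    have hcp := vecN_mul_mem_homPoly (monoL_le_homPoly hrm)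
    have hwq : (fun u => vecN w * q u) ∈ homPoly n (k + 1) := mul_mem_homPoly _ hq'
    have hmain : (fun u => vecN w * q u) + (-1 : ℝ) • (fun u => vecN u * r u) ∈
        monoL n (k + 1) := by
      refine ⟨mem_homPoly.1 (Submodule.add_mem _ hwq (Submodule.smul_mem _ _ hcp)), fun u => ?_⟩
      rw [diracL_add (differentiable_of_mem_homPoly hwq)
        (differentiable_of_mem_homPoly (Submodule.smul_mem _ _ hcp)),
        diracL_smul _ (differentiable_of_mem_homPoly hcp), diracL_vecN_const_mul hq,
        diracL_vecN_mul hrm, hru, smul_smul, smul_smul, ← add_smul, hc]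
      have : (-2 + -1 * (-(n + 2 * k : ℝ)) * (2 / (n + 2 * k)) : ℝ) = 0 := by
        field_simp
        ring
      rw [mul_assoc, ← mul_assoc (-1 : ℝ)] at *
      rw [this, zero_smul]
    have hsum : (fun u => vec v * q u) =
        (((fun u => vecN w * q u) + (-1 : ℝ) • (fun u => vecN u * r u)) +
          v (Fin.last n) • fun u => e (Fin.last n) * q u) + fun u => vecN u * r u := by
      ext1 u
      simp only [Pi.add_apply, Pi.smul_apply, vec_eq_vecN_add v, add_mul, smul_mul_assoc]
      rw [neg_one_smul]
      rw [← hw]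
      abel
    rw [hsum]
    exact Submodule.add_mem_sup
      (Submodule.add_mem _ hmain (Submodule.smul_mem _ _ hlast)) hcompl

/-- Only this property of the chosen component is needed: the pairing does not see the complement,
so uniqueness of the decomposition plays no role. -/
theorem sub_projL_mem {h : E n → Cl n} (hh : h ∈ monoL n k ⊔ complLₛ n k) :
    h - projL k h ∈ complLₛ n k := by
  have H : ∃ p ∈ monogenicL n k, h - p ∈ complL n k := by
    obtain ⟨p, hp, c, hc, rfl⟩ := Submodule.mem_sup.1 hh
    exact ⟨p, hp, by rw [add_sub_cancel_left]; exact mem_complLₛ.1 hc⟩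
  rw [projL, dif_pos H]
  exact mem_complLₛ.2 H.choose_spec.2

end FischerDecomposition

/-! ### Transfer from left to right by the reversal antiautomorphism. -/

section Reversal

variable {n k : ℕ}

/-- The reversal of the Clifford algebra applied to the values of a function. -/
def rev (n : ℕ) : (E n → Cl n) →ₗ[ℝ] (E n → Cl n) where
  toFun p u := CliffordAlgebra.reverse (p u)
  map_add' p q := by ext1 u; simp
  map_smul' r p := by ext1 u; simp

theorem rev_apply (p : E n → Cl n) (u : E n) : rev n p u = CliffordAlgebra.reverse (p u) := rfl

@[simp] theorem rev_rev (p : E n → Cl n) : rev n (rev n p) = p := by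
  ext1 u
  simp [rev_apply]

theorem reverse_vec (x : E (n + 1)) : CliffordAlgebra.reverse (vec x) = vec x := by
  simp [vec]

theorem reverse_vecN (u : E n) : CliffordAlgebra.reverse (vecN u) = vecN u := by
  simp [vecN, e, reverse_vec]

theorem rev_mem_homPoly {p : E n → Cl n} (hp : p ∈ homPoly n k) : rev n p ∈ homPoly n k :=
  map_comp_mem_homPoly CliffordAlgebra.reverse hp

theorem diracL_rev {p : E n → Cl n} (hp : Differentiable ℝ p) (u : E n) :
    diracL (rev n p) u = CliffordAlgebra.reverse (diracR p u) := by
  rw [diracL_eq, diracR, map_sum]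
  refine Finset.sum_congr rfl fun j _ => ?_
  rw [CliffordAlgebra.reverse.map_mul, e, reverse_vec]
  congr 1
  exact pderiv_map hp CliffordAlgebra.reverse j u

theorem rev_mem_monoL {p : E n → Cl n} : rev n p ∈ monoL n k ↔ p ∈ monogenicR n k := by
  constructor
  · intro h
    have h1 := rev_mem_homPoly (monoL_le_homPoly h)
    rw [rev_rev] at h1
    refine ⟨mem_homPoly.1 h1, fun u => ?_⟩
    have h2 := diracL_rev (differentiable_of_mem_homPoly h1) u
    rw [h.2 u] at h2
    have h3 := congrArg CliffordAlgebra.reverse h2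
    rwa [map_zero, CliffordAlgebra.reverse_reverse, eq_comm] at h3
  · intro h
    have h1 := mem_homPoly.2 h.1
    refine ⟨mem_homPoly.1 (rev_mem_homPoly h1), fun u => ?_⟩
    rw [diracL_rev (differentiable_of_mem_homPoly h1), h.2, map_zero]

theorem rev_mem_complLₛ {p : E n → Cl n} : rev n p ∈ complLₛ n k ↔ p ∈ complR n k := by
  rw [mem_complLₛ]
  cases k with
  | zero =>
    simp only [complL, complR, mem_singleton_iff]
    constructor
    · intro h
      rw [← rev_rev p, h, map_zero]
    · rintro rfl
      exact map_zero _
  | succ k =>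
    constructor
    · rintro ⟨q, hq, h⟩
      refine ⟨rev n q, rev_mem_monoL.1 (by rwa [rev_rev]), fun u => ?_⟩
      rw [← rev_rev p, rev_apply, h, CliffordAlgebra.reverse.map_mul, reverse_vecN, rev_apply]
    · rintro ⟨q, hq, h⟩
      refine ⟨rev n q, rev_mem_monoL.2 hq, fun u => ?_⟩
      rw [rev_apply, h, CliffordAlgebra.reverse.map_mul, reverse_vecN, rev_apply]

/-- The right monogenic polynomials as a submodule. -/
def monoR (n k : ℕ) : Submodule ℝ (E n → Cl n) := (monoL n k).comap (rev n)

theorem mem_monoR {p : E n → Cl n} : p ∈ monoR n k ↔ p ∈ monogenicR n k := rev_mem_monoL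

instance instFiniteDimensionalMonoR (n k : ℕ) : FiniteDimensional ℝ (monoR n k) :=
  Submodule.finiteDimensional_of_le (S₂ := homPoly n k)
    fun _ hp => mem_homPoly.2 (mem_monoR.1 hp).1

/-- The complement of the right monogenic polynomials as a submodule. -/
def complRₛ (n k : ℕ) : Submodule ℝ (E n → Cl n) := (complLₛ n k).comap (rev n)

theorem mem_complRₛ {p : E n → Cl n} : p ∈ complRₛ n k ↔ p ∈ complR n k := rev_mem_complLₛ

/-- Reversal fixes vectors and exchanges the order of products, so the left decomposition of the
reversed polynomial gives this one. -/
theorem mul_vec_mem_sup (hn : 1 ≤ n) (v : E (n + 1)) {q : E n → Cl n} (hq : q ∈ monoR n k) :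
    (fun u => q u * vec v) ∈ monoR n k ⊔ complRₛ n k := by
  obtain ⟨p, hp, c, hc, h⟩ := 
    Submodule.mem_sup.1 (vec_mul_mem_sup hn v (show rev n q ∈ monoL n k from hq))
  refine Submodule.mem_sup.2 ⟨rev n p, ?_, rev n c, ?_, ?_⟩
  · change rev n (rev n p) ∈ monoL n k
    rwa [rev_rev]
  · change rev n (rev n c) ∈ complLₛ n k
    rwa [rev_rev]
  · rw [← map_add, h]
    ext1 u
    simp [rev_apply, reverse_vec]

theorem sub_projR_mem {h : E n → Cl n} (hh : h ∈ monoR n k ⊔ complRₛ n k) :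
    h - projR k h ∈ complRₛ n k := by
  have H : ∃ p ∈ monogenicR n k, h - p ∈ complR n k := by
    obtain ⟨p, hp, c, hc, rfl⟩ := Submodule.mem_sup.1 hh
    exact ⟨p, mem_monoR.1 hp, by rw [add_sub_cancel_left]; exact mem_complRₛ.1 hc⟩
  rw [projR, dif_pos H]
  exact mem_complRₛ.2 H.choose_spec.2

end Reversal

/-! ### Orthogonality of monogenic polynomials and their complements on the sphere. -/

section SphereOrthogonality

variable {n : ℕ}

theorem integral_volumeIoiPow (m : ℕ) (h : ℝ → ℝ) :
    ∫ r : Ioi (0 : ℝ), h r ∂Measure.volumeIoiPow m = ∫ r in Ioi (0 : ℝ), r ^ m * h r := by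
  simp only [Measure.volumeIoiPow, ENNReal.ofReal]
  rw [integral_withDensity_eq_integral_smul (by fun_prop),
    integral_subtype_comap measurableSet_Ioi fun a ↦ Real.toNNReal (a ^ m) • h a]
  refine setIntegral_congr_fun measurableSet_Ioi fun r hr => ?_
  rw [NNReal.smul_def, Real.coe_toNNReal _ (pow_nonneg (le_of_lt hr) _), smul_eq_mul]

/-- Integration in polar coordinates of a radial weight times a homogeneous function. -/
theorem integral_radialBump_smul_homogeneous (hn : 1 ≤ n) {F : Type*} [NormedAddCommGroup F]
    [NormedSpace ℝ F] {N : ℕ} {Ψ : E n → F} (hΨ : ∀ (r : ℝ) (u : E n), Ψ (r • u) = r ^ N • Ψ u) :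
    ∫ u, radialBump (‖u‖ ^ 2) • Ψ u =
      radialMoment (n - 1 + N) •
        ∫ u : sphere (0 : E n) 1, Ψ u ∂(volume : Measure (E n)).toSphere := by
  have : NeZero n := ⟨by omega⟩
  set G : E n → F := fun u => radialBump (‖u‖ ^ 2) • Ψ u with hG
  have h1 : ∫ u, G u = ∫ u : ({(0)}ᶜ : Set (E n)), G u ∂((volume : Measure (E n)).comap (↑)) := by
    rw [integral_subtype_comap (measurableSet_singleton _).compl, restrict_compl_singleton]
  have h2 := (volume : Measure (E n)).measurePreserving_homeomorphUnitSphereProd.integral_comp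
    (Homeomorph.measurableEmbedding _)
    (fun z : sphere (0 : E n) 1 × Ioi (0 : ℝ) =>
      ((z.2 : ℝ) ^ N * radialBump ((z.2 : ℝ) ^ 2)) • Ψ z.1)
  have h3 : ∀ u : ({(0)}ᶜ : Set (E n)), G u =
      (((homeomorphUnitSphereProd (E n) u).2 : ℝ) ^ N *
        radialBump (((homeomorphUnitSphereProd (E n) u).2 : ℝ) ^ 2)) •
          Ψ (homeomorphUnitSphereProd (E n) u).1 := by
    intro u
    have hu : ‖(u : E n)‖ ≠ 0 := norm_ne_zero_iff.2 u.2
    have h4 : Ψ u = ‖(u : E n)‖ ^ N • Ψ (‖(u : E n)‖⁻¹ • (u : E n)) := by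
      rw [← hΨ, smul_smul, mul_inv_cancel₀ hu, one_smul]
    rw [homeomorphUnitSphereProd_apply_fst_coe, homeomorphUnitSphereProd_apply_snd_coe, mul_comm,
      mul_smul, ← h4]
  rw [h1, integral_congr_ae (Filter.Eventually.of_forall h3), h2, ← integral_prod_swap]
  have h5 := integral_prod_smul (μ := Measure.volumeIoiPow (Module.finrank ℝ (E n) - 1))
    (ν := (volume : Measure (E n)).toSphere)
    (fun r : Ioi (0 : ℝ) => (r : ℝ) ^ N * radialBump ((r : ℝ) ^ 2))
    (fun s : sphere (0 : E n) 1 => Ψ s)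
  refine h5.trans ?_
  congr 1
  rw [integral_volumeIoiPow _ fun r => r ^ N * radialBump (r ^ 2), finrank_euclideanSpace_fin,
    radialMoment]
  refine integral_congr_ae (Filter.Eventually.of_forall fun r => ?_)
  simp only [pow_add, mul_assoc]

/-- A primitive of `-radialBump` that vanishes for large arguments. -/
def radialPrim (x : ℝ) : ℝ := ∫ t in x..3, radialBump t

theorem hasDerivAt_radialPrim (x : ℝ) : HasDerivAt radialPrim (-radialBump x) x :=
  intervalIntegral.integral_hasDerivAt_left (radialBump.continuous.intervalIntegrable _ _)
    (radialBump.continuous.stronglyMeasurableAtFilter _ _) radialBump.continuous.continuousAt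

theorem contDiff_radialPrim : ContDiff ℝ 1 radialPrim := by
  rw [contDiff_one_iff_deriv]
  refine ⟨fun x => (hasDerivAt_radialPrim x).differentiableAt, ?_⟩
  rw [funext fun x => (hasDerivAt_radialPrim x).deriv]
  exact radialBump.continuous.neg

theorem radialPrim_eq_zero {x : ℝ} (hx : 3 ≤ x) : radialPrim x = 0 := by
  rw [radialPrim, intervalIntegral.integral_symm, intervalIntegral.integral_zero_ae, neg_zero]
  refine Filter.Eventually.of_forall fun t ht => radialBump_eq_zero (Or.inr ?_)
  rw [uIoc_of_le hx] at ht
  exact ht.1.le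

theorem hasFDerivAt_radialPrim_norm_sq (u : E n) :
    HasFDerivAt (fun u : E n => radialPrim (‖u‖ ^ 2))
      ((-radialBump (‖u‖ ^ 2)) • ((2 : ℝ) • innerSL ℝ u)) u := by
  have hn : HasFDerivAt (fun y : E n => ‖y‖ ^ 2) _ u := (hasStrictFDerivAt_norm_sq u).hasFDerivAt
  have h := HasDerivAt.comp_hasFDerivAt (h₂ := radialPrim) u (hasDerivAt_radialPrim _) hn
  rwa [← ofNat_smul_eq_nsmul ℝ] at h

theorem hasFDerivAt_mul_mul {a b : E n → Cl n} (ha : Differentiable ℝ a)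
    (hb : Differentiable ℝ b) (c : Cl n) (j : Fin n) (u : E n) :
    pderiv j (fun u => a u * c * b u) u = pderiv j a u * c * b u + a u * c * pderiv j b u := by
  have h1 := ((LinearMap.toContinuousLinearMap (LinearMap.mulRight ℝ c)).hasFDerivAt.comp u
    (ha u).hasFDerivAt)
  have h2 : fderiv ℝ (fun u => a u * c * b u) u = _ :=
    ((mulCl n).hasFDerivAt_of_bilinear h1 (hb u).hasFDerivAt).fderiv
  rw [pderiv, h2]
  exact add_comm _ _

theorem contDiff_mul {a b : E n → Cl n} {N : ℕ∞} (ha : ContDiff ℝ N a) (hb : ContDiff ℝ N b) :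
    ContDiff ℝ N fun u => a u * b u :=
  (mulCl n).isBoundedBilinearMap.contDiff.comp (ha.prodMk hb)

theorem integral_smul_pderiv {φ : E n → ℝ} {Z : E n → Cl n} (hφ : ContDiff ℝ 1 φ)
    (hc : HasCompactSupport φ) (hZ : ContDiff ℝ 1 Z) (j : Fin n) :
    ∫ u, φ u • pderiv j Z u = -∫ u, fderiv ℝ φ u (EuclideanSpace.single j 1) • Z u := by
  have c1 : Continuous fun u => fderiv ℝ φ u (EuclideanSpace.single j 1) :=
    (hφ.continuous_fderiv one_ne_zero).clm_apply continuous_const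
  have c2 : Continuous fun u => fderiv ℝ Z u (EuclideanSpace.single j 1) :=
    (hZ.continuous_fderiv one_ne_zero).clm_apply continuous_const
  have s1 : HasCompactSupport fun u => fderiv ℝ φ u (EuclideanSpace.single j 1) :=
    (hc.fderiv (𝕜 := ℝ)).comp_left (g := fun A : E n →L[ℝ] ℝ => A _) rfl
  exact integral_smul_fderiv_eq_neg_fderiv_smul_of_integrable
    ((c1.smul hZ.continuous).integrable_of_hasCompactSupport s1.smul_right)
    ((hφ.continuous.smul c2).integrable_of_hasCompactSupport hc.smul_right)
    ((hφ.continuous.smul hZ.continuous).integrable_of_hasCompactSupport hc.smul_right)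
    (fun u _ => hφ.differentiable one_ne_zero u) (fun u _ => hZ.differentiable one_ne_zero u)

/-- The Clifford-Stokes orthogonality of `𝓜_j` and `u 𝓜_i` on the sphere. -/
theorem integral_mul_vecN_mul_eq_zero (hn : 1 ≤ n) {i j : ℕ} {a b : E n → Cl n}
    (ha : a ∈ monogenicR n i) (hb : b ∈ monogenicL n j) :
    ∫ u : sphere (0 : E n) 1, a u * vecN (u : E n) * b u ∂(volume : Measure (E n)).toSphere =
      0 := by
  have ha' := mem_homPoly.2 ha.1
  have hb' := mem_homPoly.2 hb.1
  have had := differentiable_of_mem_homPoly ha'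
  have hbd := differentiable_of_mem_homPoly hb'
  set φ : E n → ℝ := fun u => radialPrim (‖u‖ ^ 2) with hφ
  have hφd : ContDiff ℝ 1 φ := contDiff_radialPrim.comp (contDiff_norm_sq ℝ)
  have hφc : HasCompactSupport φ := by
    refine HasCompactSupport.intro (isCompact_closedBall (0 : E n) 2) fun u hu => ?_
    refine radialPrim_eq_zero ?_
    rw [mem_closedBall, dist_zero_right, not_le] at hu
    nlinarith
  have hZ : ∀ l : Fin n, ContDiff ℝ 1 fun u => a u * e l.castSucc * b u := fun l =>
    contDiff_mul (N := 1) (contDiff_mul (N := 1) (contDiff_of_mem_homPoly ha') contDiff_const)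
      (contDiff_of_mem_homPoly hb')
  have hint : ∀ l : Fin n, Integrable fun u =>
      φ u • pderiv l (fun u => a u * e l.castSucc * b u) u :=
    fun l => (hφd.continuous.smul (((hZ l).continuous_fderiv one_ne_zero).clm_apply
      continuous_const)).integrable_of_hasCompactSupport hφc.smul_right
  have hint' : ∀ l : Fin n, Integrable fun u =>
      fderiv ℝ φ u (EuclideanSpace.single l 1) • (a u * e l.castSucc * b u) := fun l =>
    (((hφd.continuous_fderiv one_ne_zero).clm_apply continuous_const).smul
      (hZ l).continuous).integrable_of_hasCompactSupport
      (((hφc.fderiv (𝕜 := ℝ)).comp_left (g := fun A : E n →L[ℝ] ℝ =>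
        A (EuclideanSpace.single l 1)) rfl).smul_right)
  -- The integrand vanishes pointwise: `∑ ∂_l (a e_l b)` is `(a D) b + a (D b)`, and `a` is right,
  -- `b` left monogenic.
  have h1 : ∑ l : Fin n, ∫ u, φ u • pderiv l (fun u => a u * e l.castSucc * b u) u = 0 := by
    rw [← integral_finsetSum _ fun l _ => hint l]
    refine integral_eq_zero_of_ae (Filter.Eventually.of_forall fun u => ?_)
    simp only [hasFDerivAt_mul_mul had hbd, Pi.zero_apply]
    rw [← Finset.smul_sum, Finset.sum_add_distrib, ← Finset.sum_mul]
    simp only [mul_assoc (a u)]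
    rw [← Finset.mul_sum]
    have e1 : ∑ l : Fin n, pderiv l a u * e l.castSucc = 0 := ha.2 u
    have e2 : ∑ l : Fin n, e l.castSucc * pderiv l b u = 0 := hb.2 u
    rw [e1, e2, zero_mul, mul_zero, add_zero, smul_zero]
  -- Integration by parts moves the derivatives to `φ`, whose gradient is `-2 radialBump (‖u‖²) u`;
  -- so the factors `e_l` assemble to the vector `u`.
  have h2 : (2 : ℝ) • ∫ u, radialBump (‖u‖ ^ 2) • (a u * vecN u * b u) = 0 := by
    rw [← h1, ← integral_smul]
    simp only [integral_smul_pderiv hφd hφc (hZ _)]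
    rw [Finset.sum_neg_distrib, ← integral_finsetSum _ fun l _ => hint' l, ← integral_neg]
    congr 1
    ext1 u
    simp only [hφ, (hasFDerivAt_radialPrim_norm_sq u).fderiv]
    simp only [vecN, Finset.mul_sum, Finset.sum_mul, Finset.smul_sum, ← Finset.sum_neg_distrib]
    refine Finset.sum_congr rfl fun l _ => ?_
    simp only [_root_.smul_apply, innerSL_apply_apply, EuclideanSpace.inner_single_right,
      smul_eq_mul, mul_smul_comm, smul_mul_assoc, smul_smul, ← neg_smul]
    congr 1
    simp
    ring
  -- The product `a u b` is homogeneous of degree `i + 1 + j`, so polar coordinates split off a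
  -- positive radial moment and leave the integral over the sphere.
  rw [integral_radialBump_smul_homogeneous hn (N := i + 1 + j)] at h2
  · exact ((smul_eq_zero.1 h2).resolve_left two_ne_zero |> smul_eq_zero.1).resolve_left
      (radialMoment_pos _).ne'
  · intro r u
    have hv : vecN (r • u) = r • vecN u := (vecNₗ n).map_smul r u
    rw [smul_eq_of_mem_homPoly ha', smul_eq_of_mem_homPoly hb', hv]
    simp only [smul_mul_assoc, mul_smul_comm, smul_smul]
    congr 1
    ring

end SphereOrthogonality

/-! ### C¹ coordinates of families of polynomials. -/

section Coordinates

/-- Scalar functionals of point values separate the elements of `S`; in finite dimension a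
separating subspace of the dual is the whole dual. Thus every coordinate on `S` is a finite
combination of point values. -/
theorem exists_mem_span_eval_comp_subtype {α W : Type*} [AddCommGroup W] [Module ℝ W]
    (S : Submodule ℝ (α → W)) [FiniteDimensional ℝ S] (φ : Module.Dual ℝ S) :
    ∃ ψ ∈ Submodule.span ℝ (range fun z : α × Module.Dual ℝ W =>
      z.2 ∘ₗ (LinearMap.proj z.1 : (α → W) →ₗ[ℝ] W)), ψ ∘ₗ S.subtype = φ := by
  set T := Submodule.span ℝ (range fun z : α × Module.Dual ℝ W =>
      z.2 ∘ₗ (LinearMap.proj z.1 : (α → W) →ₗ[ℝ] W)) with hT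
  have h1 : (T.map S.subtype.dualMap).dualCoannihilator = ⊥ := by
    rw [eq_bot_iff]
    intro p hp
    rw [Submodule.mem_bot]
    ext1
    ext1 x
    rw [← sub_eq_zero, ← Module.forall_dual_apply_eq_zero_iff ℝ]
    intro l
    have := (Submodule.mem_dualCoannihilator _).1 hp _
      (Submodule.mem_map_of_mem (Submodule.subset_span ⟨(x, l), rfl⟩))
    simpa using this
  have : FiniteDimensional ℝ (T.map S.subtype.dualMap) :=
    FiniteDimensional.finiteDimensional_submodule _
  have h2 : T.map S.subtype.dualMap = ⊤ := by
    rw [← Subspace.dualCoannihilator_dualAnnihilator_eq (W := T.map S.subtype.dualMap), h1,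
      Submodule.dualAnnihilator_bot]
  obtain ⟨ψ, hψ, h⟩ := Submodule.mem_map.1 (h2 ▸ Submodule.mem_top : φ ∈ T.map S.subtype.dualMap)
  exact ⟨ψ, hψ, h⟩

variable {n : ℕ}

theorem IsC1On.contMDiffOn_apply {U : Set (Sph n)} {f : Sph n → E n → Cl n} (hf : IsC1On U f)
    (u : E n) : ContMDiffOn (𝓡 n) 𝓘(ℝ, Cl n) 1 (fun x => f x u) U := by
  have h : ContMDiffOn (𝓡 n) ((𝓡 n).prod 𝓘(ℝ, E n)) 1 (fun x : Sph n => (x, u)) U :=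
    (contMDiff_id.prodMk contMDiff_const).contMDiffOn
  exact ContMDiffOn.comp hf h fun x hx => ⟨hx, mem_univ _⟩

/-- The coordinates of a `C¹` family in a finite dimensional space of functions are `C¹`. -/
theorem IsC1On.exists_coordinates {U : Set (Sph n)} {f : Sph n → E n → Cl n} (hf : IsC1On U f)
    (S : Submodule ℝ (E n → Cl n)) [FiniteDimensional ℝ S] (hS : ∀ x ∈ U, f x ∈ S) :
    ∃ (d : ℕ) (b : Fin d → E n → Cl n) (c : Fin d → Sph n → ℝ), (∀ i, b i ∈ S) ∧
      (∀ i, ContMDiffOn (𝓡 n) 𝓘(ℝ, ℝ) 1 (c i) U) ∧ ∀ x ∈ U, f x = ∑ i, c i x • b i := by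
  let b := Module.finBasis ℝ S
  choose ψ hψ hψc using fun i => exists_mem_span_eval_comp_subtype S (b.coord i)
  refine ⟨_, fun i => b i, fun i x => ψ i (f x), fun i => (b i).2, fun i => ?_, fun x hx => ?_⟩
  · have := hψ i
    change ContMDiffOn (𝓡 n) 𝓘(ℝ, ℝ) 1 (fun x => ψ i (f x)) U
    -- The regularity hypothesis concerns values at fixed `u`, which are the generators of the span;
    -- it passes to linear combinations.
    generalize ψ i = χ at this
    induction this using Submodule.span_induction with
    | mem χ hχ =>
      obtain ⟨⟨u, l⟩, rfl⟩ := hχ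
      exact ((LinearMap.toContinuousLinearMap l).contMDiff (n := 1)).comp_contMDiffOn
        (hf.contMDiffOn_apply u)
    | zero => exact contMDiffOn_const
    | add χ₁ χ₂ _ _ h₁ h₂ => exact h₁.add h₂
    | smul r χ _ h => exact ((r • ContinuousLinearMap.id ℝ ℝ).contMDiff (n := 1)).comp_contMDiffOn h
  · have h1 := congrArg Subtype.val (b.sum_repr ⟨f x, hS x hx⟩)
    have h2 : ∀ i, b.repr ⟨f x, hS x hx⟩ i = ψ i (f x) := fun i =>
      (LinearMap.congr_fun (hψc i) ⟨f x, hS x hx⟩).symm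
    rw [Submodule.coe_sum] at h1
    simp only [h2, Submodule.coe_smul] at h1
    exact h1.symm

end Coordinates

/-! ### The spherical Dirac operator on real coefficients. -/

section SphericalDirac

variable {n : ℕ}

theorem hasFDerivAt_comp_nproj_gradient {U : Set (Sph n)} (hU : IsOpen U) {c : Sph n → ℝ}
    (hc : ContMDiffOn (𝓡 n) 𝓘(ℝ, ℝ) 1 c U) {w : Sph n} (hw : w ∈ U) :
    HasFDerivAt (fun y => c (nproj y)) (innerSL ℝ (∇ (fun y => c (nproj y)) (w : E (n + 1))))
      (w : E (n + 1)) := by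
  have h : DifferentiableAt ℝ (fun y => c (nproj y)) (w : E (n + 1)) :=
    ((ContMDiffOn.contDiffOn_comp_nproj hU hc).contDiffAt
      ((isOpen_cone hU).mem_nhds (coe_mem_cone.2 hw))).differentiableAt one_ne_zero
  exact h.hasGradientAt.hasFDerivAt

/-- The extension is unchanged by precomposition with `nproj`, and the derivative of `nproj` at `w`
annihilates `w`. -/
theorem inner_gradient_comp_nproj {U : Set (Sph n)} (hU : IsOpen U) {c : Sph n → ℝ}
    (hc : ContMDiffOn (𝓡 n) 𝓘(ℝ, ℝ) 1 c U) {w : Sph n} (hw : w ∈ U) :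
    inner ℝ (w : E (n + 1)) (∇ (fun y => c (nproj y)) (w : E (n + 1))) = 0 := by
  have h1 := hasFDerivAt_comp_nproj_gradient hU hc hw
  have h2 : HasFDerivAt (fun y => c (nproj y)) (innerSL ℝ (∇ (fun y => c (nproj y))
      (w : E (n + 1)))) ((nproj (w : E (n + 1)) : E (n + 1))) := by
    rwa [nproj_coe]
  have h3 := h2.comp (w : E (n + 1)) (hasFDerivAt_coe_nproj w)
  have h4 : ((fun y => c (nproj y)) ∘ fun y : E (n + 1) => (nproj y : E (n + 1))) =
      fun y => c (nproj y) := by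
    ext1 y
    simp [nproj_coe]
  rw [h4] at h3
  have h5 := DFunLike.congr_fun (h1.unique h3) (w : E (n + 1))
  rw [real_inner_comm]
  simpa using h5

/-- The components of the spherical Dirac operator applied to a real function `c`. -/
def diracVec (c : Sph n → ℝ) (w : Sph n) : E (n + 1) :=
  ((n : ℝ) / 2 * c w) • (w : E (n + 1)) - ∇ (fun y => c (nproj y)) (w : E (n + 1))

theorem angular_sum_smul {ι : Type*} [Fintype ι] {U : Set (Sph n)} (hU : IsOpen U)
    {c : ι → Sph n → ℝ} (hc : ∀ l, ContMDiffOn (𝓡 n) 𝓘(ℝ, ℝ) 1 (c l) U) (a : ι → Cl n)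
    {F : Sph n → Cl n} (hF : ∀ x ∈ U, F x = ∑ l, c l x • a l) {w : Sph n} (hw : w ∈ U)
    (i j : Fin (n + 1)) :
    angular i j F w = ∑ l, ((w : E (n + 1)) i * (∇ (fun y => c l (nproj y)) (w : E (n + 1))) j -
      (w : E (n + 1)) j * (∇ (fun y => c l (nproj y)) (w : E (n + 1))) i) • a l := by
  have h1 : radialExt F =ᶠ[𝓝 (w : E (n + 1))] fun y => ∑ l, c l (nproj y) • a l := by
    filter_upwards [(isOpen_cone hU).mem_nhds (coe_mem_cone.2 hw)] with y hy
    rw [radialExt_eq F hy.1, hF _ hy.2]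
  have h2 : fderiv ℝ (fun y => ∑ l, c l (nproj y) • a l) (w : E (n + 1)) = _ :=
    (HasFDerivAt.fun_sum fun l _ =>
      (hasFDerivAt_comp_nproj_gradient hU (hc l) hw).smul_const (a l)).fderiv
  rw [angular, h1.fderiv_eq, h2, _root_.sum_apply]
  refine Finset.sum_congr rfl fun l _ => ?_
  simp only [ContinuousLinearMap.smulRight_apply, innerSL_apply_apply, inner_sub_right,
    inner_smul_right, EuclideanSpace.inner_single_right]
  simp

/-- The derivatives fall on the real coefficients alone, and `w` times the bivector of the
tangential gradient is minus that gradient. So the operator acts as multiplication by vectors. -/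
theorem sphDiracL_sum_smul {ι : Type*} [Fintype ι] {U : Set (Sph n)} (hU : IsOpen U)
    {c : ι → Sph n → ℝ} (hc : ∀ l, ContMDiffOn (𝓡 n) 𝓘(ℝ, ℝ) 1 (c l) U) (a : ι → Cl n)
    {F : Sph n → Cl n} (hF : ∀ x ∈ U, F x = ∑ l, c l x • a l) {w : Sph n} (hw : w ∈ U) :
    sphDiracL F w = ∑ l, vec (diracVec (c l) w) * a l := by
  have h1 : ∑ i : Fin (n + 1), ∑ j ∈ Finset.Ioi i, e i * e j * angular i j F w =
      ∑ l, (∑ i : Fin (n + 1), ∑ j ∈ Finset.Ioi i,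
        ((w : E (n + 1)) i * (∇ (fun y => c l (nproj y)) (w : E (n + 1))) j -
          (w : E (n + 1)) j * (∇ (fun y => c l (nproj y)) (w : E (n + 1))) i) •
            (e i * e j : Cl n)) * a l := by
    simp only [angular_sum_smul hU hc a hF hw, Finset.mul_sum, Finset.sum_mul, smul_mul_assoc,
      mul_smul_comm]
    rw [Finset.sum_comm]
    simp only [Finset.sum_comm (s := Finset.univ (α := ι))]
  rw [sphDiracL, h1, hF w hw, mul_add, Finset.mul_sum, Finset.smul_sum, Finset.mul_sum,
    ← Finset.sum_add_distrib]
  refine Finset.sum_congr rfl fun l _ => ?_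
  rw [← mul_assoc, vec_mul_sum_bivector (norm_coe_sph w) (inner_gradient_comp_nproj hU (hc l) hw),
    diracVec, sub_eq_add_neg, vec_add, vec_smul, add_mul, ← vecₗ_apply (-_), map_neg, vecₗ_apply,
    add_comm]
  simp only [smul_mul_assoc, mul_smul_comm, smul_smul]

/-- The factors keep the order `w e_i e_j` when they multiply from the right, so the same vector
`diracVec` appears as in the left case. -/
theorem sphDiracR_sum_smul {ι : Type*} [Fintype ι] {U : Set (Sph n)} (hU : IsOpen U)
    {c : ι → Sph n → ℝ} (hc : ∀ l, ContMDiffOn (𝓡 n) 𝓘(ℝ, ℝ) 1 (c l) U) (a : ι → Cl n)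
    {F : Sph n → Cl n} (hF : ∀ x ∈ U, F x = ∑ l, c l x • a l) {w : Sph n} (hw : w ∈ U) :
    sphDiracR F w = ∑ l, a l * vec (diracVec (c l) w) := by
  have h1 : ∑ i : Fin (n + 1), ∑ j ∈ Finset.Ioi i,
        angular i j F w * (vec (w : E (n + 1)) * e i * e j) =
      ∑ l, a l * (vec (w : E (n + 1)) * ∑ i : Fin (n + 1), ∑ j ∈ Finset.Ioi i,
        ((w : E (n + 1)) i * (∇ (fun y => c l (nproj y)) (w : E (n + 1))) j -
          (w : E (n + 1)) j * (∇ (fun y => c l (nproj y)) (w : E (n + 1))) i) •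
            (e i * e j : Cl n)) := by
    simp only [angular_sum_smul hU hc a hF hw, Finset.mul_sum, Finset.sum_mul, smul_mul_assoc,
      mul_smul_comm, mul_assoc]
    rw [Finset.sum_comm]
    simp only [Finset.sum_comm (s := Finset.univ (α := ι))]
  rw [sphDiracR, h1, hF w hw, Finset.sum_mul, Finset.smul_sum, ← Finset.sum_add_distrib]
  refine Finset.sum_congr rfl fun l _ => ?_
  rw [vec_mul_sum_bivector (norm_coe_sph w) (inner_gradient_comp_nproj hU (hc l) hw),
    diracVec, sub_eq_add_neg, vec_add, vec_smul, mul_add, ← vecₗ_apply (-_), map_neg, vecₗ_apply,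
    add_comm]
  simp only [smul_mul_assoc, mul_smul_comm, smul_smul]

end SphericalDirac

/-! ### The pairing over the unit sphere and the projections. -/

section Pairing

variable {n k : ℕ}

theorem integrable_toSphere {F : Type*} [NormedAddCommGroup F] [NormedSpace ℝ F]
    {h : E n → F} (hh : Continuous h) :
    Integrable (fun u : sphere (0 : E n) 1 => h u) (volume : Measure (E n)).toSphere :=
  (hh.comp continuous_subtype_val).integrable_of_hasCompactSupport
    (HasCompactSupport.of_compactSpace _)

theorem continuous_mul {a b : E n → Cl n} (ha : Continuous a) (hb : Continuous b) :
    Continuous fun u => a u * b u :=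
  (mulCl n).isBoundedBilinearMap.continuous.comp (ha.prodMk hb)

theorem continuous_of_mem_homPoly {p : E n → Cl n} (hp : p ∈ homPoly n k) : Continuous p :=
  (differentiable_of_mem_homPoly hp).continuous

theorem monoR_le_homPoly : monoR n k ≤ homPoly n k := fun _ hp => mem_homPoly.2 (mem_monoR.1 hp).1

theorem pairing_add_right {P Q R : E n → Cl n} (hP : Continuous P) (hQ : Continuous Q)
    (hR : Continuous R) : pairing P (Q + R) = pairing P Q + pairing P R := by
  simp only [pairing, Pi.add_apply, mul_add]
  exact integral_add (integrable_toSphere (continuous_mul hP hQ))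
    (integrable_toSphere (continuous_mul hP hR))

theorem pairing_sum_smul_right {ι : Type*} [Fintype ι] {P : E n → Cl n} (hP : Continuous P)
    {Q : ι → E n → Cl n} (hQ : ∀ i, Continuous (Q i)) (r : ι → ℝ) :
    pairing P (fun u => ∑ i, r i • Q i u) = ∑ i, r i • pairing P (Q i) := by
  simp only [pairing, Finset.mul_sum, mul_smul_comm]
  refine (integral_finsetSum _ fun i _ =>
    (integrable_toSphere (continuous_mul hP (hQ i))).smul (r i)).trans ?_
  simp only [Pi.smul_apply, integral_smul]

theorem pairing_sum_smul_left {ι : Type*} [Fintype ι] {P : E n → Cl n} (hP : Continuous P)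
    {Q : ι → E n → Cl n} (hQ : ∀ i, Continuous (Q i)) (r : ι → ℝ) :
    pairing (fun u => ∑ i, r i • Q i u) P = ∑ i, r i • pairing (Q i) P := by
  simp only [pairing, Finset.sum_mul, smul_mul_assoc]
  refine (integral_finsetSum _ fun i _ =>
    (integrable_toSphere (continuous_mul (hQ i) hP)).smul (r i)).trans ?_
  simp only [Pi.smul_apply, integral_smul]

theorem pairing_complL (hn : 1 ≤ n) {j : ℕ} {P h : E n → Cl n} (hP : P ∈ monoR n j)
    (hh : h ∈ complLₛ n k) : pairing P h = 0 := by
  have hh' := mem_complLₛ.1 hh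
  cases k with
  | zero =>
    rw [complL, mem_singleton_iff] at hh'
    simp [pairing, hh']
  | succ k =>
    obtain ⟨q, hq, h⟩ := hh'
    simp only [pairing, h, ← mul_assoc]
    exact integral_mul_vecN_mul_eq_zero hn (mem_monoR.1 hP) hq

theorem pairing_complR (hn : 1 ≤ n) {j : ℕ} {P h : E n → Cl n} (hP : P ∈ monoL n j)
    (hh : h ∈ complRₛ n k) : pairing h P = 0 := by
  have hh' := mem_complRₛ.1 hh
  cases k with
  | zero =>
    rw [complR, mem_singleton_iff] at hh'
    simp [pairing, hh']
  | succ k =>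
    obtain ⟨q, hq, h⟩ := hh'
    simp only [pairing, h]
    exact integral_mul_vecN_mul_eq_zero hn hq hP

theorem complLₛ_le_homPoly : complLₛ n k ≤ homPoly n k := by
  cases k with
  | zero => exact bot_le
  | succ k =>
    rintro _ ⟨q, hq, rfl⟩
    exact vecN_mul_mem_homPoly (monoL_le_homPoly hq)

/-- The difference `h - projL k h` lies in the complement, which the pairing with a right monogenic
polynomial annihilates. -/
theorem pairing_projL (hn : 1 ≤ n) {P h : E n → Cl n} (hP : P ∈ monoR n k)
    (hh : h ∈ monoL n k ⊔ complLₛ n k) : pairing P (projL k h) = pairing P h := by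
  have h1 := sub_projL_mem hh
  have h2 := complLₛ_le_homPoly h1
  have h3 : h ∈ homPoly n k := (sup_le monoL_le_homPoly complLₛ_le_homPoly) hh
  have h4 : projL k h ∈ homPoly n k := by
    rw [← sub_sub_cancel h (projL k h)]
    exact Submodule.sub_mem _ h3 h2
  have h5 := pairing_add_right (continuous_of_mem_homPoly (monoR_le_homPoly hP))
    (continuous_of_mem_homPoly h4) (continuous_of_mem_homPoly h2)
  rw [add_sub_cancel, pairing_complL hn hP h1, add_zero] at h5
  exact h5.symm

/-- The vector representing the functional `v ↦ ℓ (a, v b)_u`. -/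
def momentVec (l : Module.Dual ℝ (Cl n)) (a b : E n → Cl n) : E (n + 1) :=
  WithLp.toLp 2 fun j => l (pairing a fun u => e j * b u)

theorem inner_momentVec (l : Module.Dual ℝ (Cl n)) {a b : E n → Cl n} (ha : Continuous a)
    (hb : Continuous b) (v : E (n + 1)) :
    inner ℝ (momentVec l a b) v = l (pairing a fun u => vec v * b u) := by
  have h1 : (fun u => vec v * b u) = fun u => ∑ j, v j • (e j * b u) := by
    ext1 u
    rw [vec_eq_sum, Finset.sum_mul]
    simp only [smul_mul_assoc]
  rw [h1, pairing_sum_smul_right ha fun j => continuous_mul continuous_const hb, map_sum]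
  simp [momentVec, PiLp.inner_apply]

theorem pairing_vec_assoc (a b : E n → Cl n) (v : E (n + 1)) :
    pairing (fun u => a u * vec v) b = pairing a fun u => vec v * b u := by
  simp only [pairing, mul_assoc]

end Pairing

/-! ### Divergence of tangential parts of constant fields. -/

section TangentField

variable {n : ℕ}

/-- The projection of the constant field `a` to the tangent spaces of the spheres. -/
def tangentPart (a y : E (n + 1)) : E (n + 1) :=
  a - inner ℝ a (nproj y : E (n + 1)) • (nproj y : E (n + 1))

theorem inner_tangentPart (a : E (n + 1)) {y : E (n + 1)} (hy : y ≠ 0) :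
    inner ℝ y (tangentPart a y) = 0 := by
  have h : inner ℝ (nproj y : E (n + 1)) (tangentPart a y) = 0 := by
    rw [tangentPart, inner_sub_right, inner_smul_right, real_inner_self_eq_norm_sq, norm_coe_sph,
      real_inner_comm]
    simp
  calc inner ℝ y (tangentPart a y)
      = inner ℝ (‖y‖ • (nproj y : E (n + 1))) (tangentPart a y) := by rw [smul_nproj hy]
    _ = 0 := by rw [inner_smul_left, h, mul_zero]

theorem contDiffOn_tangentPart (a : E (n + 1)) (U : Set (Sph n)) :
    ContDiffOn ℝ 1 (tangentPart a) (cone U) := fun y hy => by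
  have h : ContDiffAt ℝ 1 (fun y => (nproj y : E (n + 1))) y := contDiffAt_coe_nproj (k := 1) hy.1
  exact (contDiffAt_const.sub ((contDiffAt_const.inner ℝ h).smul h)).contDiffWithinAt

/-- The divergence on the unit sphere of a `0`-homogeneous function times the tangential part of a
constant field. -/
theorem trace_fderiv_smul_tangentPart {s : E (n + 1) → ℝ} {w : Sph n} {γ : E (n + 1)}
    (hs : HasFDerivAt s (innerSL ℝ γ) (w : E (n + 1))) (hγ : inner ℝ (w : E (n + 1)) γ = 0)
    (a : E (n + 1)) : ∃ A, HasFDerivAt (fun y => s y • tangentPart a y) A (w : E (n + 1)) ∧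
      LinearMap.trace ℝ _ A.toLinearMap =
        inner ℝ a γ - n * s w * inner ℝ a (w : E (n + 1)) := by
  have hN := hasFDerivAt_coe_nproj w
  set D := ContinuousLinearMap.id ℝ (E (n + 1)) -
    (innerSL ℝ (w : E (n + 1))).smulRight (w : E (n + 1)) with hD
  have hi : HasFDerivAt (fun y => inner ℝ a (nproj y : E (n + 1))) ((innerSL ℝ a).comp D)
      (w : E (n + 1)) := (innerSL ℝ a).hasFDerivAt.comp (w : E (n + 1)) hN
  have hT : HasFDerivAt (tangentPart a) _ (w : E (n + 1)) :=
    (hi.fun_smul hN).const_sub a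
  have hF := hs.fun_smul hT
  refine ⟨_, hF, ?_⟩
  -- `D` is the orthogonal projection to the tangent space at `w`: it annihilates `w`, which removes
  -- the rank one part of the derivative of `tangentPart`, and its trace `n` yields the curvature
  -- term.
  have hDw : D (w : E (n + 1)) = 0 := by
    simp [hD]
  have hDt : LinearMap.trace ℝ _ D.toLinearMap = n := by
    rw [hD, ContinuousLinearMap.toLinearMap_sub, map_sub]
    have h1 : LinearMap.trace ℝ (E (n + 1)) ((innerSL ℝ (w : E (n + 1))).smulRight
        (w : E (n + 1))).toLinearMap = inner ℝ (w : E (n + 1)) (w : E (n + 1)) :=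
      LinearMap.trace_smulRight (innerSL ℝ (w : E (n + 1))).toLinearMap (w : E (n + 1))
    have h2 : (ContinuousLinearMap.id ℝ (E (n + 1))).toLinearMap = LinearMap.id := rfl
    rw [h1, h2, real_inner_self_eq_norm_sq, norm_coe_sph, LinearMap.trace_id,
      finrank_euclideanSpace_fin]
    push_cast
    ring
  have h2 : ∀ (b : E (n + 1) →L[ℝ] ℝ) (x : E (n + 1)),
      LinearMap.trace ℝ (E (n + 1)) (b.smulRight x).toLinearMap = b x := fun b x =>
    LinearMap.trace_smulRight b.toLinearMap x
  rw [ContinuousLinearMap.toLinearMap_add, map_add, ContinuousLinearMap.toLinearMap_smul, map_smul,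
    ContinuousLinearMap.toLinearMap_neg, map_neg, ContinuousLinearMap.toLinearMap_add, map_add,
    ContinuousLinearMap.toLinearMap_smul, map_smul, h2, h2, hDt, nproj_coe,
    ContinuousLinearMap.comp_apply, hDw, map_zero, tangentPart, nproj_coe, innerSL_apply_apply,
    inner_sub_right, inner_smul_right, real_inner_comm (w : E (n + 1)) γ, hγ, real_inner_comm a γ]
  simp only [smul_eq_mul]
  ring

/-- The derivative of a field constant along rays is homogeneous of degree `-1`, so its trace has to
be computed on the unit sphere only. -/
theorem trace_fderiv_eq_zero_of_smul {X : E (n + 1) → E (n + 1)}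
    (hXh : ∀ r : ℝ, 0 < r → ∀ y, X (r • y) = X y) {y : E (n + 1)} (hy : y ≠ 0)
    (h : LinearMap.trace ℝ _ (fderiv ℝ X (nproj y : E (n + 1))).toLinearMap = 0) :
    LinearMap.trace ℝ _ (fderiv ℝ X y).toLinearMap = 0 := by
  have hy0 : 0 < ‖y‖⁻¹ := inv_pos.2 (norm_pos_iff.2 hy)
  have h1 : (X <| ‖y‖⁻¹ • ·) = X := funext fun z => hXh _ hy0 z
  have h2 : fderiv ℝ (X <| ‖y‖⁻¹ • ·) y = ‖y‖⁻¹ • fderiv ℝ X (‖y‖⁻¹ • y) := fderiv_comp_smul _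
  rw [h1, ← coe_nproj hy] at h2
  rw [h2, ContinuousLinearMap.toLinearMap_smul, map_smul, h, smul_zero]

end TangentField

/-! ### The field behind the boundary integrand, and Cauchy's theorem. -/

section CauchyTheorem

variable {m k : ℕ}

/-- The equation for `f` is tested against a fixed right monogenic `a` rather than against `g`. The
projection disappears under the pairing, and what remains is linear in the Dirac vectors of the
coefficients. -/
theorem pairing_sphDirac_eq_zero {n : ℕ} (hn : 1 ≤ n) {U : Set (Sph n)} (hU : IsOpen U)
    {f : Sph n → E n → Cl n} {d : ℕ} {b : Fin d → E n → Cl n} {c : Fin d → Sph n → ℝ}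
    (hb : ∀ i, b i ∈ monoL n k) (hc : ∀ i, ContMDiffOn (𝓡 n) 𝓘(ℝ, ℝ) 1 (c i) U)
    (hfc : ∀ x ∈ U, f x = ∑ i, c i x • b i) {x : Sph n} (hx : x ∈ U)
    (hR : ∀ u, raritaL k f x u = 0) {a : E n → Cl n} (ha : a ∈ monoR n k)
    (l : Module.Dual ℝ (Cl n)) :
    ∑ i, inner ℝ (momentVec l a (b i)) (diracVec (c i) x) = 0 := by
  have h1 : (fun u => sphDiracL (fun y => f y u) x) =
      ∑ i, fun u => vec (diracVec (c i) x) * b i u := by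
    ext1 u
    rw [Finset.sum_apply, sphDiracL_sum_smul hU hc (fun i => b i u) (fun y hy => ?_) hx]
    simp [hfc y hy]
  have h2 : (fun u => sphDiracL (fun y => f y u) x) ∈ monoL n k ⊔ complLₛ n k := by
    rw [h1]
    exact Submodule.sum_mem _ fun i _ => vec_mul_mem_sup hn _ (hb i)
  have h3 := pairing_projL hn ha h2
  have h4 : projL k (fun u => sphDiracL (fun y => f y u) x) = 0 := funext hR
  have hac := continuous_of_mem_homPoly (monoR_le_homPoly ha)
  have hbc := fun i => continuous_of_mem_homPoly (monoL_le_homPoly (hb i))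
  have h5 := pairing_sum_smul_right hac
    (fun i => continuous_mul (continuous_const (y := vec (diracVec (c i) x))) (hbc i)) fun _ => 1
  have h6 : (fun u => ∑ i, (1 : ℝ) • (vec (diracVec (c i) x) * b i u)) =
      ∑ i, fun u => vec (diracVec (c i) x) * b i u := by
    ext1 u
    simp
  rw [h6, ← h1, ← h3, h4] at h5
  simp only [inner_momentVec l hac (hbc _)]
  rw [← map_sum]
  simp only [one_smul] at h5
  rw [← h5]
  simp [pairing]

theorem pairing_dirac_right_eq_zero {n : ℕ} (hn : 1 ≤ n) {U : Set (Sph n)} (hU : IsOpen U)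
    {g : Sph n → E n → Cl n} {d : ℕ} {b : Fin d → E n → Cl n} {c : Fin d → Sph n → ℝ}
    (hb : ∀ i, b i ∈ monoR n k) (hc : ∀ i, ContMDiffOn (𝓡 n) 𝓘(ℝ, ℝ) 1 (c i) U)
    (hgc : ∀ x ∈ U, g x = ∑ i, c i x • b i) {x : Sph n} (hx : x ∈ U)
    (hR : ∀ u, raritaR k g x u = 0) {a : E n → Cl n} (ha : a ∈ monoL n k)
    (l : Module.Dual ℝ (Cl n)) :
    ∑ i, inner ℝ (momentVec l (b i) a) (diracVec (c i) x) = 0 := by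
  have h1 : (fun u => sphDiracR (fun y => g y u) x) =
      ∑ i, fun u => b i u * vec (diracVec (c i) x) := by
    ext1 u
    rw [Finset.sum_apply, sphDiracR_sum_smul hU hc (fun i => b i u) (fun y hy => ?_) hx]
    simp [hgc y hy]
  have h2 : (fun u => sphDiracR (fun y => g y u) x) ∈ monoR n k ⊔ complRₛ n k := by
    rw [h1]
    exact Submodule.sum_mem _ fun i _ => mul_vec_mem_sup hn _ (hb i)
  have h3 := sub_projR_mem h2
  have h4 : projR k (fun u => sphDiracR (fun y => g y u) x) = 0 := funext hR
  rw [h4, sub_zero] at h3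
  have h5 := pairing_complR hn ha h3
  have hac := continuous_of_mem_homPoly (monoL_le_homPoly ha)
  have hbc := fun i => continuous_of_mem_homPoly (monoR_le_homPoly (hb i))
  have h6 := pairing_sum_smul_left hac
    (fun i => continuous_mul (hbc i) (continuous_const (y := vec (diracVec (c i) x)))) fun _ => 1
  have h7 : (fun u => ∑ i, (1 : ℝ) • (b i u * vec (diracVec (c i) x))) =
      ∑ i, fun u => b i u * vec (diracVec (c i) x) := by
    ext1 u
    simp
  rw [h7, ← h1, h5] at h6
  simp only [inner_momentVec l (hbc _) hac, ← pairing_vec_assoc]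
  rw [← map_sum]
  simp only [one_smul] at h6
  rw [← h6, map_zero]

/-- After the projection has been dropped under the pairing, the integrand is bilinear over the
reals in the two families of coefficients. -/
theorem boundaryForm_eq_sum {n : ℕ} (hn : 1 ≤ n) {V : Set (Sph n)} {f g : Sph n → E n → Cl n}
    {d d' : ℕ} {b : Fin d → E n → Cl n} {c : Fin d → Sph n → ℝ} {b' : Fin d' → E n → Cl n}
    {c' : Fin d' → Sph n → ℝ} (hb : ∀ i, b i ∈ monoL n k) (hb' : ∀ i, b' i ∈ monoR n k)
    {x : Sph n} (hf : f x = ∑ i, c i x • b i) (hg : g x = ∑ i, c' i x • b' i) :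
    boundaryForm k V f g x = ∑ l, ∑ i, (c' l x * c i x) •
      pairing (b' l) fun u => vec (outwardNormal V x) * b i u := by
  have hfm : f x ∈ monoL n k := by
    rw [hf]
    exact Submodule.sum_mem _ fun i _ => Submodule.smul_mem _ _ (hb i)
  have hgm : g x ∈ monoR n k := by
    rw [hg]
    exact Submodule.sum_mem _ fun i _ => Submodule.smul_mem _ _ (hb' i)
  have hbc := fun i => continuous_of_mem_homPoly (monoL_le_homPoly (hb i))
  have hbc' := fun i => continuous_of_mem_homPoly (monoR_le_homPoly (hb' i))
  have hgc := continuous_of_mem_homPoly (monoR_le_homPoly hgm)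
  have h1 : (fun u => vec (outwardNormal V x) * f x u) =
      fun u => ∑ i, c i x • (vec (outwardNormal V x) * b i u) := by
    ext1 u
    simp [hf, Finset.mul_sum]
  have h2 : g x = fun u => ∑ l, c' l x • b' l u := by
    ext1 u
    simp [hg]
  have hvc := fun i => continuous_mul (continuous_const (y := vec (outwardNormal V x))) (hbc i)
  rw [boundaryForm, pairing_projL hn hgm (vec_mul_mem_sup hn _ hfm), h1,
    pairing_sum_smul_right hgc hvc]
  rw [Finset.sum_comm]
  refine Finset.sum_congr rfl fun i _ => ?_
  rw [h2, pairing_sum_smul_left (hvc i) hbc', Finset.smul_sum]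
  refine Finset.sum_congr rfl fun l _ => ?_
  rw [smul_smul, mul_comm]

/-- Each real component of Cauchy's theorem. -/
theorem integral_dual_boundaryForm {U V : Set (Sph (m + 1))} (hUo : IsOpen U) (hVo : IsOpen V)
    (hVU : V ⊆ U) (hbU : frontier V ⊆ U) (hbdry : HasC1Boundary V)
    {f g : Sph (m + 1) → E (m + 1) → Cl (m + 1)} (hf : IsC1On U f) (hg : IsC1On U g)
    (hfM : ∀ x ∈ U, f x ∈ monogenicL (m + 1) k) (hgM : ∀ x ∈ U, g x ∈ monogenicR (m + 1) k)
    (hRf : ∀ x ∈ U, ∀ u, raritaL k f x u = 0) (hRg : ∀ x ∈ U, ∀ u, raritaR k g x u = 0)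
    (l : Module.Dual ℝ (Cl (m + 1))) :
    IntegrableOn (fun x => l (boundaryForm k V f g x)) (frontier V) (surfaceMeasure (m + 1)) ∧
      ∫ x in frontier V, l (boundaryForm k V f g x) ∂surfaceMeasure (m + 1) = 0 := by
  have hn : 1 ≤ m + 1 := Nat.le_add_left 1 m
  obtain ⟨d, b, c, hb, hc, hfc⟩ := hf.exists_coordinates (monoL (m + 1) k) hfM
  obtain ⟨d', b', c', hb', hc', hgc⟩ := hg.exists_coordinates (monoR (m + 1) k)
    fun x hx => mem_monoR.2 (hgM x hx)
  have hbc := fun i => continuous_of_mem_homPoly (monoL_le_homPoly (hb i))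
  have hbc' := fun i => continuous_of_mem_homPoly (monoR_le_homPoly (hb' i))
  set M : Fin d' → Fin d → E (m + 2) := fun j i => momentVec l (b' j) (b i) with hM
  set X : E (m + 2) → E (m + 2) := fun y =>
    ∑ j, ∑ i, (c' j (nproj y) * c i (nproj y)) • tangentPart (M j i) y with hX
  have hXd : ContDiffOn ℝ 1 X (cone U) := ContDiffOn.sum fun j _ => ContDiffOn.sum fun i _ =>
    ((ContMDiffOn.contDiffOn_comp_nproj hUo (hc' j)).mul
      (ContMDiffOn.contDiffOn_comp_nproj hUo (hc i))).smul
      (contDiffOn_tangentPart _ U)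
  have hXh : ∀ r : ℝ, 0 < r → ∀ y, X (r • y) = X y := fun r hr y => by
    by_cases hy : y = 0
    · rw [hy, smul_zero]
    · simp only [hX, tangentPart, nproj_smul hr hy]
  have hXt : ∀ y ∈ cone U, inner ℝ y (X y) = 0 := fun y hy => by
    simp [hX, inner_sum, inner_smul_right, inner_tangentPart _ hy.1]
  have hdiv : ∀ y ∈ cone V, LinearMap.trace ℝ _ (fderiv ℝ X y).toLinearMap = 0 := by
    intro y hy
    refine trace_fderiv_eq_zero_of_smul hXh hy.1 ?_
    have hw : nproj y ∈ U := hVU hy.2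
    generalize nproj y = w at hw
    set γ := fun i => ∇ (fun y => c i (nproj y)) (w : E (m + 2)) with hγ
    set γ' := fun j => ∇ (fun y => c' j (nproj y)) (w : E (m + 2)) with hγ'
    -- The divergence consists of the two gradient terms and `-n c' c ⟨M, w⟩`. Each vector
    -- `diracVec` contains `n/2` times its coefficient times `w`, so the last term is shared equally
    -- between the two.
    have hA : ∀ j i, ∃ A, HasFDerivAt
        (fun y => (c' j (nproj y) * c i (nproj y)) • tangentPart (M j i) y) A (w : E (m + 2)) ∧
        LinearMap.trace ℝ _ A.toLinearMap =
          -(c' j w * inner ℝ (M j i) (diracVec (c i) w)) -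
            c i w * inner ℝ (M j i) (diracVec (c' j) w) := by
      intro j i
      have h1 := (hasFDerivAt_comp_nproj_gradient hUo (hc' j) hw).fun_mul
        (hasFDerivAt_comp_nproj_gradient hUo (hc i) hw)
      have h2 : HasFDerivAt (fun y => c' j (nproj y) * c i (nproj y))
          (innerSL ℝ (c' j w • γ i + c i w • γ' j)) (w : E (m + 2)) := by
        simp only [nproj_coe] at h1
        rw [map_add, map_smul, map_smul]
        exact h1
      have h3 : inner ℝ (w : E (m + 2)) (c' j w • γ i + c i w • γ' j) = 0 := by
        rw [inner_add_right, inner_smul_right, inner_smul_right,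
          inner_gradient_comp_nproj hUo (hc i) hw, inner_gradient_comp_nproj hUo (hc' j) hw]
        simp
      obtain ⟨A, hA, htr⟩ := trace_fderiv_smul_tangentPart h2 h3 (M j i)
      refine ⟨A, hA, ?_⟩
      rw [htr, diracVec, diracVec, inner_add_right, inner_sub_right, inner_sub_right]
      simp only [inner_smul_right, nproj_coe]
      ring
    choose A hA htr using hA
    have hXA : fderiv ℝ X (w : E (m + 2)) = ∑ j, ∑ i, A j i :=
      (HasFDerivAt.fun_sum fun j _ => HasFDerivAt.fun_sum fun i _ => hA j i).fderiv
    rw [hXA]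
    simp only [ContinuousLinearMap.toLinearMap_sum, map_sum, htr, Finset.sum_sub_distrib,
      Finset.sum_neg_distrib]
    -- The two halves are summed in opposite orders: for fixed `j` the sum over `i` is the equation
    -- for `f` tested on `b' j`, and for fixed `i` the sum over `j` is the equation for `g` tested
    -- on `b i`.
    rw [Finset.sum_comm (f := fun j i => c i w * inner ℝ (M j i) (diracVec (c' j) w))]
    simp only [← Finset.mul_sum, hM]
    rw [Finset.sum_eq_zero fun j _ => by
        rw [pairing_sphDirac_eq_zero hn hUo hb hc hfc hw (hRf w hw) (hb' j) l, mul_zero],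
      Finset.sum_eq_zero fun i _ => by
        rw [pairing_dirac_right_eq_zero hn hUo hb' hc' hgc hw (hRg w hw) (hb i) l, mul_zero]]
    simp
  have hform : ∀ x ∈ frontier V,
      l (boundaryForm k V f g x) = inner ℝ (outwardNormal V x) (X x) := by
    intro x hx
    rw [boundaryForm_eq_sum hn hb hb' (hfc x (hbU hx)) (hgc x (hbU hx))]
    simp only [map_sum, map_smul, hX, inner_sum, inner_smul_right, nproj_coe, smul_eq_mul]
    refine Finset.sum_congr rfl fun j _ => Finset.sum_congr rfl fun i _ => ?_
    -- The outward normal is tangent to the sphere, so it does not see the radial component removed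
    -- from `M j i`.
    rw [tangentPart, nproj_coe, inner_sub_right, inner_smul_right,
      real_inner_comm (x : E (m + 2)) (outwardNormal V x), inner_outwardNormal, mul_zero, sub_zero,
      real_inner_comm, inner_momentVec l (hbc' j) (hbc i)]
  obtain ⟨h1, h2⟩ := integral_boundary_eq_zero hUo hVo hVU hbU hbdry hXd hXh hXt hdiv
  have hfm : MeasurableSet (frontier V) := isClosed_frontier.measurableSet
  exact ⟨h1.congr_fun (fun x hx => (hform x hx).symm) hfm,
    (setIntegral_congr_fun hfm hform).trans h2⟩

end CauchyTheorem

end SphericalRS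

end

theorem mainTheorem7 (n k : ℕ) (hn : 1 ≤ n)
    (U V : Set (SphericalRS.Sph n))
    (hUo : IsOpen U) (hUc : IsConnected U)
    (hVo : IsOpen V) (hVc : IsConnected V)
    (hVU : V ⊆ U) (hbU : frontier V ⊆ U)
    (hbdry : SphericalRS.HasC1Boundary V)
    (f g : SphericalRS.Sph n → SphericalRS.E n → SphericalRS.Cl n)
    (hf : SphericalRS.IsC1On U f) (hg : SphericalRS.IsC1On U g)
    (hfM : ∀ x ∈ U, f x ∈ SphericalRS.monogenicL n k)
    (hgM : ∀ x ∈ U, g x ∈ SphericalRS.monogenicR n k)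
    (hRf : ∀ x ∈ U, ∀ u, SphericalRS.raritaL k f x u = 0)
    (hRg : ∀ x ∈ U, ∀ u, SphericalRS.raritaR k g x u = 0) :
    IntegrableOn (SphericalRS.boundaryForm k V f g) (frontier V) (SphericalRS.surfaceMeasure n) ∧
      ∫ x in frontier V, SphericalRS.boundaryForm k V f g x ∂(SphericalRS.surfaceMeasure n) = 0 := by
  -- With `n = m + 1` the boundary dimension `n - 1` is `m`; the vector-valued statement then
  -- follows from the coordinates in the basis `e_A`.
  obtain ⟨m, rfl⟩ : ∃ m, n = m + 1 := ⟨n - 1, by omega⟩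
  have h := fun A => SphericalRS.integral_dual_boundaryForm hUo hVo hVU hbU hbdry hf hg hfM hgM
    hRf hRg ((SphericalRS.basisCl (m + 1)).coord A)
  have hsum : SphericalRS.boundaryForm k V f g = fun x => ∑ A,
      (SphericalRS.basisCl (m + 1)).coord A (SphericalRS.boundaryForm k V f g x) •
        SphericalRS.basisCl (m + 1) A :=
    funext fun x => ((SphericalRS.basisCl (m + 1)).sum_repr _).symm
  have hint := fun A => (h A).1.smul_const (SphericalRS.basisCl (m + 1) A)
  rw [hsum]
  refine ⟨integrable_finsetSum _ fun A _ => hint A, ?_⟩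
  rw [integral_finsetSum _ fun A _ => hint A]
  refine Finset.sum_eq_zero fun A _ => ?_
  rw [integral_smul_const, (h A).2, zero_smul]
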